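/- Let $q\in\mathbb{C}$ with $0<|q|<1$. Put $(x;q)_\infty=\prod_{i\ge 0}(1-q^ix)$, $j(x;q)=(x;q)_\infty(q/x;q)_\infty(q;q)_\infty$, $J_m=\prod_{i\ge1}(1-q^{mi})$, $$m(x,q,z)=\frac{1}{j(z;q)}\sum_{r\in\mathbb{Z}}\frac{(-1)^rq^{r(r-1)/2}z^r}{1-q^{r-1}xz},$$ and $\mathrm{sg}(r)=1$ for $r\ge 0$, $\mathrm{sg}(r)=-1$ for $r<0$. Define \begin{align*} G(x,y,z;q)={}&\frac{J_4^3\,j(y^2z^2;q^4)}{j(y^2;q^4)j(z^2;q^4)}\,m\Big(-\frac{qx}{yz},q^2,-yz\Big)+\frac{J_4^3\,j(x^2z^2;q^4)}{j(x^2;q^4)j(z^2;q^4)}\,m\Big(-\frac{qy}{xz},q^2,-xz\Big)\\ &+\frac{J_1^3J_2^3}{j(x;q)j(y;q)j(z;q)}\cdot\frac{j(xy;q^2)j(xz;q^2)j(yz;q^2)}{j(-x;q^2)j(-y;q^2)j(-z;q^2)}+\frac{J_4^3\,j(x^2y^2;q^4)}{j(x^2;q^4)j(y^2;q^4)}\,m\Big(-\frac{qz}{xy},q^2,-xy\Big)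 \end{align*} and $$F(x,y,z;q)=\sum_{\mathrm{sg}(s)=\mathrm{sg}(t)}\mathrm{sg}(s)\frac{q^{4st}y^{2s}z^{2t}}{1-x^2q^{4s+4t}}+x\sum_{\mathrm{sg}(s)=\mathrm{sg}(t)}\mathrm{sg}(s)\frac{q^{4st+4s+4t+3}y^{2s+1}z^{2t+1}}{1-x^2q^{4s+4t+4}},$$ the sums being over $s,t\in\mathbb{Z}$. (1) If $x,y,z\in\mathbb{C}$ satisfy $|q|<|x|<1$, $|q|<|y|<1$ and $|q|<|z|<1$, then, the series being absolutely convergent, $$\sum_{\substack{\mathrm{sg}(r)=\mathrm{sg}(s)=\mathrm{sg}(t)\\ r\equiv s\equiv t\ (\mathrm{mod}\ 2)}}q^{rs+rt+st}x^ry^sz^t=G(x,y,z;q).$$ (2) More strongly, let $x,y,z\in\mathbb{C}$ with $|q|<|y|<1$, $|q|<|z|<1$, $x\neq0$ and $x\neq\pm q^{2n}$ for all $n\in\mathbb{Z}$. Then both series in $F(x,y,z;q)$ converge absolutely and $F(x,y,z;q)=G(x,y,z;q)$. Here, at the points $x$ where a denominator in $G$ vanishes (those with $x=q^{2n+1}$,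 $xy=-q^{2n}$ or $xz=-q^{2n}$ for some $n\in\mathbb{Z}$), $G$ has a removable singularity in $x$, and its value is understood as the limit $\lim_{w\to x}G(w,y,z;q)$. -/

import Mathlib

open Filter Topology

noncomputable section

namespace TripleSum

/-- The infinite `q`-Pochhammer symbol `(x;q)_∞ = ∏_{i ≥ 0} (1 - q^i x)`. -/
def qPoch (x q : ℂ) : ℂ := ∏' i : ℕ, (1 - q ^ i * x)

/-- The theta function `j(x;q) = (x;q)_∞ (q/x;q)_∞ (q;q)_∞`. -/
def j (x q : ℂ) : ℂ := qPoch x q * qPoch (q / x) q * qPoch q q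

/-- `J_m = ∏_{i ≥ 1} (1 - q^{m i}) = (q^m;q^m)_∞`. -/
def J (q : ℂ) (m : ℕ) : ℂ := qPoch (q ^ m) (q ^ m)

/-- The Appell-Lerch function
`m(x,q,z) = j(z;q)⁻¹ ∑_{r ∈ ℤ} (-1)^r q^{r(r-1)/2} z^r / (1 - q^{r-1} x z)`.
The integer division in the exponent is exact. -/
def appellLerch (x q z : ℂ) : ℂ :=
  1 / j z q *
    ∑' r : ℤ, (-1) ^ r * q ^ (r * (r - 1) / 2) * z ^ r / (1 - q ^ (r - 1) * x * z)

/-- `sg r = 1` if `r ≥ 0` and `sg r = -1` if `r < 0`. -/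
def sg (r : ℤ) : ℤ := if 0 ≤ r then 1 else -1

/-- Triples with `sg r = sg s = sg t` and `r ≡ s ≡ t (mod 2)`. -/
def sameParityTriples : Set (ℤ × ℤ × ℤ) :=
  {p | (sg p.1 = sg p.2.1 ∧ sg p.2.1 = sg p.2.2) ∧
    (p.1 ≡ p.2.1 [ZMOD 2] ∧ p.2.1 ≡ p.2.2 [ZMOD 2])}

/-- The term `q^{rs+rt+st} x^r y^s z^t`, with `p = (r, s, t)`. -/
def tripleTerm (x y z q : ℂ) (p : ℤ × ℤ × ℤ) : ℂ :=
  q ^ (p.1 * p.2.1 + p.1 * p.2.2 + p.2.1 * p.2.2) * x ^ p.1 * y ^ p.2.1 * z ^ p.2.2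

/-- Pairs with `sg s = sg t`. -/
def sameSignPairs : Set (ℤ × ℤ) := {p | sg p.1 = sg p.2}

/-- The term `sg(s) q^{4st} y^{2s} z^{2t} / (1 - x² q^{4s+4t})`, with `p = (s, t)`. -/
def evenTerm (x y z q : ℂ) (p : ℤ × ℤ) : ℂ :=
  (sg p.1 : ℂ) * (q ^ (4 * p.1 * p.2) * y ^ (2 * p.1) * z ^ (2 * p.2) /
    (1 - x ^ 2 * q ^ (4 * p.1 + 4 * p.2)))

/-- The term `sg(s) q^{4st+4s+4t+3} y^{2s+1} z^{2t+1} / (1 - x² q^{4s+4t+4})`,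
with `p = (s, t)`. -/
def oddTerm (x y z q : ℂ) (p : ℤ × ℤ) : ℂ :=
  (sg p.1 : ℂ) * (q ^ (4 * p.1 * p.2 + 4 * p.1 + 4 * p.2 + 3) *
    y ^ (2 * p.1 + 1) * z ^ (2 * p.2 + 1) / (1 - x ^ 2 * q ^ (4 * p.1 + 4 * p.2 + 4)))

/-- The double-sum side of the stronger identity. -/
def F (x y z q : ℂ) : ℂ :=
  (∑' p : sameSignPairs, evenTerm x y z q p) + x * (∑' p : sameSignPairs, oddTerm x y z q p)

/-- The Appell-Lerch and theta side. -/
def G (x y z q : ℂ) : ℂ :=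
  J q 4 ^ 3 * j (y ^ 2 * z ^ 2) (q ^ 4) / (j (y ^ 2) (q ^ 4) * j (z ^ 2) (q ^ 4)) *
      appellLerch (-(q * x / (y * z))) (q ^ 2) (-(y * z))
    + J q 4 ^ 3 * j (x ^ 2 * z ^ 2) (q ^ 4) / (j (x ^ 2) (q ^ 4) * j (z ^ 2) (q ^ 4)) *
      appellLerch (-(q * y / (x * z))) (q ^ 2) (-(x * z))
    + J q 1 ^ 3 * J q 2 ^ 3 / (j x q * j y q * j z q) *
      (j (x * y) (q ^ 2) * j (x * z) (q ^ 2) * j (y * z) (q ^ 2) /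
        (j (-x) (q ^ 2) * j (-y) (q ^ 2) * j (-z) (q ^ 2)))
    + J q 4 ^ 3 * j (x ^ 2 * y ^ 2) (q ^ 4) / (j (x ^ 2) (q ^ 4) * j (y ^ 2) (q ^ 4)) *
      appellLerch (-(q * z / (x * y))) (q ^ 2) (-(x * y))

end TripleSum

end

/-! The parity condition splits the triple sum into two families, and summing the geometric series
in `r` turns each of them into one of the two double sums of `F`. It remains to prove `F = G`, for
fixed `y` and `z`, as meromorphic functions of `x`. After the zeros of the theta quotients in `G`
have been cancelled against the poles of the Appell–Lerch sums, the difference `D = F - G` satisfies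
`D (q² x) = q / (y z) · x · D x`, a consequence of Kronecker's identity `∑ a^r / (1 - b p^r) =
(p;p)_∞³ j(ab;p) / (j(a;p) j(b;p))`. Its possible poles are the points `q^(2n) ε` with `ε ∈ {1, -1,
q}`, all simple, and by the functional equation it is enough to compare residues at `ε` itself. At
`ε = q` the residues cancel directly; at `ε = ±1` they cancel by the formula for the change of
parameter in an Appell–Lerch sum. So `D` is holomorphic on the punctured plane. The functional
equation bounds `D` near `0`, hence `D` extends to an entire function, and comparing leading Taylor
coefficients at `0` forces `D = 0`. -/

noncomputable section

namespace TripleSum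

/-- A nome: a complex number `q` with `0 < |q| < 1`, the base of all theta functions below. -/
structure IsNome (q : ℂ) : Prop where
  ne_zero : q ≠ 0
  norm_lt_one : ‖q‖ < 1

namespace IsNome

variable {q : ℂ}

lemma norm_pos (hq : IsNome q) : 0 < ‖q‖ := norm_pos_iff.2 hq.ne_zero

lemma pow (hq : IsNome q) {n : ℕ} (hn : n ≠ 0) : IsNome (q ^ n) where
  ne_zero := pow_ne_zero n hq.ne_zero
  norm_lt_one := by rw [norm_pow]; exact pow_lt_one₀ (norm_nonneg q) hq.norm_lt_one hn

lemma sq (hq : IsNome q) : IsNome (q ^ 2) := hq.pow two_ne_zero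

lemma pow_four (hq : IsNome q) : IsNome (q ^ 4) := hq.pow four_ne_zero

lemma zpow_eq_one_iff (hq : IsNome q) {n : ℤ} : q ^ n = 1 ↔ n = 0 := by
  refine ⟨fun h => ?_, fun h => by rw [h, zpow_zero]⟩
  have hn : ‖q‖ ^ n = 1 := by rw [← norm_zpow, h, norm_one]
  exact (zpow_eq_one_iff_right₀ (norm_nonneg q) hq.norm_lt_one.ne).1 hn

end IsNome

section Punctured

variable {f g : ℂ → ℂ} {c k l : ℂ}

lemma tendsto_punctured (hf : ContinuousAt f c) : Tendsto f (𝓝[≠] c) (𝓝 (f c)) :=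
  hf.tendsto.mono_left nhdsWithin_le_nhds

lemma eventually_punctured_ne (h : c ≠ l) : ∀ᶠ w in 𝓝[≠] c, w ≠ l :=
  nhdsWithin_le_nhds (isOpen_ne.mem_nhds h)

lemma tendsto_const_mul_punctured (hk : k ≠ 0) (c : ℂ) :
    Tendsto (fun w => k * w) (𝓝[≠] c) (𝓝[≠] (k * c)) :=
  tendsto_nhdsWithin_iff.2 ⟨tendsto_punctured (by fun_prop),
    eventually_mem_nhdsWithin.mono fun _ hw h => hw (mul_left_cancel₀ hk h)⟩

lemma eq_of_eventually_eq_punctured (hf : ContinuousAt f c) (hg : ContinuousAt g c)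
    (h : ∀ᶠ w in 𝓝[≠] c, f w = g w) : f c = g c :=
  tendsto_nhds_unique_of_eventuallyEq (tendsto_punctured hf) (tendsto_punctured hg) h

end Punctured

/-- `f` has at most a simple pole at `c`, with residue `r`, expressed through the limit of
`(w - c) f(w)`, which does not depend on the junk value `f c`. -/
def HasResidueAt (f : ℂ → ℂ) (c r : ℂ) : Prop :=
  Tendsto (fun w => (w - c) * f w) (𝓝[≠] c) (𝓝 r)

lemma hasResidueAt_zero_of_continuousAt {f : ℂ → ℂ} {c : ℂ} (hf : ContinuousAt f c) :
    HasResidueAt f c 0 := by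
  have h : ContinuousAt (fun w => (w - c) * f w) c := by fun_prop
  simpa [HasResidueAt] using tendsto_punctured h

namespace HasResidueAt

variable {f g : ℂ → ℂ} {c r s : ℂ}

lemma congr (hf : HasResidueAt f c r) (h : f =ᶠ[𝓝[≠] c] g) : HasResidueAt g c r :=
  Tendsto.congr' (h.mono fun w hw => by simp only [hw]) hf

lemma add (hf : HasResidueAt f c r) (hg : HasResidueAt g c s) :
    HasResidueAt (fun w => f w + g w) c (r + s) := by
  simpa only [HasResidueAt, mul_add] using Tendsto.add hf hg

lemma sub (hf : HasResidueAt f c r) (hg : HasResidueAt g c s) :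
    HasResidueAt (fun w => f w - g w) c (r - s) := by
  simpa only [HasResidueAt, mul_sub] using Tendsto.sub hf hg

lemma mul_continuousAt (hf : HasResidueAt f c r) (hg : ContinuousAt g c) :
    HasResidueAt (fun w => f w * g w) c (r * g c) := by
  simpa only [HasResidueAt, mul_assoc] using Tendsto.mul hf (tendsto_punctured hg)

lemma const_mul (hf : HasResidueAt f c r) (k : ℂ) : HasResidueAt (fun w => k * f w) c (k * r) := by
  simpa only [mul_comm k] using hf.mul_continuousAt (g := fun _ => k) continuousAt_const

lemma div_const (hf : HasResidueAt f c r) (k : ℂ) : HasResidueAt (fun w => f w / k) c (r / k) := by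
  simpa only [div_eq_mul_inv] using hf.mul_continuousAt (g := fun _ => k⁻¹) continuousAt_const

lemma comp {g' : ℂ} (hf : HasResidueAt f (g c) r) (hg : HasDerivAt g g' c) (hg' : g' ≠ 0) :
    HasResidueAt (fun w => f (g w)) c (r / g') := by
  have hslope : Tendsto (fun w => (slope g c w)⁻¹) (𝓝[≠] c) (𝓝 g'⁻¹) := hg.tendsto_slope.inv₀ hg'
  have hne : ∀ᶠ w in 𝓝[≠] c, g w ≠ g c := hg.eventually_ne hg'
  have hgc : Tendsto g (𝓝[≠] c) (𝓝[≠] (g c)) :=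
    tendsto_nhdsWithin_iff.2 ⟨tendsto_punctured hg.continuousAt, hne⟩
  refine ((Tendsto.comp hf hgc).mul hslope).congr' ?_
  filter_upwards [hne] with w hw
  have hw' : g w - g c ≠ 0 := sub_ne_zero.2 hw
  rw [Function.comp_apply, slope_def_field, inv_div]
  field_simp

end HasResidueAt

lemma hasResidueAt_div {f g : ℂ → ℂ} {c g' : ℂ} (hf : ContinuousAt f c) (hg : HasDerivAt g g' c)
    (hgc : g c = 0) (hg' : g' ≠ 0) : HasResidueAt (fun w => f w / g w) c (f c / g') := by
  refine ((tendsto_punctured hf).div hg.tendsto_slope hg').congr fun w => ?_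
  rw [Pi.div_apply, slope_def_field, hgc, sub_zero, div_div_eq_mul_div]
  ring

section Removable

variable {f : ℂ → ℂ} {c : ℂ}

/-- The function `f` with its removable singularities filled in: its value at `x` is the limit of
`f` along punctured neighbourhoods of `x`, a junk value where that limit does not exist. -/
def removeSingularities (f : ℂ → ℂ) (x : ℂ) : ℂ := limUnder (𝓝[≠] x) f

lemma removeSingularities_eq (hf : ContinuousAt f c) : removeSingularities f c = f c :=
  (tendsto_punctured hf).limUnder_eq

lemma tendsto_removeSingularities (hd : ∀ᶠ w in 𝓝[≠] c, DifferentiableAt ℂ f w)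
    (hr : HasResidueAt f c 0) : Tendsto f (𝓝[≠] c) (𝓝 (removeSingularities f c)) := by
  refine Complex.tendsto_limUnder_of_differentiable_on_punctured_nhds_of_isLittleO hd ?_
  have hconst : HasResidueAt (fun _ => f c) c 0 :=
    hasResidueAt_zero_of_continuousAt continuousAt_const
  have hne : ∀ᶠ w in 𝓝[≠] c, (w - c)⁻¹ = 0 → f w - f c = 0 :=
    eventually_mem_nhdsWithin.mono fun w hw h => absurd (inv_eq_zero.1 h) (sub_ne_zero.2 hw)
  have hsub : HasResidueAt (fun w => f w - f c) c 0 := by simpa only [sub_zero] using hr.sub hconst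
  rw [Asymptotics.isLittleO_iff_tendsto' hne]
  refine Tendsto.congr (fun w => ?_) hsub
  rw [div_inv_eq_mul, mul_comm]

lemma eventually_removeSingularities_eventuallyEq
    (hd : ∀ᶠ w in 𝓝[≠] c, DifferentiableAt ℂ f w) :
    ∀ᶠ w in 𝓝[≠] c, removeSingularities f =ᶠ[𝓝 w] f := by
  filter_upwards [eventually_eventually_nhdsWithin.2 hd, self_mem_nhdsWithin] with w hw hwc
  rw [isOpen_compl_singleton.nhdsWithin_eq hwc] at hw
  exact hw.mono fun v hv => removeSingularities_eq hv.continuousAt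

lemma analyticAt_removeSingularities (hd : ∀ᶠ w in 𝓝[≠] c, DifferentiableAt ℂ f w)
    (hr : HasResidueAt f c 0) : AnalyticAt ℂ (removeSingularities f) c := by
  have heq := eventually_removeSingularities_eventuallyEq hd
  refine Complex.analyticAt_of_differentiable_on_punctured_nhds_of_continuousAt ?_ ?_
  · filter_upwards [heq, hd] with w h1 h2 using h1.differentiableAt_iff.2 h2
  · rw [← continuousWithinAt_compl_self]
    exact (tendsto_removeSingularities hd hr).congr' (heq.mono fun w hw => hw.eq_of_nhds.symm)

end Removable

section Contraction

variable {q : ℂ} {h : ℂ → ℂ} {R ρ : ℝ}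

lemma exists_eq_pow_mul_annulus (hq : IsNome q) {x : ℂ} (hx : x ≠ 0) (hxR : ‖x‖ ≤ R) :
    ∃ (n : ℕ) (y : ℂ), x = q ^ n * y ∧ ‖q‖ * R ≤ ‖y‖ ∧ ‖y‖ ≤ R := by
  have hx0 : 0 < ‖x‖ := norm_pos_iff.2 hx
  have hR : 0 < R := hx0.trans_le hxR
  obtain ⟨n, hn, hn'⟩ := exists_nat_pow_near_of_lt_one (div_pos hx0 hR) ((div_le_one hR).2 hxR)
    hq.norm_pos hq.norm_lt_one
  have hqn : 0 < ‖q‖ ^ n := pow_pos hq.norm_pos n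
  refine ⟨n, x / q ^ n, (mul_div_cancel₀ x (pow_ne_zero n hq.ne_zero)).symm, ?_, ?_⟩
  · rw [norm_div, norm_pow, le_div_iff₀ hqn]
    rw [lt_div_iff₀ hR, pow_succ] at hn
    linarith
  · rw [norm_div, norm_pow, div_le_iff₀ hqn]
    rw [div_le_iff₀ hR] at hn'
    linarith

lemma norm_pow_mul_le_of_contraction (hq : IsNome q) (hρ : 0 ≤ ρ)
    (hh : ∀ x ≠ 0, ‖x‖ ≤ R → ‖h (q * x)‖ ≤ ρ * ‖h x‖) {x : ℂ} (hx : x ≠ 0) (hxR : ‖x‖ ≤ R)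
    (n : ℕ) : ‖h (q ^ n * x)‖ ≤ ρ ^ n * ‖h x‖ := by
  induction n with
  | zero => simp
  | succ n ih =>
    have hle : ‖q ^ n * x‖ ≤ R := by
      rw [norm_mul, norm_pow]
      exact (mul_le_of_le_one_left (norm_nonneg x)
        (pow_le_one₀ (norm_nonneg q) hq.norm_lt_one.le)).trans hxR
    calc ‖h (q ^ (n + 1) * x)‖ = ‖h (q * (q ^ n * x))‖ := by rw [pow_succ', mul_assoc]
      _ ≤ ρ * ‖h (q ^ n * x)‖ := hh _ (mul_ne_zero (pow_ne_zero n hq.ne_zero) hx) hle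
      _ ≤ ρ * (ρ ^ n * ‖h x‖) := mul_le_mul_of_nonneg_left ih hρ
      _ = ρ ^ (n + 1) * ‖h x‖ := by rw [pow_succ', mul_assoc]

lemma exists_bound_of_contraction (hq : IsNome q) (hR : 0 < R) (hρ : 0 ≤ ρ) (hρ1 : ρ ≤ 1)
    (hc : ∀ x ≠ 0, ContinuousAt h x) (hh : ∀ x ≠ 0, ‖x‖ ≤ R → ‖h (q * x)‖ ≤ ρ * ‖h x‖) :
    ∃ M, ∀ x ≠ 0, ‖x‖ ≤ R → ‖h x‖ ≤ M := by
  have hcompact : IsCompact (Metric.closedBall (0 : ℂ) R \ Metric.ball 0 (‖q‖ * R)) :=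
    (isCompact_closedBall _ _).diff Metric.isOpen_ball
  have hne : ∀ y : ℂ, ‖q‖ * R ≤ ‖y‖ → y ≠ 0 := fun y hy =>
    norm_pos_iff.1 ((mul_pos hq.norm_pos hR).trans_le hy)
  obtain ⟨M, hM⟩ := hcompact.exists_bound_of_continuousOn (f := h) fun y hy =>
    (hc y (hne y (by simpa using hy.2))).continuousWithinAt
  refine ⟨M, fun x hx hxR => ?_⟩
  obtain ⟨n, y, rfl, hy, hyR⟩ := exists_eq_pow_mul_annulus hq hx hxR
  calc ‖h (q ^ n * y)‖ ≤ ρ ^ n * ‖h y‖ :=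
        norm_pow_mul_le_of_contraction hq hρ hh (hne y hy) hyR n
    _ ≤ ‖h y‖ := mul_le_of_le_one_left (norm_nonneg _) (pow_le_one₀ hρ hρ1)
    _ ≤ M := hM y ⟨by simpa using hyR, by simpa using hy⟩

lemma tendsto_zero_of_contraction (hq : IsNome q) (hR : 0 < R) (hρ : 0 ≤ ρ) (hρ1 : ρ < 1)
    (hc : ∀ x ≠ 0, ContinuousAt h x) (hh : ∀ x ≠ 0, ‖x‖ ≤ R → ‖h (q * x)‖ ≤ ρ * ‖h x‖) :
    Tendsto h (𝓝[≠] 0) (𝓝 0) := by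
  obtain ⟨M, hM⟩ := exists_bound_of_contraction hq hR hρ hρ1.le hc hh
  rw [Metric.tendsto_nhds]
  intro ε hε
  have hpow : Tendsto (fun n : ℕ => ρ ^ n * M) atTop (𝓝 0) := by
    simpa using (tendsto_pow_atTop_nhds_zero_of_lt_one hρ hρ1).mul_const M
  obtain ⟨N, hN⟩ := (hpow.eventually_lt_const hε).exists
  have hqN : q ^ N ≠ 0 := pow_ne_zero N hq.ne_zero
  have hball : Metric.ball (0 : ℂ) (‖q ^ N‖ * R) ∈ 𝓝[≠] (0 : ℂ) :=
    nhdsWithin_le_nhds (Metric.ball_mem_nhds 0 (mul_pos (norm_pos_iff.2 hqN) hR))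
  filter_upwards [hball, self_mem_nhdsWithin] with x hx hx0
  have hxR : ‖x / q ^ N‖ ≤ R := by
    rw [norm_div, div_le_iff₀' (norm_pos_iff.2 hqN)]
    exact (mem_ball_zero_iff.1 hx).le
  have hx' : x / q ^ N ≠ 0 := div_ne_zero hx0 hqN
  calc dist (h x) 0 = ‖h (q ^ N * (x / q ^ N))‖ := by rw [dist_zero_right, mul_div_cancel₀ x hqN]
    _ ≤ ρ ^ N * ‖h (x / q ^ N)‖ := norm_pow_mul_le_of_contraction hq hρ hh hx' hxR N
    _ ≤ ρ ^ N * M := mul_le_mul_of_nonneg_left (hM _ hx' hxR) (pow_nonneg hρ N)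
    _ < ε := hN

end Contraction

section Vanishing

variable {q : ℂ} {D μ : ℂ → ℂ}

lemma HasResidueAt.of_qShift (hq : q ≠ 0) {x : ℂ} (hμ : ContinuousAt μ x) (hμx : μ x ≠ 0)
    (hD : ∀ᶠ w in 𝓝[≠] x, D (q * w) = μ w * D w) (hr : HasResidueAt D (q * x) 0) :
    HasResidueAt D x 0 := by
  have hcomp : HasResidueAt (fun w => D (q * w)) x (0 / q) :=
    hr.comp (by simpa using (hasDerivAt_id x).const_mul q) hq
  have h := hcomp.mul_continuousAt (hμ.inv₀ hμx)
  rw [zero_div, zero_mul] at h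
  refine h.congr ?_
  filter_upwards [hD, nhdsWithin_le_nhds (hμ.eventually_ne hμx)] with w hw hμw
  rw [hw, Pi.inv_apply, mul_comm, inv_mul_cancel_left₀ hμw]

lemma HasResidueAt.qShift (hq : q ≠ 0) {x : ℂ} (hμ : ContinuousAt μ x)
    (hD : ∀ᶠ w in 𝓝[≠] x, D (q * w) = μ w * D w) (hr : HasResidueAt D x 0) :
    HasResidueAt D (q * x) 0 := by
  have hx : q⁻¹ * (q * x) = x := inv_mul_cancel_left₀ hq x
  have h := hr.mul_continuousAt hμ
  rw [zero_mul, ← hx] at h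
  have hcomp := h.comp (g := fun w => q⁻¹ * w)
    (by simpa using (hasDerivAt_id (q * x)).const_mul q⁻¹) (inv_ne_zero hq)
  rw [zero_div] at hcomp
  have htendsto := tendsto_const_mul_punctured (inv_ne_zero hq) (q * x)
  rw [hx] at htendsto
  refine hcomp.congr ((htendsto.eventually hD).mono fun w hw => ?_)
  beta_reduce
  rw [mul_comm, ← hw, mul_inv_cancel_left₀ hq]

lemma HasResidueAt.zpow_qShift (hq : q ≠ 0) (hμ : Continuous μ) (hμ0 : ∀ x ≠ 0, μ x ≠ 0)
    (hD : ∀ x ≠ 0, ∀ᶠ w in 𝓝[≠] x, D (q * w) = μ w * D w) {x : ℂ} (hx : x ≠ 0)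
    (hr : HasResidueAt D x 0) (n : ℤ) : HasResidueAt D (q ^ n * x) 0 := by
  induction n with
  | zero => simpa using hr
  | succ n ih =>
    have h := ih.qShift hq hμ.continuousAt (hD _ (mul_ne_zero (zpow_ne_zero _ hq) hx))
    rwa [← mul_assoc, ← zpow_one_add₀ hq, add_comm] at h
  | pred n ih =>
    have hy : q ^ (-(n : ℤ) - 1) * x ≠ 0 := mul_ne_zero (zpow_ne_zero _ hq) hx
    refine HasResidueAt.of_qShift hq hμ.continuousAt (hμ0 _ hy) (hD _ hy) ?_
    rwa [← mul_assoc, ← zpow_one_add₀ hq, add_sub_cancel]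

lemma hasResidueAt_zero_of_qShift (hq : IsNome q) (hμ : ContinuousAt μ 0) (hμ1 : ‖q * μ 0‖ < 1)
    (hc : ∀ x ≠ 0, ContinuousAt D x) (hD : ∀ x ≠ 0, D (q * x) = μ x * D x) :
    HasResidueAt D 0 0 := by
  obtain ⟨ρ, hρ, hρ1⟩ := exists_between hμ1
  have hnhds : ∀ᶠ x in 𝓝 (0 : ℂ), ‖q * μ x‖ < ρ :=
    (hμ.const_mul q).norm.eventually_lt continuousAt_const hρ
  obtain ⟨R, hR, hball⟩ := Metric.nhds_basis_closedBall.mem_iff.1 hnhds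
  have h : Tendsto (fun x => x * D x) (𝓝[≠] 0) (𝓝 0) := by
    refine tendsto_zero_of_contraction hq hR ((norm_nonneg _).trans hρ.le) hρ1
      (fun x hx => continuousAt_id.mul (hc x hx)) fun x hx hxR => ?_
    rw [hD x hx, show q * x * (μ x * D x) = q * μ x * (x * D x) by ring, norm_mul]
    exact mul_le_mul_of_nonneg_right (hball (by simpa using hxR)).le (norm_nonneg _)
  simpa only [HasResidueAt, sub_zero] using h

/- Comparing leading Taylor coefficients in `D (q x) = μ x * D x`: if `D` vanishes to order exactly
`n` at the origin, then `q ^ n = μ 0`. -/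
lemma eventually_eq_zero_of_qShift (hμ : ContinuousAt μ 0) (hμq : ∀ k : ℕ, μ 0 ≠ q ^ k)
    (han : AnalyticAt ℂ D 0) (hD : ∀ᶠ x in 𝓝[≠] 0, D (q * x) = μ x * D x) :
    ∀ᶠ x in 𝓝 0, D x = 0 := by
  by_contra hne
  obtain ⟨n, g, hg, hg0, hDg⟩ := han.exists_eventuallyEq_pow_smul_nonzero_iff.2 hne
  simp only [sub_zero, smul_eq_mul] at hDg
  have hmul : Tendsto (fun w => q * w) (𝓝 (0 : ℂ)) (𝓝 0) := by
    simpa using (continuous_const_mul q).tendsto 0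
  have hgq : ContinuousAt (fun w => g (q * w)) 0 :=
    ContinuousAt.comp (by simpa using hg.continuousAt) (by fun_prop)
  have heq : q ^ n * g (q * 0) = μ 0 * g 0 := by
    refine eq_of_eventually_eq_punctured (f := fun w => q ^ n * g (q * w))
      (g := fun w => μ w * g w) (hgq.const_mul _)
      (hμ.mul hg.continuousAt) ?_
    filter_upwards [nhdsWithin_le_nhds hDg, nhdsWithin_le_nhds (hmul.eventually hDg), hD,
      self_mem_nhdsWithin] with w h1 h2 h3 hw
    rw [h1, h2] at h3
    exact mul_left_cancel₀ (pow_ne_zero n hw) (by linear_combination h3)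
  rw [mul_zero] at heq
  exact hμq n (mul_right_cancel₀ hg0 heq).symm

lemma eq_zero_of_qShift_of_analyticAt (hq : IsNome q) (hμ : ContinuousAt μ 0)
    (hμ1 : ‖q * μ 0‖ < 1) (hμq : ∀ k : ℕ, μ 0 ≠ q ^ k) (han : ∀ x ≠ 0, AnalyticAt ℂ D x)
    (hD : ∀ x ≠ 0, D (q * x) = μ x * D x) {x : ℂ} (hx : x ≠ 0) : D x = 0 := by
  have hext : ∀ w ≠ 0, removeSingularities D w = D w := fun w hw =>
    removeSingularities_eq (han w hw).continuousAt
  have hext0 : AnalyticAt ℂ (removeSingularities D) 0 :=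
    analyticAt_removeSingularities (eventually_mem_nhdsWithin.mono fun w hw =>
      (han w hw).differentiableAt)
      (hasResidueAt_zero_of_qShift hq hμ hμ1 (fun w hw => (han w hw).continuousAt) hD)
  have hentire : AnalyticOnNhd ℂ (removeSingularities D) Set.univ := fun w _ => by
    rcases eq_or_ne w 0 with rfl | hw
    · exact hext0
    · exact (han w hw).congr
        (Eventually.mono (isOpen_ne.mem_nhds hw) fun v hv => (hext v hv).symm)
  have hzero : ∀ᶠ w in 𝓝 0, removeSingularities D w = 0 :=
    eventually_eq_zero_of_qShift hμ hμq hext0 <| eventually_mem_nhdsWithin.mono fun w hw => by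
      rw [hext w hw, hext _ (mul_ne_zero hq.ne_zero hw), hD w hw]
  rw [← hext x hx]
  exact hentire.eqOn_zero_of_preconnected_of_eventuallyEq_zero isPreconnected_univ
    (Set.mem_univ 0) hzero (Set.mem_univ x)

lemma eventually_eq_zero_of_qShift_of_hasResidueAt (hq : IsNome q) (hμ : Continuous μ)
    (hμ1 : ‖q * μ 0‖ < 1) (hμq : ∀ k : ℕ, μ 0 ≠ q ^ k)
    (hd : ∀ x ≠ 0, ∀ᶠ w in 𝓝[≠] x, DifferentiableAt ℂ D w) (hr : ∀ x ≠ 0, HasResidueAt D x 0)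
    (hD : ∀ x ≠ 0, ∀ᶠ w in 𝓝[≠] x, D (q * w) = μ w * D w) {x : ℂ} (hx : x ≠ 0) :
    ∀ᶠ w in 𝓝[≠] x, D w = 0 := by
  have hlim : ∀ x ≠ 0, Tendsto D (𝓝[≠] x) (𝓝 (removeSingularities D x)) := fun x hx =>
    tendsto_removeSingularities (hd x hx) (hr x hx)
  have hshift : ∀ x ≠ 0, removeSingularities D (q * x) = μ x * removeSingularities D x :=
    fun x hx => tendsto_nhds_unique_of_eventuallyEq
      ((hlim _ (mul_ne_zero hq.ne_zero hx)).comp (tendsto_const_mul_punctured hq.ne_zero x))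
      ((tendsto_punctured hμ.continuousAt).mul (hlim x hx)) (hD x hx)
  filter_upwards [hd x hx, eventually_punctured_ne hx] with w hw hw0
  rw [← removeSingularities_eq hw.continuousAt]
  exact eq_zero_of_qShift_of_analyticAt hq hμ.continuousAt hμ1 hμq
    (fun v hv => analyticAt_removeSingularities (hd v hv) (hr v hv)) hshift hw0

theorem eq_zero_of_qShift (hq : IsNome q) (hμ : Continuous μ) (hμ0 : ∀ x ≠ 0, μ x ≠ 0)
    (hμ1 : ‖q * μ 0‖ < 1) (hμq : ∀ k : ℕ, μ 0 ≠ q ^ k)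
    {S : Set ℂ} (hS : ∀ x ≠ 0, ∀ᶠ w in 𝓝[≠] x, w ∈ S)
    (hd : ∀ x ∈ S, x ≠ 0 → DifferentiableAt ℂ D x)
    (hD : ∀ x ∈ S, x ≠ 0 → D (q * x) = μ x * D x)
    (hr : ∀ x ∉ S, x ≠ 0 → ∃ y ≠ 0, (∃ n : ℤ, x = q ^ n * y) ∧ HasResidueAt D y 0)
    {x : ℂ} (hxS : x ∈ S) (hx : x ≠ 0) : D x = 0 := by
  have hS' : ∀ x ≠ 0, ∀ᶠ w in 𝓝[≠] x, w ∈ S ∧ w ≠ 0 := fun x hx =>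
    (hS x hx).and (eventually_punctured_ne hx)
  have hD' : ∀ x ≠ 0, ∀ᶠ w in 𝓝[≠] x, D (q * w) = μ w * D w := fun x hx =>
    (hS' x hx).mono fun w hw => hD w hw.1 hw.2
  have hr' : ∀ x ≠ 0, HasResidueAt D x 0 := fun x hx => by
    by_cases hxS : x ∈ S
    · exact hasResidueAt_zero_of_continuousAt (hd x hxS hx).continuousAt
    · obtain ⟨y, hy, ⟨n, rfl⟩, hres⟩ := hr x hxS hx
      exact hres.zpow_qShift hq.ne_zero hμ hμ0 hD' hy n
  exact eq_of_eventually_eq_punctured (hd x hxS hx).continuousAt continuousAt_const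
    (eventually_eq_zero_of_qShift_of_hasResidueAt hq hμ hμ1 hμq
      (fun x hx => (hS' x hx).mono fun w hw => hd w hw.1 hw.2) hr' hD' hx)

end Vanishing

section QPoch

variable {q : ℂ}

lemma summable_norm_pow_mul (hq : ‖q‖ < 1) (x : ℂ) : Summable fun i : ℕ => ‖q ^ i * x‖ := by
  simpa only [norm_mul, norm_pow] using
    (summable_geometric_of_lt_one (norm_nonneg q) hq).mul_right ‖x‖

lemma multipliable_qPoch (hq : ‖q‖ < 1) (x : ℂ) : Multipliable fun i : ℕ => 1 - q ^ i * x := by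
  simp only [sub_eq_add_neg]
  exact multipliable_one_add_of_summable (by simpa using summable_norm_pow_mul hq x)

lemma qPoch_eq_mul (hq : ‖q‖ < 1) (x : ℂ) : qPoch x q = (1 - x) * qPoch (q * x) q := by
  have hshift : ∀ i : ℕ, 1 - q ^ (i + 1) * x = 1 - q ^ i * (q * x) := fun i => by ring
  have h := tprod_eq_zero_mul' (f := fun i : ℕ => 1 - q ^ i * x)
    (by simpa only [hshift] using multipliable_qPoch hq (q * x))
  simpa only [qPoch, hshift, pow_zero, one_mul] using h

lemma qPoch_eq_zero_iff (hq : ‖q‖ < 1) {x : ℂ} : qPoch x q = 0 ↔ ∃ i : ℕ, q ^ i * x = 1 := by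
  refine ⟨fun h => ?_, fun ⟨i, hi⟩ => tprod_of_exists_eq_zero ⟨i, by rw [hi, sub_self]⟩⟩
  contrapose! h
  simp only [qPoch, sub_eq_add_neg]
  refine tprod_one_add_ne_zero_of_summable (fun i hi => h i ?_)
    (by simpa using summable_norm_pow_mul hq x)
  linear_combination -hi

lemma qPoch_one (hq : ‖q‖ < 1) : qPoch 1 q = 0 :=
  (qPoch_eq_zero_iff hq).2 ⟨0, by simp⟩

lemma qPoch_zero : qPoch 0 q = 1 := by simp [qPoch]

lemma qPoch_self_ne_zero (hq : ‖q‖ < 1) : qPoch q q ≠ 0 := fun h => by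
  obtain ⟨i, hi⟩ := (qPoch_eq_zero_iff hq).1 h
  have hlt : ‖q ^ (i + 1)‖ < 1 := by
    rw [norm_pow]
    exact pow_lt_one₀ (norm_nonneg q) hq i.succ_ne_zero
  rw [pow_succ, hi, norm_one] at hlt
  exact lt_irrefl 1 hlt

lemma differentiable_qPoch (hq : ‖q‖ < 1) : Differentiable ℂ fun x => qPoch x q := by
  intro x
  have hopen : IsOpen (Metric.ball (0 : ℂ) (‖x‖ + 1)) := Metric.isOpen_ball
  have hprod : HasProdLocallyUniformlyOn (fun (i : ℕ) (w : ℂ) => 1 + -(q ^ i * w))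
      (fun w => ∏' i : ℕ, (1 + -(q ^ i * w))) (Metric.ball 0 (‖x‖ + 1)) := by
    refine Summable.hasProdLocallyUniformlyOn_one_add hopen
      ((summable_geometric_of_lt_one (norm_nonneg q) hq).mul_right (‖x‖ + 1))
      (.of_forall fun i w hw => ?_) fun i => by fun_prop
    rw [norm_neg, norm_mul, norm_pow]
    exact mul_le_mul_of_nonneg_left (mem_ball_zero_iff.1 hw).le (pow_nonneg (norm_nonneg q) i)
  have hd := TendstoLocallyUniformlyOn.differentiableOn hprod
    (.of_forall fun s => by fun_prop) hopen
  simpa only [qPoch, sub_eq_add_neg] using hd.differentiableAt (hopen.mem_nhds (by simp))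

lemma qPoch_sq (hq : ‖q‖ < 1) (x : ℂ) :
    qPoch (x ^ 2) (q ^ 2) = qPoch x q * qPoch (-x) q := by
  unfold qPoch
  rw [← (multipliable_qPoch hq x).tprod_mul (multipliable_qPoch hq (-x))]
  exact tprod_congr fun i => by ring

lemma norm_sq_lt_one (hq : ‖q‖ < 1) : ‖q ^ 2‖ < 1 := by
  rw [norm_pow]
  exact pow_lt_one₀ (norm_nonneg q) hq two_ne_zero

lemma qPoch_even_mul_odd (hq : ‖q‖ < 1) (x : ℂ) :
    qPoch x (q ^ 2) * qPoch (q * x) (q ^ 2) = qPoch x q := by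
  have heven : ∀ i : ℕ, 1 - (q ^ 2) ^ i * x = 1 - q ^ (2 * i) * x := fun i => by ring
  have hodd : ∀ i : ℕ, 1 - (q ^ 2) ^ i * (q * x) = 1 - q ^ (2 * i + 1) * x := fun i => by ring
  have hmeven := multipliable_qPoch (norm_sq_lt_one hq) x
  have hmodd := multipliable_qPoch (norm_sq_lt_one hq) (q * x)
  simp only [qPoch, heven, hodd] at hmeven hmodd ⊢
  exact tprod_even_mul_odd (f := fun i : ℕ => 1 - q ^ i * x) hmeven hmodd

lemma qPoch_self_mul_qPoch_sq (hq : ‖q‖ < 1) :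
    qPoch q (q ^ 2) * qPoch (q ^ 2) (q ^ 2) = qPoch q q := by
  simpa only [← sq] using qPoch_even_mul_odd hq q

end QPoch

section Theta

variable {q x : ℂ}

lemma j_mul_self (hq : IsNome q) (hx : x ≠ 0) : j (q * x) q = -x⁻¹ * j x q := by
  have hq0 := hq.ne_zero
  unfold j
  rw [show q / (q * x) = x⁻¹ by field_simp, qPoch_eq_mul hq.norm_lt_one x,
    qPoch_eq_mul hq.norm_lt_one x⁻¹, ← div_eq_mul_inv]
  field_simp
  ring

lemma j_self_div (hq : q ≠ 0) (x : ℂ) : j (q / x) q = j x q := by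
  unfold j
  rw [div_div_cancel₀ hq]
  ring

lemma j_inv (hq : IsNome q) (hx : x ≠ 0) : j x⁻¹ q = -x⁻¹ * j x q := by
  rw [← j_self_div hq.ne_zero x⁻¹, div_inv_eq_mul, j_mul_self hq hx]

lemma j_sq (hq : ‖q‖ < 1) (x : ℂ) :
    j (x ^ 2) (q ^ 2) * qPoch q q ^ 2 = qPoch (q ^ 2) (q ^ 2) * (j x q * j (-x) q) := by
  unfold j
  rw [← div_pow, qPoch_sq hq x, qPoch_sq hq (q / x), div_neg]
  ring

lemma j_even_mul_odd (hq : IsNome q) (x : ℂ) :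
    qPoch q q * (j x (q ^ 2) * j (q * x) (q ^ 2)) = j x q * qPoch (q ^ 2) (q ^ 2) ^ 2 := by
  unfold j
  rw [← qPoch_even_mul_odd hq.norm_lt_one x, ← qPoch_even_mul_odd hq.norm_lt_one (q / x),
    show q * (q / x) = q ^ 2 / x by ring, sq q, mul_div_mul_left _ _ hq.ne_zero]
  ring

lemma j_self_sq (hq : IsNome q) : j q (q ^ 2) * qPoch (q ^ 2) (q ^ 2) = qPoch q q ^ 2 := by
  rw [← qPoch_self_mul_qPoch_sq hq.norm_lt_one, j, sq q, mul_div_cancel_right₀ q hq.ne_zero]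
  ring

lemma j_neg_one (hq : ‖q‖ < 1) : j (-1) q * qPoch q q = 2 * qPoch (q ^ 2) (q ^ 2) ^ 2 := by
  rw [qPoch_sq hq q, j, qPoch_eq_mul hq (-1), div_neg, div_one, mul_neg_one]
  ring

lemma j_neg_self_sq (hq : IsNome q) :
    j (-q) (q ^ 2) * qPoch q q ^ 2 * qPoch (q ^ 4) (q ^ 4) ^ 2 = qPoch (q ^ 2) (q ^ 2) ^ 5 := by
  have h1 := qPoch_self_mul_qPoch_sq hq.norm_lt_one
  have h2 := qPoch_self_mul_qPoch_sq hq.sq.norm_lt_one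
  rw [qPoch_sq hq.sq.norm_lt_one, ← pow_mul] at h2
  rw [j, ← h1, show q ^ 2 / -q = -q by rw [div_neg, sq, mul_div_cancel_right₀ q hq.ne_zero]]
  linear_combination (qPoch (q ^ 2) (q ^ 2) ^ 3 * (qPoch q (q ^ 2) * qPoch (-q) (q ^ 2) *
    qPoch (q ^ 4) (q ^ 4) + qPoch (q ^ 2) (q ^ 2))) * h2

lemma j_one (hq : ‖q‖ < 1) : j 1 q = 0 := by
  rw [j, qPoch_one hq, zero_mul, zero_mul]

lemma j_eq_zero_iff (hq : IsNome q) (hx : x ≠ 0) : j x q = 0 ↔ ∃ n : ℤ, x = q ^ n := by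
  simp only [j, mul_eq_zero, qPoch_self_ne_zero hq.norm_lt_one, or_false,
    qPoch_eq_zero_iff hq.norm_lt_one]
  constructor
  · rintro (⟨i, hi⟩ | ⟨i, hi⟩)
    · refine ⟨-i, ?_⟩
      rw [zpow_neg, zpow_natCast]
      exact eq_inv_of_mul_eq_one_right hi
    · refine ⟨i + 1, ?_⟩
      rw [zpow_add_one₀ hq.ne_zero, zpow_natCast]
      rw [← mul_div_assoc, div_eq_one_iff_eq hx] at hi
      exact hi.symm
  · rintro ⟨n, rfl⟩
    rcases le_or_gt n 0 with hn | hn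
    · obtain ⟨i, rfl⟩ := Int.exists_eq_neg_ofNat hn
      exact .inl ⟨i, by rw [← zpow_natCast, ← zpow_add₀ hq.ne_zero, add_neg_cancel, zpow_zero]⟩
    · obtain ⟨i, rfl⟩ := Int.exists_add_of_le (Int.add_one_le_of_lt hn)
      refine .inr ⟨i, ?_⟩
      rw [zero_add, zpow_one_add₀ hq.ne_zero, zpow_natCast, ← mul_div_assoc, mul_comm,
        div_self (mul_ne_zero hq.ne_zero (pow_ne_zero i hq.ne_zero))]

lemma j_neg_one_ne_zero (hq : IsNome q) : j (-1) q ≠ 0 := fun h => by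
  have h2 : (2 : ℂ) * qPoch (q ^ 2) (q ^ 2) ^ 2 ≠ 0 :=
    mul_ne_zero two_ne_zero (pow_ne_zero 2 (qPoch_self_ne_zero hq.sq.norm_lt_one))
  exact h2 (by rw [← j_neg_one hq.norm_lt_one, h, zero_mul])

lemma differentiableAt_j (hq : ‖q‖ < 1) (hx : x ≠ 0) :
    DifferentiableAt ℂ (fun x => j x q) x := by
  have hd := differentiable_qPoch hq
  exact ((hd x).mul ((hd (q / x)).comp x
    ((differentiableAt_const q).div differentiableAt_id hx))).mul_const _

lemma hasDerivAt_j_one (hq : ‖q‖ < 1) : HasDerivAt (fun x => j x q) (-qPoch q q ^ 3) 1 := by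
  have hd := differentiable_qPoch hq
  have hfactor : ∀ x, j x q = (1 - x) * (qPoch (q * x) q * qPoch (q / x) q * qPoch q q) :=
    fun x => by
      rw [j, qPoch_eq_mul hq x]
      ring
  have hg : DifferentiableAt ℂ
      (fun x => qPoch (q * x) q * qPoch (q / x) q * qPoch q q) 1 := by
    refine (DifferentiableAt.mul ?_ ?_).mul_const _
    · exact (hd (q * 1)).comp 1 (differentiableAt_id.const_mul q)
    · exact (hd (q / 1)).comp 1 ((differentiableAt_const q).div differentiableAt_id one_ne_zero)
  simp only [hfactor]
  refine (((hasDerivAt_id (1 : ℂ)).const_sub 1).mul hg.hasDerivAt).congr_deriv ?_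
  simp only [id_eq, sub_self, zero_mul, add_zero, mul_one, div_one]
  ring

lemma hasDerivAt_j_self (hq : IsNome q) : HasDerivAt (fun x => j x q) (qPoch q q ^ 3 / q) q := by
  have hq0 := hq.ne_zero
  have hj : HasDerivAt (fun x => j x q) (-qPoch q q ^ 3) (q / q) := by
    rw [div_self hq0]
    exact hasDerivAt_j_one hq.norm_lt_one
  have hdiv : HasDerivAt (fun x => q / x) (-q / q ^ 2) q := by
    refine ((hasDerivAt_const q q).fun_div (hasDerivAt_id' q) hq0).congr_deriv ?_
    rw [zero_mul, mul_one, zero_sub]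
  refine ((hj.comp q hdiv).congr_deriv ?_).congr_of_eventuallyEq
    (.of_forall fun w => (j_self_div hq0 w).symm)
  field_simp

lemma eventually_j_ne_zero (hq : IsNome q) (hx : x ≠ 0) : ∀ᶠ w in 𝓝[≠] x, j w q ≠ 0 := by
  have han : AnalyticOnNhd ℂ (fun w => j w q) {0}ᶜ :=
    DifferentiableOn.analyticOnNhd (fun w hw =>
      (differentiableAt_j hq.norm_lt_one hw).differentiableWithinAt) isOpen_compl_singleton
  have hconn : IsPreconnected ({0}ᶜ : Set ℂ) :=
    (isConnected_compl_singleton_of_one_lt_rank (by simp) 0).isPreconnected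
  refine (han x hx).eventually_eq_zero_or_eventually_ne_zero.resolve_left fun h => ?_
  exact j_neg_one_ne_zero hq (han.eqOn_zero_of_preconnected_of_eventuallyEq_zero hconn hx h
    (neg_ne_zero.2 one_ne_zero : (-1 : ℂ) ≠ 0))

end Theta

/-- The open annulus `|q| < |y| < 1`, in which the parameters `y` and `z` of the double sums lie. -/
structure InAnnulus (q y : ℂ) : Prop where
  lt_norm : ‖q‖ < ‖y‖
  norm_lt_one : ‖y‖ < 1

namespace InAnnulus

variable {q y z : ℂ}

lemma norm_pos (hy : InAnnulus q y) : 0 < ‖y‖ := (norm_nonneg q).trans_lt hy.lt_norm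

lemma ne_zero (hy : InAnnulus q y) : y ≠ 0 := norm_pos_iff.1 hy.norm_pos

lemma neg (hy : InAnnulus q y) : InAnnulus q (-y) where
  lt_norm := by simpa only [norm_neg] using hy.lt_norm
  norm_lt_one := by simpa only [norm_neg] using hy.norm_lt_one

lemma pow (hy : InAnnulus q y) {n : ℕ} (hn : n ≠ 0) : InAnnulus (q ^ n) (y ^ n) where
  lt_norm := by simpa only [norm_pow] using pow_lt_pow_left₀ hy.lt_norm (norm_nonneg q) hn
  norm_lt_one := by simpa only [norm_pow] using pow_lt_one₀ (norm_nonneg y) hy.norm_lt_one hn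

lemma mul (hy : InAnnulus q y) (hz : InAnnulus q z) : InAnnulus (q ^ 2) (y * z) where
  lt_norm := by
    rw [sq, norm_mul, norm_mul]
    exact mul_lt_mul'' hy.lt_norm hz.lt_norm (norm_nonneg q) (norm_nonneg q)
  norm_lt_one := by
    rw [norm_mul]
    exact mul_lt_one_of_nonneg_of_lt_one_left (norm_nonneg y) hy.norm_lt_one hz.norm_lt_one.le

lemma sq_base (hy : InAnnulus q y) : InAnnulus (q ^ 2) y where
  lt_norm := by
    rw [sq, norm_mul]
    exact (mul_le_of_le_one_left (norm_nonneg q)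
      (hy.lt_norm.trans hy.norm_lt_one).le).trans_lt hy.lt_norm
  norm_lt_one := hy.norm_lt_one

lemma self_mul (hq : IsNome q) (hy : InAnnulus q y) : InAnnulus (q ^ 2) (q * y) where
  lt_norm := by
    rw [sq, norm_mul, norm_mul]
    exact mul_lt_mul_of_pos_left hy.lt_norm hq.norm_pos
  norm_lt_one := by
    rw [norm_mul]
    exact mul_lt_one_of_nonneg_of_lt_one_left (norm_nonneg q) hq.norm_lt_one hy.norm_lt_one.le

lemma ne_zpow (hq : IsNome q) (hy : InAnnulus q y) (n : ℤ) : y ≠ q ^ n := by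
  rintro rfl
  have h1 := hy.lt_norm
  have h0 := hy.norm_lt_one
  rw [norm_zpow] at h0 h1
  rw [zpow_lt_one_iff_right_of_lt_one₀ hq.norm_pos hq.norm_lt_one] at h0
  nth_rewrite 1 [← zpow_one ‖q‖] at h1
  rw [zpow_lt_zpow_iff_right_of_lt_one₀ hq.norm_pos hq.norm_lt_one] at h1
  omega

lemma j_ne_zero (hq : IsNome q) (hy : InAnnulus q y) : j y q ≠ 0 := fun h => by
  obtain ⟨n, hn⟩ := (j_eq_zero_iff hq hy.ne_zero).1 h
  exact hy.ne_zpow hq n hn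

end InAnnulus

lemma IsNome.inAnnulus_sq {q : ℂ} (hq : IsNome q) : InAnnulus (q ^ 2) q where
  lt_norm := by
    rw [norm_pow]
    exact pow_lt_self_of_lt_one₀ hq.norm_pos hq.norm_lt_one one_lt_two
  norm_lt_one := hq.norm_lt_one

section Triangular

/-- The exponent `r(r-1)/2` of the theta series; the integer division is exact. -/
def tri (r : ℤ) : ℤ := r * (r - 1) / 2

lemma two_mul_tri (r : ℤ) : 2 * tri r = r * (r - 1) :=
  Int.mul_ediv_cancel' (even_iff_two_dvd.1 (Int.even_mul_pred_self r))

lemma tri_add_one (r : ℤ) : tri (r + 1) = tri r + r := by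
  linarith [two_mul_tri r, two_mul_tri (r + 1)]

lemma tri_neg (r : ℤ) : tri (-r) = tri r + r := by
  linarith [two_mul_tri r, two_mul_tri (-r)]

lemma tri_one_sub (r : ℤ) : tri (1 - r) = tri r := by
  linarith [two_mul_tri r, two_mul_tri (1 - r)]

lemma tri_zero : tri 0 = 0 := rfl

lemma zpow_tri_add_one {K : Type*} [Field K] {q : K} (hq : q ≠ 0) (r : ℤ) :
    q ^ tri (r + 1) = q ^ tri r * q ^ r := by
  rw [tri_add_one, zpow_add₀ hq]

lemma summable_zpow_tri_nat {ρ R : ℝ} (h0 : 0 < ρ) (h1 : ρ < 1) (hR : 0 < R) :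
    Summable fun n : ℕ => ρ ^ tri n * R ^ n := by
  have hratio : ∀ n : ℕ, ‖ρ ^ tri ((n + 1 : ℕ) : ℤ) * R ^ (n + 1)‖ / ‖ρ ^ tri (n : ℤ) * R ^ n‖ =
      ρ ^ n * R := fun n => by
    rw [Real.norm_of_nonneg (by positivity), Real.norm_of_nonneg (by positivity), Nat.cast_succ,
      zpow_tri_add_one h0.ne', pow_succ R, zpow_natCast ρ n]
    field_simp
  refine summable_of_ratio_test_tendsto_lt_one (l := 0) one_pos
    (.of_forall fun n => by positivity) ?_
  simp only [hratio]
  simpa using (tendsto_pow_atTop_nhds_zero_of_lt_one h0.le h1).mul_const R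

lemma summable_norm_zpow_tri {q b : ℂ} (hq : IsNome q) (hb : b ≠ 0) :
    Summable fun r : ℤ => ‖q ^ tri r * b ^ r‖ := by
  have hq0 := hq.norm_pos
  have hb0 := norm_pos_iff.2 hb
  simp only [norm_mul, norm_zpow]
  refine Summable.of_nat_of_neg ?_ ?_
  · simpa only [zpow_natCast ‖b‖] using summable_zpow_tri_nat hq0 hq.norm_lt_one hb0
  · refine (summable_zpow_tri_nat hq0 hq.norm_lt_one (div_pos hq0 hb0)).congr fun n => ?_
    rw [tri_neg, zpow_add₀ hq0.ne', zpow_neg, zpow_natCast, zpow_natCast, div_pow]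
    ring

end Triangular

section TripleProduct

variable {q b : ℂ}

/-- The tail `(q^{m+1};q)_∞`, which is `(q;q)_∞ / (q;q)_m` for `m ≥ 0` and vanishes for `m < 0`.
It serves to write the finite triple product identity as a sum over all of `ℤ`. -/
def qTail (q : ℂ) (m : ℤ) : ℂ := qPoch (q ^ (m + 1)) q

lemma qTail_sub_one (hq : IsNome q) (m : ℤ) : qTail q (m - 1) = (1 - q ^ m) * qTail q m := by
  rw [qTail, qTail, qPoch_eq_mul hq.norm_lt_one, sub_add_cancel, ← zpow_one_add₀ hq.ne_zero,
    add_comm]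

lemma qTail_of_neg (hq : IsNome q) {m : ℤ} (hm : m < 0) : qTail q m = 0 := by
  obtain ⟨i, hi⟩ := Int.exists_eq_neg_ofNat (Int.add_one_le_of_lt hm)
  refine (qPoch_eq_zero_iff hq.norm_lt_one).2 ⟨i, ?_⟩
  rw [hi, ← zpow_natCast, ← zpow_add₀ hq.ne_zero, add_neg_cancel, zpow_zero]

lemma tendsto_qTail (hq : IsNome q) (k : ℤ) :
    Tendsto (fun n : ℕ => qTail q (n + k)) atTop (𝓝 1) := by
  have harg : Tendsto (fun n : ℕ => q ^ n * q ^ (k + 1)) atTop (𝓝 0) := by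
    simpa using (tendsto_pow_atTop_nhds_zero_of_norm_lt_one hq.norm_lt_one).mul_const (q ^ (k + 1))
  have h := ((differentiable_qPoch hq.norm_lt_one).continuous.tendsto 0).comp harg
  rw [qPoch_zero] at h
  refine h.congr fun n => ?_
  rw [qTail, add_assoc, zpow_add₀ hq.ne_zero (n : ℤ), zpow_natCast, Function.comp_apply]

lemma exists_norm_qTail_le (hq : IsNome q) : ∃ C, 0 ≤ C ∧ ∀ m, ‖qTail q m‖ ≤ C := by
  obtain ⟨C, hC⟩ := (isCompact_closedBall (0 : ℂ) 1).exists_bound_of_continuousOn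
    (differentiable_qPoch hq.norm_lt_one).continuous.continuousOn
  have hC0 : 0 ≤ C := (norm_nonneg _).trans (hC 0 (by simp))
  refine ⟨C, hC0, fun m => ?_⟩
  rcases lt_or_ge m 0 with hm | hm
  · rwa [qTail_of_neg hq hm, norm_zero]
  · lift m to ℕ using hm
    refine hC _ ?_
    rw [mem_closedBall_zero_iff, ← Nat.cast_add_one, zpow_natCast, norm_pow]
    exact pow_le_one₀ (norm_nonneg q) hq.norm_lt_one.le

/-- The `k`-th summand of the `n`-th finite form of the triple product identity; it tends to
`q^{k(k-1)/2} b^k` as `n → ∞`. -/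
def finiteThetaTerm (q b : ℂ) (n : ℕ) (k : ℤ) : ℂ :=
  q ^ tri k * b ^ k * (qTail q (n - k) * qTail q (n + k))

lemma exists_norm_finiteThetaTerm_le (hq : IsNome q) (b : ℂ) :
    ∃ C, ∀ n k, ‖finiteThetaTerm q b n k‖ ≤ ‖q ^ tri k * b ^ k‖ * C := by
  obtain ⟨C, hC0, hC⟩ := exists_norm_qTail_le hq
  refine ⟨C * C, fun n k => ?_⟩
  rw [finiteThetaTerm, norm_mul, norm_mul (qTail q _)]
  exact mul_le_mul_of_nonneg_left (mul_le_mul (hC _) (hC _) (norm_nonneg _) hC0) (norm_nonneg _)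

lemma summable_finiteThetaTerm (hq : IsNome q) (hb : b ≠ 0) (n : ℕ) :
    Summable (finiteThetaTerm q b n) := by
  obtain ⟨C, hC⟩ := exists_norm_finiteThetaTerm_le hq b
  exact ((summable_norm_zpow_tri hq hb).mul_right C).of_norm_bounded (hC n)

lemma finiteThetaTerm_succ (hq : IsNome q) (hb : b ≠ 0) (n : ℕ) (k : ℤ) :
    (1 - q ^ (2 * n + 1)) * (1 - q ^ (2 * n + 2)) * finiteThetaTerm q b (n + 1) k =
      (1 + q ^ (2 * n + 1)) * finiteThetaTerm q b n k + q ^ n * b * finiteThetaTerm q b n (k - 1)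
        + q ^ (n + 1) / b * finiteThetaTerm q b n (k + 1) := by
  have hq0 := hq.ne_zero
  have hk : q ^ k ≠ 0 := zpow_ne_zero k hq0
  have htri : q ^ tri (k - 1) * q ^ k = q ^ tri k * q := by
    have h := zpow_tri_add_one hq0 (k - 1)
    rw [sub_add_cancel, zpow_sub_one₀ hq0] at h
    rw [h, mul_assoc, inv_mul_cancel_right₀ hq0]
  have hsub : qTail q (n - k) = (1 - q ^ (n + 1) / q ^ k) * qTail q (n + 1 - k) := by
    rw [← zpow_natCast q (n + 1), ← zpow_sub₀ hq0, Nat.cast_succ, ← qTail_sub_one hq,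
      sub_right_comm, add_sub_cancel_right]
  have hsub' : qTail q (n - k - 1) = (1 - q ^ n / q ^ k) * qTail q (n - k) := by
    rw [← zpow_natCast q n, ← zpow_sub₀ hq0, ← qTail_sub_one hq]
  have hadd : qTail q (n + k) = (1 - q ^ (n + 1) * q ^ k) * qTail q (n + 1 + k) := by
    rw [← zpow_natCast q (n + 1), ← zpow_add₀ hq0, Nat.cast_succ, ← qTail_sub_one hq,
      add_right_comm, add_sub_cancel_right]
  have hadd' : qTail q (n + k - 1) = (1 - q ^ n * q ^ k) * qTail q (n + k) := by
    rw [← zpow_natCast q n, ← zpow_add₀ hq0, ← qTail_sub_one hq]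
  simp only [finiteThetaTerm]
  rw [eq_div_of_mul_eq hk htri, zpow_tri_add_one hq0, zpow_sub_one₀ hb, zpow_add_one₀ hb,
    Nat.cast_succ, sub_sub_eq_add_sub, ← sub_sub (n : ℤ), ← add_sub_assoc, ← add_assoc,
    add_right_comm, hsub', hadd', hsub, hadd]
  field_simp
  ring_nf

lemma tsum_finiteThetaTerm_succ (hq : IsNome q) (hb : b ≠ 0) (n : ℕ) :
    (1 - q ^ (2 * n + 1)) * (1 - q ^ (2 * n + 2)) * ∑' k, finiteThetaTerm q b (n + 1) k =
      (1 + q ^ n * b) * (1 + q ^ (n + 1) / b) * ∑' k, finiteThetaTerm q b n k := by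
  have hs := summable_finiteThetaTerm hq hb n
  have hpred := (Equiv.subRight (1 : ℤ)).hasSum_iff.2 hs.hasSum
  have hsucc := (Equiv.addRight (1 : ℤ)).hasSum_iff.2 hs.hasSum
  simp only [Function.comp_def, Equiv.coe_addRight, Equiv.subRight_apply] at hpred hsucc
  have h := ((hs.hasSum.mul_left (1 + q ^ (2 * n + 1))).add (hpred.mul_left (q ^ n * b))).add
    (hsucc.mul_left (q ^ (n + 1) / b))
  have hcross : q ^ n * b * (q ^ (n + 1) / b) = q ^ (2 * n + 1) := by
    rw [pow_succ, two_mul, pow_succ, pow_add, mul_div_assoc']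
    exact (div_eq_iff hb).2 (by ring)
  rw [← tsum_mul_left, tsum_congr (finiteThetaTerm_succ hq hb n), h.tsum_eq]
  linear_combination -(∑' k, finiteThetaTerm q b n k) * hcross

/-- The partial product `∏_{i < n} (1 - q^i x)` of the `q`-Pochhammer symbol `(x;q)_∞`. -/
def qPochFinite (x q : ℂ) (n : ℕ) : ℂ := ∏ i ∈ Finset.range n, (1 - q ^ i * x)

lemma tsum_finiteThetaTerm_zero (hq : IsNome q) (b : ℂ) :
    ∑' k, finiteThetaTerm q b 0 k = qTail q 0 * qTail q 0 := by
  rw [tsum_eq_single 0 fun k hk => ?_]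
  · simp [finiteThetaTerm, tri]
  · rcases lt_or_gt_of_ne hk with h | h
    · simp [finiteThetaTerm, qTail_of_neg hq h]
    · simp [finiteThetaTerm, qTail_of_neg hq (neg_neg_of_pos h)]

theorem finite_triple_product (hq : IsNome q) (hb : b ≠ 0) (n : ℕ) :
    ∑' k, finiteThetaTerm q b n k =
      qPochFinite (-b) q n * qPochFinite (q / -b) q n * (qTail q (2 * n : ℕ) * qTail q 0) := by
  induction n with
  | zero => simp [tsum_finiteThetaTerm_zero hq, qPochFinite]
  | succ n ih =>
    have hne : ∀ m : ℕ, 1 - q ^ (m + 1) ≠ 0 := fun m h =>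
      m.cast_add_one_ne_zero (R := ℤ)
        (hq.zpow_eq_one_iff.1 (by exact_mod_cast (sub_eq_zero.1 h).symm))
    have htail : qTail q (2 * n : ℕ) =
        (1 - q ^ (2 * n + 1)) * ((1 - q ^ (2 * n + 2)) * qTail q (2 * (n + 1) : ℕ)) := by
      have h1 := qTail_sub_one hq ((2 * n + 1 : ℕ) : ℤ)
      have h2 := qTail_sub_one hq ((2 * n + 2 : ℕ) : ℤ)
      rw [zpow_natCast, Nat.cast_succ, add_sub_cancel_right] at h1 h2
      rw [h1, ← Nat.cast_succ, h2, Nat.mul_succ, Nat.cast_succ (2 * n + 1)]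
    have hsucc : ∀ x, qPochFinite x q (n + 1) = qPochFinite x q n * (1 - q ^ n * x) := fun x =>
      Finset.prod_range_succ _ _
    refine mul_left_cancel₀ (mul_ne_zero (hne (2 * n)) (hne (2 * n + 1))) ?_
    rw [tsum_finiteThetaTerm_succ hq hb, ih, htail, hsucc, hsucc]
    field_simp
    ring

lemma tendsto_qPochFinite (hq : ‖q‖ < 1) (x : ℂ) :
    Tendsto (qPochFinite x q) atTop (𝓝 (qPoch x q)) :=
  (multipliable_qPoch hq x).tendsto_prod_tprod_nat

theorem jacobi_triple_product (hq : IsNome q) (hb : b ≠ 0) :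
    ∑' k : ℤ, q ^ tri k * b ^ k = j (-b) q := by
  obtain ⟨C, hC⟩ := exists_norm_finiteThetaTerm_le hq b
  have hsum : Tendsto (fun n : ℕ => ∑' k, finiteThetaTerm q b n k) atTop
      (𝓝 (∑' k : ℤ, q ^ tri k * b ^ k * (1 * 1))) :=
    tendsto_tsum_of_dominated_convergence ((summable_norm_zpow_tri hq hb).mul_right C)
      (fun k => ((tendsto_qTail hq (-k)).mul (tendsto_qTail hq k)).const_mul _)
      (.of_forall hC)
  have htail : Tendsto (fun n : ℕ => qTail q (2 * n : ℕ)) atTop (𝓝 1) := by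
    refine ((tendsto_qTail hq 0).comp (tendsto_id.const_mul_atTop' two_pos)).congr fun n => ?_
    rw [Function.comp_apply, id, add_zero]
  have hprod : Tendsto (fun n : ℕ => ∑' k, finiteThetaTerm q b n k) atTop
      (𝓝 (qPoch (-b) q * qPoch (q / -b) q * (1 * qTail q 0))) := by
    simp only [finite_triple_product hq hb]
    exact ((tendsto_qPochFinite hq.norm_lt_one _).mul (tendsto_qPochFinite hq.norm_lt_one _)).mul
      (htail.mul_const _)
  simpa [j, qTail] using tendsto_nhds_unique hsum hprod

end TripleProduct

section PoleSum

variable {p u : ℂ}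

lemma one_sub_mul_zpow_ne_zero (hp : IsNome p) (hu : j u p ≠ 0) (n : ℤ) : 1 - u * p ^ n ≠ 0 :=
  fun h => by
    have hun : u = p ^ (-n) := by
      rw [zpow_neg]
      exact eq_inv_of_mul_eq_one_left (sub_eq_zero.1 h).symm
    exact hu ((j_eq_zero_iff hp (hun ▸ zpow_ne_zero _ hp.ne_zero)).2 ⟨-n, hun⟩)

lemma exists_one_add_norm_zpow_div_le (hp : IsNome p) (hu : u ≠ 0) :
    ∃ M : ℝ, 0 < M ∧ ∀ n : ℤ, (1 + ‖p ^ n‖) / ‖1 - u * p ^ n‖ ≤ M := by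
  have hpow : Tendsto (fun n : ℕ => p ^ n) atTop (𝓝 0) :=
    tendsto_pow_atTop_nhds_zero_of_norm_lt_one hp.norm_lt_one
  have hpos : Tendsto (fun n : ℕ => (1 + ‖p ^ n‖) / ‖1 - u * p ^ n‖) atTop
      (𝓝 ((1 + ‖(0 : ℂ)‖) / ‖1 - u * 0‖)) :=
    (hpow.norm.const_add 1).div ((hpow.const_mul u).const_sub 1).norm (by simp)
  have hneg : Tendsto (fun n : ℕ => (‖p ^ n‖ + 1) / ‖p ^ n - u‖) atTop
      (𝓝 ((‖(0 : ℂ)‖ + 1) / ‖0 - u‖)) :=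
    (hpow.norm.add_const 1).div (hpow.sub_const u).norm (by simpa using hu)
  obtain ⟨M₁, hM₁⟩ := hpos.bddAbove_range
  obtain ⟨M₂, hM₂⟩ := hneg.bddAbove_range
  refine ⟨max 1 (max M₁ M₂), by positivity, fun n => ?_⟩
  obtain ⟨m, rfl | rfl⟩ := n.eq_nat_or_neg
  · simp only [zpow_natCast]
    exact (hM₁ (Set.mem_range_self m)).trans ((le_max_left _ _).trans (le_max_right _ _))
  · have hpm : p ^ m ≠ 0 := pow_ne_zero m hp.ne_zero
    have hpm' : ‖p ^ m‖ ≠ 0 := norm_ne_zero_iff.2 hpm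
    have hdiv : 1 - u * p ^ (-(m : ℤ)) = (p ^ m - u) / p ^ m := by
      rw [zpow_neg, zpow_natCast, sub_div, div_self hpm, div_eq_mul_inv u]
    have heq : (1 + ‖p ^ (-(m : ℤ))‖) / ‖1 - u * p ^ (-(m : ℤ))‖ = (‖p ^ m‖ + 1) / ‖p ^ m - u‖ := by
      rw [hdiv, zpow_neg, zpow_natCast, norm_div, norm_inv]
      field_simp
    rw [heq]
    exact (hM₂ (Set.mem_range_self m)).trans ((le_max_right _ _).trans (le_max_right _ _))

lemma exists_one_add_norm_zpow_le_ball (hp : IsNome p) (hu : u ≠ 0) :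
    ∃ M : ℝ, ∃ r : ℝ, 0 < M ∧ 0 < r ∧ ∀ w ∈ Metric.ball u r, ∀ n : ℤ, 1 - u * p ^ n ≠ 0 →
      1 + ‖p ^ n‖ ≤ M * ‖1 - w * p ^ n‖ := by
  obtain ⟨M, hM0, hM⟩ := exists_one_add_norm_zpow_div_le hp hu
  refine ⟨2 * M, 1 / (2 * M), by positivity, by positivity, fun w hw n hn => ?_⟩
  have hcenter : 1 + ‖p ^ n‖ ≤ M * ‖1 - u * p ^ n‖ := (div_le_iff₀ (norm_pos_iff.2 hn)).1 (hM n)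
  have htri : ‖1 - u * p ^ n‖ ≤ ‖1 - w * p ^ n‖ + ‖w - u‖ * ‖p ^ n‖ := by
    rw [← norm_mul]
    exact (congrArg _ (by ring)).trans_le (norm_add_le _ _)
  have hdist : M * ‖w - u‖ ≤ 1 / 2 := by
    have h := (lt_div_iff₀ (by positivity)).1 (mem_ball_iff_norm.1 hw)
    linarith
  have hclose : M * ‖w - u‖ * ‖p ^ n‖ ≤ 1 / 2 * ‖p ^ n‖ :=
    mul_le_mul_of_nonneg_right hdist (norm_nonneg _)
  linarith [mul_le_mul_of_nonneg_left htri hM0.le, norm_nonneg (p ^ n)]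

variable {ι : Type*} {n : ι → ℤ} {c : ι → ℂ}

/-- The sum `∑ c_i / (1 - u p^{n_i})`, a meromorphic function of `u` with simple poles at the points
`p^{-n_i}`. -/
def poleSum (p : ℂ) (n : ι → ℤ) (c : ι → ℂ) (u : ℂ) : ℂ := ∑' i, c i / (1 - u * p ^ n i)

lemma summable_poleSum (hp : IsNome p) (hc : Summable fun i => ‖c i‖ / (1 + ‖p ^ n i‖))
    (hu : u ≠ 0) : Summable fun i => c i / (1 - u * p ^ n i) := by
  obtain ⟨M, -, hM⟩ := exists_one_add_norm_zpow_div_le hp hu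
  refine (hc.mul_right M).of_norm_bounded fun i => ?_
  have hpos : 0 < 1 + ‖p ^ n i‖ := by positivity
  calc ‖c i / (1 - u * p ^ n i)‖
      = ‖c i‖ / (1 + ‖p ^ n i‖) * ((1 + ‖p ^ n i‖) / ‖1 - u * p ^ n i‖) := by
        rw [norm_div, div_mul_div_cancel₀ hpos.ne']
    _ ≤ ‖c i‖ / (1 + ‖p ^ n i‖) * M := mul_le_mul_of_nonneg_left (hM _) (by positivity)

lemma differentiableAt_poleSum (hp : IsNome p) (hc : Summable fun i => ‖c i‖ / (1 + ‖p ^ n i‖))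
    (hu : u ≠ 0) (h : ∀ i, c i ≠ 0 → 1 - u * p ^ n i ≠ 0) :
    DifferentiableAt ℂ (poleSum p n c) u := by
  obtain ⟨M, r, -, hr, hM⟩ := exists_one_add_norm_zpow_le_ball hp hu
  have hne : ∀ i, c i ≠ 0 → ∀ w ∈ Metric.ball u r, 0 < ‖1 - w * p ^ n i‖ := fun i hi w hw =>
    (norm_nonneg _).lt_of_ne' fun h0 => by
      have hle := hM w hw _ (h i hi)
      rw [h0, mul_zero] at hle
      linarith [norm_nonneg (p ^ n i)]
  refine DifferentiableOn.differentiableAt ?_ (Metric.ball_mem_nhds u hr)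
  refine Complex.differentiableOn_tsum_of_summable_norm (hc.mul_left M) (fun i w hw => ?_)
    Metric.isOpen_ball (fun i w hw => ?_)
  all_goals rcases eq_or_ne (c i) 0 with hi | hi
  · simp only [hi, zero_div]
    fun_prop
  · have hden : DifferentiableAt ℂ (fun w => 1 - w * p ^ n i) w := by fun_prop
    exact ((differentiableAt_const (c i)).fun_div hden
      (norm_pos_iff.1 (hne i hi w hw))).differentiableWithinAt
  · simp [hi]
  · rw [norm_div, mul_div_assoc', div_le_div_iff₀ (hne i hi w hw) (by positivity)]
    linarith [mul_le_mul_of_nonneg_left (hM w hw _ (h i hi)) (norm_nonneg (c i))]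

lemma summable_norm_update_div [DecidableEq ι] (hc : Summable fun i => ‖c i‖ / (1 + ‖p ^ n i‖))
    (i₀ : ι) : Summable fun i => ‖Function.update c i₀ 0 i‖ / (1 + ‖p ^ n i‖) := by
  refine hc.of_nonneg_of_le (fun i => by positivity) fun i => ?_
  rcases eq_or_ne i i₀ with rfl | hi
  · rw [Function.update_self, norm_zero, zero_div]
    positivity
  · rw [Function.update_of_ne hi]

lemma hasResidueAt_poleSum (hp : IsNome p) (hc : Summable fun i => ‖c i‖ / (1 + ‖p ^ n i‖))
    (hu : u ≠ 0) {i₀ : ι} (hi₀ : u * p ^ n i₀ = 1) (h : ∀ i, c i ≠ 0 → u * p ^ n i = 1 → i = i₀) :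
    HasResidueAt (poleSum p n c) u (-u * c i₀) := by
  classical
  have hpole : HasResidueAt (fun w => c i₀ / (1 - w * p ^ n i₀)) u (c i₀ / -p ^ n i₀) := by
    have hd : HasDerivAt (fun w => 1 - w * p ^ n i₀) (-p ^ n i₀) u := by
      simpa using ((hasDerivAt_id u).mul_const (p ^ n i₀)).const_sub 1
    exact hasResidueAt_div continuousAt_const hd (by rw [hi₀, sub_self])
      (neg_ne_zero.2 (zpow_ne_zero _ hp.ne_zero))
  have hrest : DifferentiableAt ℂ (poleSum p n (Function.update c i₀ 0)) u :=
    differentiableAt_poleSum hp (summable_norm_update_div hc i₀) hu fun i hi h0 => by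
      have hne : i ≠ i₀ := fun he => hi (by rw [he, Function.update_self])
      rw [Function.update_of_ne hne] at hi
      exact hne (h i hi (sub_eq_zero.1 h0).symm)
  have hsum := hpole.add (hasResidueAt_zero_of_continuousAt hrest.continuousAt)
  have hres : -u * c i₀ = c i₀ / -p ^ n i₀ + 0 := by
    rw [eq_inv_of_mul_eq_one_right hi₀, add_zero, div_neg, div_inv_eq_mul]
    ring
  rw [hres]
  refine hsum.congr ?_
  filter_upwards [eventually_punctured_ne hu] with w hw
  rw [poleSum, poleSum, (summable_poleSum hp hc hw).tsum_eq_add_tsum_ite i₀]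
  refine congrArg _ (tsum_congr fun i => ?_)
  rcases eq_or_ne i i₀ with rfl | hi
  · simp
  · simp [hi]

end PoleSum

section Kronecker

variable {p a b : ℂ}

lemma summable_norm_zpow_div (hp : p ≠ 0) (hb : InAnnulus p b) :
    Summable fun t : ℤ => ‖b ^ t‖ / (1 + ‖p ^ t‖) := by
  have hb0 := hb.norm_pos
  refine Summable.of_nat_of_neg ?_ ?_
  · refine (summable_geometric_of_lt_one (norm_nonneg b) hb.norm_lt_one).of_nonneg_of_le
      (fun t => by positivity) fun t => ?_
    rw [zpow_natCast, norm_pow]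
    exact div_le_self (by positivity) (le_add_of_nonneg_right (norm_nonneg _))
  · refine (summable_geometric_of_lt_one (div_nonneg (norm_nonneg p) hb0.le)
      ((div_lt_one hb0).2 hb.lt_norm)).of_nonneg_of_le (fun t => by positivity) fun t => ?_
    calc ‖b ^ (-(t : ℤ))‖ / (1 + ‖p ^ (-(t : ℤ))‖) ≤ ‖b ^ (-(t : ℤ))‖ / ‖p ^ (-(t : ℤ))‖ := by
          refine div_le_div_of_nonneg_left (norm_nonneg _) ?_ (le_add_of_nonneg_left zero_le_one)
          exact norm_pos_iff.2 (zpow_ne_zero _ hp)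
      _ = (‖p‖ / ‖b‖) ^ t := by
          rw [zpow_neg, zpow_neg, zpow_natCast, zpow_natCast, norm_inv, norm_inv, norm_pow,
            norm_pow, inv_div_inv, div_pow]

lemma poleSum_zpow_mul_self (hp : p ≠ 0) (hb : b ≠ 0) (a : ℂ) :
    poleSum p id (fun t => b ^ t) (p * a) = b⁻¹ * poleSum p id (fun t => b ^ t) a := by
  rw [poleSum, poleSum, ← (Equiv.addRight (1 : ℤ)).tsum_eq fun t => b ^ t / (1 - a * p ^ id t),
    ← tsum_mul_left]
  refine tsum_congr fun t => ?_
  rw [Equiv.coe_addRight, id, id, zpow_add_one₀ hb, zpow_add_one₀ hp,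
    show p * a * p ^ t = a * (p ^ t * p) by ring]
  field_simp

lemma differentiableAt_poleSum_zpow (hp : IsNome p) (hb : InAnnulus p b) (ha : a ≠ 0)
    (hja : j a p ≠ 0) : DifferentiableAt ℂ (poleSum p id fun t => b ^ t) a :=
  differentiableAt_poleSum hp (summable_norm_zpow_div hp.ne_zero hb) ha fun t _ =>
    one_sub_mul_zpow_ne_zero hp hja t

lemma hasResidueAt_poleSum_zpow (hp : IsNome p) (hb : InAnnulus p b) :
    HasResidueAt (poleSum p id fun t => b ^ t) 1 (-1) := by
  have h := hasResidueAt_poleSum (i₀ := (0 : ℤ)) hp (summable_norm_zpow_div hp.ne_zero hb)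
    one_ne_zero (by simp) fun t _ ht => hp.zpow_eq_one_iff.1 (by simpa using ht)
  rwa [zpow_zero, mul_one] at h

/-- The theta quotient `(p;p)_∞³ j(ab;p) / (j(a;p) j(b;p))` of Kronecker's identity. -/
def kroneckerQuotient (a b p : ℂ) : ℂ := qPoch p p ^ 3 * j (a * b) p / (j a p * j b p)

lemma kroneckerQuotient_mul_self (hp : IsNome p) (ha : a ≠ 0) (hb : b ≠ 0) :
    kroneckerQuotient (p * a) b p = b⁻¹ * kroneckerQuotient a b p := by
  rw [kroneckerQuotient, kroneckerQuotient, mul_assoc, j_mul_self hp (mul_ne_zero ha hb),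
    j_mul_self hp ha]
  field_simp

lemma differentiableAt_j_mul_const (hp : IsNome p) (ha : a ≠ 0) (hb : b ≠ 0) :
    DifferentiableAt ℂ (fun a => j (a * b) p) a :=
  (differentiableAt_j hp.norm_lt_one (mul_ne_zero ha hb)).comp a
    (differentiableAt_id.mul_const b)

lemma differentiableAt_kroneckerQuotient (hp : IsNome p) (ha : a ≠ 0) (hb : b ≠ 0)
    (hja : j a p ≠ 0) (hjb : j b p ≠ 0) :
    DifferentiableAt ℂ (fun a => kroneckerQuotient a b p) a :=
  ((differentiableAt_j_mul_const hp ha hb).const_mul _).fun_div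
    ((differentiableAt_j hp.norm_lt_one ha).mul_const _) (mul_ne_zero hja hjb)

lemma hasResidueAt_kroneckerQuotient (hp : IsNome p) (hb : b ≠ 0) (hjb : j b p ≠ 0) :
    HasResidueAt (fun a => kroneckerQuotient a b p) 1 (-1) := by
  have hP : qPoch p p ^ 3 ≠ 0 := pow_ne_zero 3 (qPoch_self_ne_zero hp.norm_lt_one)
  have h := hasResidueAt_div
    ((differentiableAt_j_mul_const hp one_ne_zero hb).continuousAt.const_mul (qPoch p p ^ 3))
    ((hasDerivAt_j_one hp.norm_lt_one).mul_const (j b p))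
    (by rw [j_one hp.norm_lt_one, zero_mul]) (mul_ne_zero (neg_ne_zero.2 hP) hjb)
  rwa [one_mul, neg_mul, div_neg, div_self (mul_ne_zero hP hjb)] at h

theorem kronecker_identity (hp : IsNome p) (hb : InAnnulus p b) (ha : a ≠ 0) (hja : j a p ≠ 0) :
    poleSum p id (fun t => b ^ t) a = kroneckerQuotient a b p := by
  have hb0 := hb.ne_zero
  have hjb := hb.j_ne_zero hp
  have hb1 : 1 < ‖b⁻¹‖ := by
    rw [norm_inv]
    exact (one_lt_inv₀ hb.norm_pos).2 hb.norm_lt_one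
  rw [← sub_eq_zero]
  refine eq_zero_of_qShift (D := fun a => poleSum p id (fun t => b ^ t) a - kroneckerQuotient a b p)
    (S := {a | j a p ≠ 0}) (μ := fun _ => b⁻¹) hp continuous_const (fun _ _ => inv_ne_zero hb0) ?_
    ?_ (fun x hx => eventually_j_ne_zero hp hx) ?_ ?_ ?_ hja ha
  · rw [← div_eq_mul_inv, norm_div]
    exact (div_lt_one hb.norm_pos).2 hb.lt_norm
  · intro k hk
    rw [hk, norm_pow] at hb1
    exact hb1.not_ge (pow_le_one₀ (norm_nonneg p) hp.norm_lt_one.le)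
  · exact fun x hx hx0 => (differentiableAt_poleSum_zpow hp hb hx0 hx).sub
      (differentiableAt_kroneckerQuotient hp hx0 hb0 hx hjb)
  · intro x _ hx0
    rw [poleSum_zpow_mul_self hp.ne_zero hb0, kroneckerQuotient_mul_self hp hx0 hb0, mul_sub]
  · intro x hx hx0
    obtain ⟨n, rfl⟩ := (j_eq_zero_iff hp hx0).1 (not_not.1 hx)
    refine ⟨1, one_ne_zero, ⟨n, (mul_one _).symm⟩, ?_⟩
    simpa only [sub_self] using
      (hasResidueAt_poleSum_zpow hp hb).sub (hasResidueAt_kroneckerQuotient hp hb0 hjb)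

end Kronecker

section AppellSum

variable {p a b : ℂ}

/-- The bilateral sum `∑ p^{r(r-1)/2} b^r / (1 - a p^r)`, the numerator of an Appell–Lerch
function. -/
def appellSum (a b p : ℂ) : ℂ := poleSum p id (fun r => p ^ tri r * b ^ r) a

lemma appellSum_eq_tsum (a b p : ℂ) :
    appellSum a b p = ∑' r : ℤ, p ^ tri r * b ^ r / (1 - a * p ^ r) := rfl

lemma summable_norm_zpow_tri_div (hp : IsNome p) (hb : b ≠ 0) :
    Summable fun r : ℤ => ‖p ^ tri r * b ^ r‖ / (1 + ‖p ^ r‖) :=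
  (summable_norm_zpow_tri hp hb).of_nonneg_of_le (fun r => by positivity) fun _ =>
    div_le_self (norm_nonneg _) (le_add_of_nonneg_right (norm_nonneg _))

lemma summable_appellSum (hp : IsNome p) (ha : a ≠ 0) (hb : b ≠ 0) :
    Summable fun r : ℤ => p ^ tri r * b ^ r / (1 - a * p ^ r) :=
  summable_poleSum (n := id) hp (summable_norm_zpow_tri_div hp hb) ha

lemma appellSum_mul_left (hp : IsNome p) (ha : a ≠ 0) (hb : b ≠ 0) (hja : j a p ≠ 0) :
    appellSum (p * a) b p = j (-b) p + p * a / b * appellSum a b p := by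
  have hsum := summable_appellSum hp ha hb
  have hshift := (Equiv.addRight (1 : ℤ)).summable_iff.2 hsum
  simp only [Function.comp_def, Equiv.coe_addRight] at hshift
  rw [← sub_eq_iff_eq_add, ← jacobi_triple_product hp hb, appellSum_eq_tsum, appellSum_eq_tsum,
    ← (Equiv.addRight (1 : ℤ)).tsum_eq fun r => p ^ tri r * b ^ r / (1 - a * p ^ r),
    ← tsum_mul_left]
  simp only [Equiv.coe_addRight]
  rw [← (summable_appellSum hp (mul_ne_zero hp.ne_zero ha) hb).tsum_sub (hshift.mul_left _)]
  refine tsum_congr fun r => ?_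
  have h := one_sub_mul_zpow_ne_zero hp hja (r + 1)
  rw [show p * a * p ^ r = a * p ^ (r + 1) by rw [zpow_add_one₀ hp.ne_zero]; ring,
    zpow_tri_add_one hp.ne_zero, zpow_add_one₀ hb, mul_div_assoc', ← sub_div, div_eq_iff h,
    zpow_add_one₀ hp.ne_zero]
  field_simp

lemma appellSum_mul_right (hp : IsNome p) (ha : a ≠ 0) (hb : b ≠ 0) (hja : j a p ≠ 0) :
    appellSum a (p * b) p = a⁻¹ * (appellSum a b p - j (-b) p) := by
  rw [← jacobi_triple_product hp hb, appellSum_eq_tsum, appellSum_eq_tsum,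
    ← (summable_appellSum hp ha hb).tsum_sub (summable_norm_zpow_tri hp hb).of_norm,
    ← tsum_mul_left]
  refine tsum_congr fun r => ?_
  have h : 1 - p ^ r * a ≠ 0 := mul_comm a (p ^ r) ▸ one_sub_mul_zpow_ne_zero hp hja r
  rw [mul_zpow]
  field_simp
  ring

lemma appellSum_symm (hp : IsNome p) (ha : a ≠ 0) (hb : b ≠ 0) (hja : j a p ≠ 0) :
    appellSum a b p = -(b / (p * a)) * appellSum (p * a)⁻¹ (p / b) p := by
  rw [appellSum_eq_tsum, appellSum_eq_tsum, ← (Equiv.subLeft (1 : ℤ)).tsum_eq, ← tsum_mul_left]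
  refine tsum_congr fun r => ?_
  have hp0 := hp.ne_zero
  have hr : p ^ r ≠ 0 := zpow_ne_zero r hp0
  have harg : a * p ^ (1 - r) = p * a / p ^ r := by
    rw [zpow_sub₀ hp0, zpow_one, mul_div_assoc', mul_comm a]
  have hne : p * a - p ^ r ≠ 0 := fun h => one_sub_mul_zpow_ne_zero hp hja (1 - r) <| by
    rw [harg, sub_eq_zero.1 h, div_self hr, sub_self]
  have hl : 1 - p * a / p ^ r = -(p * a - p ^ r) / p ^ r := by
    field_simp
    ring
  have hr' : 1 - (p * a)⁻¹ * p ^ r = (p * a - p ^ r) / (p * a) := by field_simp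
  rw [Equiv.subLeft_apply, tri_one_sub, harg, hl, hr', div_zpow, zpow_sub₀ hb, zpow_one]
  field_simp

lemma differentiableAt_appellSum_left (hp : IsNome p) (ha : a ≠ 0) (hb : b ≠ 0)
    (hja : j a p ≠ 0) : DifferentiableAt ℂ (fun a => appellSum a b p) a :=
  differentiableAt_poleSum hp (summable_norm_zpow_tri_div hp hb) ha fun r _ =>
    one_sub_mul_zpow_ne_zero hp hja r

lemma hasResidueAt_appellSum (hp : IsNome p) (hb : b ≠ 0) :
    HasResidueAt (fun a => appellSum a b p) 1 (-1) := by
  have h := hasResidueAt_poleSum (i₀ := (0 : ℤ)) hp (summable_norm_zpow_tri_div hp hb)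
    one_ne_zero (by simp) fun r _ hr => hp.zpow_eq_one_iff.1 (by simpa using hr)
  rwa [tri_zero, zpow_zero, zpow_zero, mul_one, mul_one] at h

lemma differentiableAt_tsum_mul_zpow {c : ℤ → ℂ}
    (hc : ∀ R : ℝ, 0 < R → Summable fun r : ℤ => ‖c r‖ * R ^ r) (hb : b ≠ 0) :
    DifferentiableAt ℂ (fun b => ∑' r : ℤ, c r * b ^ r) b := by
  have hb0 : 0 < ‖b‖ := norm_pos_iff.2 hb
  have hball : ∀ w ∈ Metric.ball b (‖b‖ / 2), ‖b‖ / 2 ≤ ‖w‖ ∧ ‖w‖ ≤ 2 * ‖b‖ := fun w hw => by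
    rw [mem_ball_iff_norm] at hw
    constructor <;> linarith [norm_sub_norm_le b w, norm_sub_norm_le w b, norm_sub_rev b w]
  refine DifferentiableOn.differentiableAt (s := Metric.ball b (‖b‖ / 2)) ?_
    (Metric.ball_mem_nhds b (by positivity))
  refine Complex.differentiableOn_tsum_of_summable_norm
    ((hc (‖b‖ / 2) (by positivity)).add (hc (2 * ‖b‖) (by positivity)))
    (fun r w hw => ?_) Metric.isOpen_ball fun r w hw => ?_
  · have hw0 : w ≠ 0 := norm_pos_iff.1 ((by positivity : 0 < ‖b‖ / 2).trans_le (hball w hw).1)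
    exact ((differentiableAt_zpow.2 (.inl hw0)).const_mul _).differentiableWithinAt
  · obtain ⟨hlow, hupp⟩ := hball w hw
    rw [norm_mul, norm_zpow, ← mul_add]
    refine mul_le_mul_of_nonneg_left ?_ (norm_nonneg _)
    obtain ⟨m, rfl | rfl⟩ := r.eq_nat_or_neg
    · simp only [zpow_natCast]
      exact (pow_le_pow_left₀ (norm_nonneg w) hupp m).trans
        (le_add_of_nonneg_left (by positivity))
    · simp only [zpow_neg, zpow_natCast]
      exact (inv_anti₀ (by positivity) (pow_le_pow_left₀ (by positivity) hlow m)).trans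
        (le_add_of_nonneg_right (by positivity))

lemma differentiableAt_appellSum_right (hp : IsNome p) (ha : a ≠ 0) (hb : b ≠ 0) :
    DifferentiableAt ℂ (fun b => appellSum a b p) b := by
  have h : DifferentiableAt ℂ (fun b => ∑' r : ℤ, p ^ tri r / (1 - a * p ^ r) * b ^ r) b := by
    refine differentiableAt_tsum_mul_zpow (fun R hR => ?_) hb
    have hs := (summable_appellSum hp ha (Complex.ofReal_ne_zero.2 hR.ne')).norm
    refine hs.congr fun r => ?_
    rw [mul_div_right_comm, norm_mul, norm_zpow, Complex.norm_of_nonneg hR.le]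
  simpa only [appellSum_eq_tsum, div_mul_eq_mul_div] using h

end AppellSum

section AppellLerch

variable {p x z z₀ z₁ : ℂ}

lemma appellLerch_eq (hp : p ≠ 0) (x z : ℂ) :
    appellLerch x p z = appellSum (x * z / p) (-z) p / j z p := by
  rw [appellLerch, one_div, inv_mul_eq_div, appellSum_eq_tsum]
  refine congrArg (· / _) (tsum_congr fun r => ?_)
  rw [tri, ← neg_one_mul z, mul_zpow, zpow_sub_one₀ hp]
  field_simp

lemma j_div_self_ne_zero (hp : IsNome p) (hx : x ≠ 0) (h : j x p ≠ 0) : j (x / p) p ≠ 0 := by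
  rw [← mul_div_cancel₀ x hp.ne_zero, j_mul_self hp (div_ne_zero hx hp.ne_zero)] at h
  exact right_ne_zero_of_mul h

lemma j_inv_ne_zero (hp : IsNome p) (hx : x ≠ 0) (h : j x p ≠ 0) : j x⁻¹ p ≠ 0 := by
  rw [j_inv hp hx]
  exact mul_ne_zero (neg_ne_zero.2 (inv_ne_zero hx)) h

lemma appellLerch_mul_self (hp : IsNome p) (hx : x ≠ 0) (hz : z ≠ 0) (hjz : j z p ≠ 0)
    (hjxz : j (x * z) p ≠ 0) : appellLerch (p * x) p z = 1 - x * appellLerch x p z := by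
  have hp0 := hp.ne_zero
  have hxz := mul_ne_zero hx hz
  rw [appellLerch_eq hp0, appellLerch_eq hp0, mul_assoc p, mul_div_assoc p,
    appellSum_mul_left hp (div_ne_zero hxz hp0) (neg_ne_zero.2 hz)
      (j_div_self_ne_zero hp hxz hjxz), neg_neg]
  field_simp
  ring

lemma appellLerch_self_div (hp : IsNome p) (hx : x ≠ 0) (hz : z ≠ 0) (hjz : j z p ≠ 0)
    (hjxz : j (x * z) p ≠ 0) : appellLerch (p / x) p z⁻¹ = 1 - appellLerch x p z := by
  have hp0 := hp.ne_zero
  have hxz := mul_ne_zero hx hz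
  rw [appellLerch_eq hp0, appellLerch_eq hp0, appellSum_symm hp (div_ne_zero hxz hp0)
    (neg_ne_zero.2 hz) (j_div_self_ne_zero hp hxz hjxz), mul_div_cancel₀ _ hp0,
    show p / -z = p * -z⁻¹ by field_simp,
    appellSum_mul_right hp (inv_ne_zero hxz) (neg_ne_zero.2 (inv_ne_zero hz))
      (j_inv_ne_zero hp hxz hjxz), neg_neg, j_inv hp hz,
    show p / x * z⁻¹ / p = (x * z)⁻¹ by field_simp]
  field_simp
  ring

lemma differentiableAt_appellLerch (hp : IsNome p) (hx : x ≠ 0) (hz : z ≠ 0)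
    (hjxz : j (x * z) p ≠ 0) : DifferentiableAt ℂ (fun x => appellLerch x p z) x := by
  have hxz := mul_ne_zero hx hz
  simp only [appellLerch_eq hp.ne_zero]
  exact ((differentiableAt_appellSum_left hp (div_ne_zero hxz hp.ne_zero) (neg_ne_zero.2 hz)
    (j_div_self_ne_zero hp hxz hjxz)).comp (f := fun x => x * z / p) x (by fun_prop)).div_const _

lemma hasResidueAt_appellLerch (hp : IsNome p) (hz : z ≠ 0) :
    HasResidueAt (fun x => appellLerch x p z) (p / z) (-p / (z * j z p)) := by
  have hp0 := hp.ne_zero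
  have hone : p / z * z / p = 1 := by field_simp
  have hd : HasDerivAt (fun x => x * z / p) (z / p) (p / z) := by
    simpa using ((hasDerivAt_id (p / z)).mul_const z).div_const p
  have h : HasResidueAt (fun a => appellSum a (-z) p) (p / z * z / p) (-1) :=
    hone ▸ hasResidueAt_appellSum hp (neg_ne_zero.2 hz)
  simp only [appellLerch_eq hp0]
  convert (h.comp (g := fun x => x * z / p) hd (div_ne_zero hz hp0)).div_const (j z p) using 1
  rw [div_div_eq_mul_div, neg_one_mul, div_div]

/-- The theta quotient by which `m(x, p, z)` changes when its parameter `z₀` is replaced by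
`z₁`. -/
def changeTheta (x p z₀ z₁ : ℂ) : ℂ :=
  z₀ * qPoch p p ^ 3 * j (z₁ / z₀) p * j (x * z₀ * z₁) p /
    (j z₀ p * j z₁ p * (j (x * z₀) p * j (x * z₁) p))

lemma changeTheta_swap (hp : IsNome p) (h₀ : z₀ ≠ 0) (h₁ : z₁ ≠ 0) (x : ℂ) :
    changeTheta x p z₁ z₀ = -changeTheta x p z₀ z₁ := by
  have h := j_inv hp (div_ne_zero h₁ h₀)
  rw [inv_div] at h
  rw [changeTheta, changeTheta, h, mul_right_comm x z₁ z₀, ← neg_div]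
  field_simp

lemma changeTheta_mul_self (hp : IsNome p) (hx : x ≠ 0) (h₀ : z₀ ≠ 0) (h₁ : z₁ ≠ 0) :
    changeTheta (p * x) p z₀ z₁ = -x * changeTheta x p z₀ z₁ := by
  rw [changeTheta, changeTheta, show p * x * z₀ * z₁ = p * (x * z₀ * z₁) by ring,
    mul_assoc p x z₀, mul_assoc p x z₁, j_mul_self hp (mul_ne_zero (mul_ne_zero hx h₀) h₁),
    j_mul_self hp (mul_ne_zero hx h₀), j_mul_self hp (mul_ne_zero hx h₁)]
  field_simp

lemma differentiableAt_changeTheta (hp : IsNome p) (hx : x ≠ 0) (h₀ : z₀ ≠ 0) (h₁ : z₁ ≠ 0)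
    (hj₀ : j z₀ p ≠ 0) (hj₁ : j z₁ p ≠ 0) (hx₀ : j (x * z₀) p ≠ 0) (hx₁ : j (x * z₁) p ≠ 0) :
    DifferentiableAt ℂ (fun x => changeTheta x p z₀ z₁) x := by
  simp only [changeTheta, mul_assoc _ z₀ z₁]
  exact ((differentiableAt_j_mul_const hp hx (mul_ne_zero h₀ h₁)).const_mul _).fun_div
    (((differentiableAt_j_mul_const hp hx h₀).mul
      (differentiableAt_j_mul_const hp hx h₁)).const_mul _)
    (mul_ne_zero (mul_ne_zero hj₀ hj₁) (mul_ne_zero hx₀ hx₁))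

lemma hasResidueAt_changeTheta (hp : IsNome p) (h₀ : z₀ ≠ 0) (h₁ : z₁ ≠ 0) (hj₀ : j z₀ p ≠ 0)
    (hj₁ : j z₁ p ≠ 0) (hj₀₁ : j (z₁ / z₀) p ≠ 0) :
    HasResidueAt (fun x => changeTheta x p z₀ z₁) (p / z₁) (-p / (z₁ * j z₁ p)) := by
  have hp0 := hp.ne_zero
  have hP := qPoch_self_ne_zero hp.norm_lt_one
  have hx : p / z₁ ≠ 0 := div_ne_zero hp0 h₁
  have hj : j (p / z₁ * z₀) p = j (z₁ / z₀) p := by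
    rw [← j_self_div hp0 (z₁ / z₀), div_div_eq_mul_div, div_mul_eq_mul_div]
  have hnum : j (p / z₁ * (z₀ * z₁)) p = -z₀⁻¹ * j z₀ p := by
    rw [← j_mul_self hp h₀]
    congr 1
    field_simp
  have hden : HasDerivAt (fun x => j (x * z₁) p) (qPoch p p ^ 3 / p * z₁) (p / z₁) := by
    have hmul : HasDerivAt (fun x => x * z₁) z₁ (p / z₁) := by
      simpa using (hasDerivAt_id (p / z₁)).mul_const z₁
    exact (hasDerivAt_j_self hp).comp_of_eq (p / z₁) hmul (div_mul_cancel₀ p h₁).symm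
  have hcont : ContinuousAt (fun x => z₀ * qPoch p p ^ 3 * j (z₁ / z₀) p * j (x * (z₀ * z₁)) p /
      (j z₀ p * j z₁ p * j (x * z₀) p)) (p / z₁) :=
    (((differentiableAt_j_mul_const hp hx (mul_ne_zero h₀ h₁)).const_mul _).fun_div
      ((differentiableAt_j_mul_const hp hx h₀).const_mul _)
      (mul_ne_zero (mul_ne_zero hj₀ hj₁) (hj ▸ hj₀₁))).continuousAt
  have hres := hasResidueAt_div hcont hden
    (by rw [div_mul_cancel₀ p h₁, (j_eq_zero_iff hp hp0).2 ⟨1, (zpow_one p).symm⟩])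
    (mul_ne_zero (div_ne_zero (pow_ne_zero 3 hP) hp0) h₁)
  rw [hj, hnum] at hres
  convert hres using 1
  · funext x
    rw [changeTheta, mul_assoc x, div_div]
    ring
  · field_simp

lemma hasResidueAt_appellLerch_sub (hp : IsNome p) (h₀ : z₀ ≠ 0) (h₁ : z₁ ≠ 0)
    (hj₀ : j z₀ p ≠ 0) (hj₁ : j z₁ p ≠ 0) (hj₀₁ : j (z₁ / z₀) p ≠ 0) :
    HasResidueAt (fun x => appellLerch x p z₁ - appellLerch x p z₀ - changeTheta x p z₀ z₁)
      (p / z₁) 0 := by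
  have hj : j (p / z₁ * z₀) p ≠ 0 := by
    rwa [div_mul_eq_mul_div, ← div_div_eq_mul_div, j_self_div hp.ne_zero]
  have hreg := hasResidueAt_zero_of_continuousAt
    (differentiableAt_appellLerch hp (div_ne_zero hp.ne_zero h₁) h₀ hj).continuousAt
  simpa only [sub_zero, sub_self] using
    ((hasResidueAt_appellLerch hp h₁).sub hreg).sub (hasResidueAt_changeTheta hp h₀ h₁ hj₀ hj₁ hj₀₁)

lemma exists_eq_zpow_mul_div (hp : IsNome p) (hx : x ≠ 0) (hz : z ≠ 0) (h : j (x * z) p = 0) :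
    ∃ n : ℤ, x = p ^ n * (p / z) := by
  obtain ⟨n, hn⟩ := (j_eq_zero_iff hp (mul_ne_zero hx hz)).1 h
  refine ⟨n - 1, ?_⟩
  rw [mul_div_assoc', ← zpow_add_one₀ hp.ne_zero, sub_add_cancel, ← hn, mul_div_cancel_right₀ _ hz]

lemma eventually_j_mul_const_ne_zero (hp : IsNome p) (hx : x ≠ 0) (hz : z ≠ 0) :
    ∀ᶠ w in 𝓝[≠] x, j (w * z) p ≠ 0 := by
  have h := (tendsto_const_mul_punctured hz x).eventually
    (eventually_j_ne_zero hp (mul_ne_zero hz hx))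
  simpa only [mul_comm] using h

theorem appellLerch_sub (hp : IsNome p) (hx : x ≠ 0) (h₀ : z₀ ≠ 0) (h₁ : z₁ ≠ 0)
    (hj₀ : j z₀ p ≠ 0) (hj₁ : j z₁ p ≠ 0) (hj₀₁ : j (z₁ / z₀) p ≠ 0) (hx₀ : j (x * z₀) p ≠ 0)
    (hx₁ : j (x * z₁) p ≠ 0) :
    appellLerch x p z₁ - appellLerch x p z₀ = changeTheta x p z₀ z₁ := by
  rw [← sub_eq_zero]
  refine eq_zero_of_qShift (μ := fun x => -x) (S := {x | j (x * z₀) p ≠ 0 ∧ j (x * z₁) p ≠ 0})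
    (D := fun x => appellLerch x p z₁ - appellLerch x p z₀ - changeTheta x p z₀ z₁) hp
    continuous_neg (fun _ => neg_ne_zero.2) (by simp) (fun k => ?_) (fun x hx => ?_) ?_ ?_ ?_
    ⟨hx₀, hx₁⟩ hx
  · simpa using (pow_ne_zero k hp.ne_zero).symm
  · exact (eventually_j_mul_const_ne_zero hp hx h₀).and (eventually_j_mul_const_ne_zero hp hx h₁)
  · exact fun x ⟨hx₀, hx₁⟩ hx => ((differentiableAt_appellLerch hp hx h₁ hx₁).sub
      (differentiableAt_appellLerch hp hx h₀ hx₀)).sub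
        (differentiableAt_changeTheta hp hx h₀ h₁ hj₀ hj₁ hx₀ hx₁)
  · intro x ⟨hx₀, hx₁⟩ hx
    rw [appellLerch_mul_self hp hx h₁ hj₁ hx₁, appellLerch_mul_self hp hx h₀ hj₀ hx₀,
      changeTheta_mul_self hp hx h₀ h₁]
    ring
  · intro x hxS hx
    by_cases hx₁ : j (x * z₁) p = 0
    · exact ⟨p / z₁, div_ne_zero hp.ne_zero h₁, exists_eq_zpow_mul_div hp hx h₁ hx₁,
        hasResidueAt_appellLerch_sub hp h₀ h₁ hj₀ hj₁ hj₀₁⟩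
    · have hx₀ : j (x * z₀) p = 0 := not_not.1 fun h => hxS ⟨h, hx₁⟩
      refine ⟨p / z₀, div_ne_zero hp.ne_zero h₀, exists_eq_zpow_mul_div hp hx h₀ hx₀, ?_⟩
      have hj₁₀ : j (z₀ / z₁) p ≠ 0 :=
        inv_div z₁ z₀ ▸ j_inv_ne_zero hp (div_ne_zero h₁ h₀) hj₀₁
      have h := (hasResidueAt_appellLerch_sub hp h₁ h₀ hj₁ hj₀ hj₁₀).const_mul (-1)
      rw [mul_zero] at h
      refine h.congr (Eventually.of_forall fun w => ?_)
      simp only [changeTheta_swap hp h₀ h₁ w]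
      ring

end AppellLerch

section Symmetric

variable {q y z ε : ℂ}

lemma InAnnulus.sign_mul (hy : InAnnulus q y) (hε : ε ^ 2 = 1) : InAnnulus q (ε * y) := by
  rcases eq_or_eq_neg_of_sq_eq_sq ε 1 (by rw [hε, one_pow]) with rfl | rfl
  · rwa [one_mul]
  · rw [neg_one_mul]
    exact hy.neg

lemma neg_sign_mul_div_inv (hy : y ≠ 0) (hε : ε ^ 2 = 1) :
    -(ε * z) / (-(ε * y))⁻¹ = y * z := by
  have : ε ≠ 0 := fun h => by simp [h] at hε
  field_simp
  linear_combination z * hε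

lemma neg_sign_mul_mul_inv (hy : y ≠ 0) (hε : ε ^ 2 = 1) :
    -(ε * q * y / z) * (-(ε * y))⁻¹ = q ^ 2 / (q * z) := by
  have hε0 : ε ≠ 0 := fun h => by simp [h] at hε
  rcases eq_or_ne q 0 with rfl | hq
  · simp
  · field_simp

lemma neg_sign_mul_mul_neg (hz : z ≠ 0) (hε : ε ^ 2 = 1) :
    -(ε * q * y / z) * -(ε * z) = q * y := by
  field_simp
  linear_combination (q * y) * hε

lemma changeTheta_sign (hq : IsNome q) (hy : y ≠ 0) (hz : z ≠ 0) (hε : ε ^ 2 = 1) :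
    changeTheta (-(ε * q * y / z)) (q ^ 2) (-(ε * y))⁻¹ (-(ε * z)) =
      -(qPoch (q ^ 2) (q ^ 2) ^ 3 * j (y * z) (q ^ 2) * j (-(ε * q)) (q ^ 2) /
        (j (-(ε * y)) (q ^ 2) * j (-(ε * z)) (q ^ 2) *
          (j (q * y) (q ^ 2) * j (q * z) (q ^ 2)))) := by
  have hq0 := hq.ne_zero
  have hε0 : ε ≠ 0 := fun h => by simp [h] at hε
  have hx₀₁ : q ^ 2 / (q * z) * -(ε * z) = -(ε * q) := by field_simp
  rw [changeTheta, neg_sign_mul_div_inv hy hε, neg_sign_mul_mul_inv hy hε, hx₀₁,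
    neg_sign_mul_mul_neg hz hε, j_self_div hq.sq.ne_zero,
    j_inv hq.sq (neg_ne_zero.2 (mul_ne_zero hε0 hy))]
  field_simp

theorem appellLerch_add_appellLerch (hq : IsNome q) (hy : InAnnulus q y) (hz : InAnnulus q z)
    (hε : ε ^ 2 = 1) :
    appellLerch (-(ε * q * y / z)) (q ^ 2) (-(ε * z)) +
      appellLerch (-(ε * q * z / y)) (q ^ 2) (-(ε * y)) =
    1 - qPoch (q ^ 2) (q ^ 2) ^ 3 * j (y * z) (q ^ 2) * j (-(ε * q)) (q ^ 2) /
      (j (-(ε * y)) (q ^ 2) * j (-(ε * z)) (q ^ 2) * (j (q * y) (q ^ 2) * j (q * z) (q ^ 2))) := by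
  have hq0 := hq.ne_zero
  have hy0 := hy.ne_zero
  have hz0 := hz.ne_zero
  have hε0 : ε ≠ 0 := fun h => by simp [h] at hε
  have hεy := (hy.sign_mul hε).neg.sq_base
  have hεz := (hz.sign_mul hε).neg.sq_base
  have hjεy := hεy.j_ne_zero hq.sq
  have hjqy := (hy.self_mul hq).j_ne_zero hq.sq
  have hjqz := (hz.self_mul hq).j_ne_zero hq.sq
  have hself := appellLerch_self_div hq.sq (x := -(ε * q * z / y)) (z := -(ε * y))
    (by simp [*]) hεy.ne_zero hjεy (by
      convert hjqz using 2
      field_simp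
      exact hε)
  have hchange := appellLerch_sub hq.sq (x := -(ε * q * y / z)) (z₀ := (-(ε * y))⁻¹)
    (z₁ := -(ε * z)) (by simp [*]) (inv_ne_zero hεy.ne_zero) hεz.ne_zero
    (j_inv_ne_zero hq.sq hεy.ne_zero hjεy) (hεz.j_ne_zero hq.sq)
    (by
      rw [neg_sign_mul_div_inv hy0 hε]
      exact (hy.mul hz).j_ne_zero hq.sq)
    (by
      rw [neg_sign_mul_mul_inv hy0 hε, j_self_div hq.sq.ne_zero]
      exact hjqz)
    (by
      rw [neg_sign_mul_mul_neg hz0 hε]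
      exact hjqy)
  have harg : q ^ 2 / -(ε * q * z / y) = -(ε * q * y / z) := by
    field_simp
    exact congrArg Neg.neg hε.symm
  rw [harg] at hself
  rw [changeTheta_sign hq hy0 hz0 hε, hself] at hchange
  linear_combination hchange

end Symmetric

section SameSign

variable {b c p u : ℂ} {r s t : ℤ}

lemma sg_of_nonneg (h : 0 ≤ r) : sg r = 1 := if_pos h

lemma sg_of_neg (h : r < 0) : sg r = -1 := if_neg (not_le.2 h)

lemma sg_eq_sg_iff : sg s = sg t ↔ (0 ≤ s ↔ 0 ≤ t) := by
  unfold sg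
  split_ifs with hs ht ht <;> simp [hs, ht]

lemma sg_mul_sg_self (r : ℤ) : (sg r : ℂ) * sg r = 1 := by
  unfold sg
  split_ifs <;> simp

lemma hasSum_zpow_nonneg (hu : ‖u‖ < 1) :
    HasSum (fun r : ℤ => if 0 ≤ r then u ^ r else 0) (1 - u)⁻¹ := by
  rw [← add_zero (1 - u)⁻¹]
  refine HasSum.of_nat_of_neg_add_one ?_ ?_
  · simpa using hasSum_geometric_of_norm_lt_one hu
  · refine hasSum_zero.congr_fun fun n => if_neg ?_
    omega

lemma hasSum_zpow_neg (hu : 1 < ‖u‖) :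
    HasSum (fun r : ℤ => if r < 0 then u ^ r else 0) (-(1 - u)⁻¹) := by
  have hu0 : u ≠ 0 := norm_pos_iff.1 (one_pos.trans hu)
  have hgeom := (hasSum_geometric_of_norm_lt_one (ξ := u⁻¹)
    (by rw [norm_inv]; exact inv_lt_one_of_one_lt₀ hu)).mul_left u⁻¹
  have hval : u⁻¹ * (1 - u⁻¹)⁻¹ = -(1 - u)⁻¹ := by
    rw [← mul_inv, mul_sub, mul_one, mul_inv_cancel₀ hu0, ← neg_sub 1 u, inv_neg]
  rw [hval] at hgeom
  rw [← zero_add (-(1 - u)⁻¹)]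
  refine HasSum.of_nat_of_neg_add_one ?_ (hgeom.congr_fun fun n => ?_)
  · exact hasSum_zero.congr_fun fun n => if_neg (by omega)
  · rw [if_pos (by omega), zpow_neg, zpow_add_one₀ hu0, zpow_natCast, mul_inv, inv_pow, mul_comm]

lemma hasSum_zpow_sg_eq (hpos : 0 ≤ t → ‖u‖ < 1) (hneg : t < 0 → 1 < ‖u‖) :
    HasSum (fun r : ℤ => if sg r = sg t then u ^ r else 0) ((sg t : ℂ) / (1 - u)) := by
  simp only [sg_eq_sg_iff]
  rcases le_or_gt 0 t with ht | ht
  · simpa only [sg_of_nonneg ht, Int.cast_one, one_div, iff_true_right ht]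
      using hasSum_zpow_nonneg (hpos ht)
  · simpa only [sg_of_neg ht, Int.cast_neg, Int.cast_one, neg_div, one_div,
      iff_false_right ht.not_ge, not_le] using hasSum_zpow_neg (hneg ht)

/-- The modulus of `b ^ s` for `s ≥ 0` and of `(b / p) ^ s` for `s < 0`: a summable majorant of the
powers of a point `b` of the annulus `|p| < |b| < 1`. -/
def annulusBound (p b : ℂ) (s : ℤ) : ℝ := if 0 ≤ s then ‖b‖ ^ s else ‖b / p‖ ^ s

lemma annulusBound_nonneg (p b : ℂ) (s : ℤ) : 0 ≤ annulusBound p b s := by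
  unfold annulusBound
  split_ifs <;> positivity

lemma summable_annulusBound (hb : InAnnulus p b) : Summable (annulusBound p b) := by
  refine Summable.of_nat_of_neg_add_one ?_ ?_
  · refine (summable_geometric_of_lt_one (norm_nonneg b) hb.norm_lt_one).congr fun n => ?_
    rw [annulusBound, if_pos (Int.natCast_nonneg n), zpow_natCast]
  · have hlt : ‖p / b‖ < 1 := by
      rw [norm_div]
      exact (div_lt_one hb.norm_pos).2 hb.lt_norm
    refine ((summable_geometric_of_lt_one (norm_nonneg _) hlt).comp_injective
      (add_left_injective 1)).congr fun n => ?_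
    rw [annulusBound, if_neg (by omega), zpow_neg, ← inv_zpow, ← norm_inv, inv_div]
    exact_mod_cast rfl

lemma summable_of_le_annulusBound (hb : InAnnulus p b) (hc : InAnnulus p c) {f : ℤ × ℤ → ℝ}
    {C : ℝ} (hf : ∀ i, 0 ≤ f i) (h0 : ∀ i : ℤ × ℤ, sg i.1 ≠ sg i.2 → f i = 0)
    (hpos : ∀ s t : ℤ, 0 ≤ s → 0 ≤ t → f (s, t) ≤ C * (‖b‖ ^ s * ‖c‖ ^ t))
    (hneg : ∀ s t : ℤ, s < 0 → t < 0 → f (s, t) ≤ C * (‖b / p‖ ^ s * ‖c / p‖ ^ t)) :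
    Summable f := by
  have hC : 0 ≤ C := by simpa using (hf (0, 0)).trans (hpos 0 0 le_rfl le_rfl)
  have hsum := (summable_annulusBound hb).mul_of_nonneg (summable_annulusBound hc)
    (annulusBound_nonneg p b) (annulusBound_nonneg p c)
  refine (hsum.mul_left C).of_nonneg_of_le hf fun ⟨s, t⟩ => ?_
  by_cases hst : sg s = sg t
  · rw [sg_eq_sg_iff] at hst
    unfold annulusBound
    rcases le_or_gt 0 t with ht | ht
    · simpa only [if_pos (hst.2 ht), if_pos ht] using hpos s t (hst.2 ht) ht
    · have hs : ¬0 ≤ s := fun hs => ht.not_ge (hst.1 hs)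
      simpa only [if_neg hs, if_neg ht.not_ge] using hneg s t (not_le.1 hs) ht
  · rw [h0 (s, t) hst]
    exact mul_nonneg hC (mul_nonneg (annulusBound_nonneg p b s) (annulusBound_nonneg p c t))

/-- The weight of the pair `(s, t)` in the double sums: the common sign of `s` and `t`, or `0` if
their signs differ. -/
def pairSign (i : ℤ × ℤ) : ℂ := if sg i.1 = sg i.2 then (sg i.1 : ℂ) else 0

lemma norm_pairSign_le (i : ℤ × ℤ) : ‖pairSign i‖ ≤ 1 := by
  unfold pairSign sg
  split_ifs <;> simp

lemma pairSign_sub_pairSign (s t : ℤ) :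
    pairSign (s, t) - pairSign (s - 1, t - 1) =
      (if s = 0 then 1 else 0) + (if t = 0 then 1 else 0) := by
  simp only [pairSign, sg_eq_sg_iff]
  unfold sg
  split_ifs <;> first | omega | norm_num

/-- The coefficient `sg(s) p^{st} b^s c^t` of the pair `(s, t)`, which is `0` if `s` and `t` have
different signs. -/
def pairCoeff (b c p : ℂ) (i : ℤ × ℤ) : ℂ :=
  pairSign i * (p ^ (i.1 * i.2) * b ^ i.1 * c ^ i.2)

lemma pairCoeff_of_sg_ne {i : ℤ × ℤ} (h : sg i.1 ≠ sg i.2) : pairCoeff b c p i = 0 := by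
  rw [pairCoeff, pairSign, if_neg h, zero_mul]

lemma pairCoeff_of_sg_eq (h : sg s = sg t) :
    pairCoeff b c p (s, t) = sg t * (p ^ (s * t) * b ^ s * c ^ t) := by
  rw [pairCoeff, pairSign, if_pos h, ← h]

lemma norm_pairCoeff_le (b c p : ℂ) (i : ℤ × ℤ) :
    ‖pairCoeff b c p i‖ ≤ ‖p‖ ^ (i.1 * i.2) * ‖b‖ ^ i.1 * ‖c‖ ^ i.2 := by
  rw [pairCoeff, norm_mul, norm_mul, norm_mul, norm_zpow, norm_zpow, norm_zpow]
  exact mul_le_of_le_one_left (by positivity) (norm_pairSign_le i)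

lemma norm_pairCoeff_le_of_nonneg (hp : IsNome p) (b c : ℂ) (hs : 0 ≤ s) (ht : 0 ≤ t) :
    ‖pairCoeff b c p (s, t)‖ ≤ ‖b‖ ^ s * ‖c‖ ^ t := by
  refine (norm_pairCoeff_le b c p (s, t)).trans ?_
  rw [mul_assoc]
  refine mul_le_of_le_one_left (by positivity) ?_
  simpa using zpow_le_zpow_right_of_le_one₀ hp.norm_pos hp.norm_lt_one.le (mul_nonneg hs ht)

-- `(s + 1) (t + 1) ≥ 0` gives `s t ≥ -1 - s - t`.
lemma norm_pairCoeff_le_of_neg (hp : IsNome p) (b c : ℂ) (hs : s < 0) (ht : t < 0) :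
    ‖pairCoeff b c p (s, t)‖ ≤ ‖p‖⁻¹ * (‖b / p‖ ^ s * ‖c / p‖ ^ t) := by
  have hp0 := hp.norm_pos
  have hle : ‖p‖ ^ (s * t) ≤ ‖p‖ ^ (-1 - s - t) :=
    zpow_le_zpow_right_of_le_one₀ hp0 hp.norm_lt_one.le (by nlinarith)
  calc ‖pairCoeff b c p (s, t)‖
      ≤ ‖p‖ ^ (s * t) * ‖b‖ ^ s * ‖c‖ ^ t := norm_pairCoeff_le b c p (s, t)
    _ ≤ ‖p‖ ^ (-1 - s - t) * ‖b‖ ^ s * ‖c‖ ^ t := by gcongr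
    _ = ‖p‖⁻¹ * (‖b / p‖ ^ s * ‖c / p‖ ^ t) := by
      rw [norm_div, norm_div, div_zpow, div_zpow, zpow_sub₀ hp0.ne', zpow_sub₀ hp0.ne',
        zpow_neg_one]
      ring

lemma summable_norm_pairCoeff (hp : IsNome p) (hb : InAnnulus p b) (hc : InAnnulus p c) :
    Summable fun i => ‖pairCoeff b c p i‖ := by
  have hinv : 1 ≤ ‖p‖⁻¹ := (one_le_inv₀ hp.norm_pos).2 hp.norm_lt_one.le
  refine summable_of_le_annulusBound hb hc (fun i => norm_nonneg _)
    (fun i hi => by rw [pairCoeff_of_sg_ne hi, norm_zero]) (fun s t hs ht => ?_)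
    (fun s t hs ht => norm_pairCoeff_le_of_neg hp b c hs ht)
  exact (norm_pairCoeff_le_of_nonneg hp b c hs ht).trans
    (le_mul_of_one_le_left (by positivity) hinv)

lemma summable_norm_pairCoeff_div (hp : IsNome p) (hb : InAnnulus (p ^ 2) b)
    (hc : InAnnulus (p ^ 2) c) :
    Summable fun i : ℤ × ℤ => ‖pairCoeff b c p i‖ / (1 + ‖p ^ (i.1 + i.2)‖) := by
  have hp0 := hp.norm_pos
  have hinv : 1 ≤ ‖p‖⁻¹ := (one_le_inv₀ hp0).2 hp.norm_lt_one.le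
  refine summable_of_le_annulusBound (C := ‖p‖⁻¹) hb hc (fun i => by positivity)
    (fun i hi => by rw [pairCoeff_of_sg_ne hi, norm_zero, zero_div]) (fun s t hs ht => ?_)
    (fun s t hs ht => ?_)
  · calc ‖pairCoeff b c p (s, t)‖ / (1 + ‖p ^ (s + t)‖)
        ≤ ‖pairCoeff b c p (s, t)‖ := div_le_self (norm_nonneg _) (by
          rw [le_add_iff_nonneg_right]
          positivity)
      _ ≤ ‖b‖ ^ s * ‖c‖ ^ t := norm_pairCoeff_le_of_nonneg hp b c hs ht
      _ ≤ ‖p‖⁻¹ * (‖b‖ ^ s * ‖c‖ ^ t) := le_mul_of_one_le_left (by positivity) hinv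
  · calc ‖pairCoeff b c p (s, t)‖ / (1 + ‖p ^ (s + t)‖)
        ≤ ‖p‖⁻¹ * (‖b / p‖ ^ s * ‖c / p‖ ^ t) / ‖p‖ ^ (s + t) := by
          rw [norm_zpow]
          gcongr
          · exact norm_pairCoeff_le_of_neg hp b c hs ht
          · linarith
      _ = ‖p‖⁻¹ * (‖b / p ^ 2‖ ^ s * ‖c / p ^ 2‖ ^ t) := by
          rw [zpow_add₀ hp0.ne', sq, ← div_div b, ← div_div c, norm_div (b / p), norm_div (c / p),
            div_zpow, div_zpow]
          ring

end SameSign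

section PairSum

variable {a b c p : ℂ}

/-- The double sum of `sg(s) p^{st} b^s c^t / (1 - a p^{s+t})` over the pairs `(s, t)` of integers
of the same sign, of which both series in `F` are specializations. -/
def pairSum (a b c p : ℂ) : ℂ := poleSum p (fun i : ℤ × ℤ => i.1 + i.2) (pairCoeff b c p) a

lemma summable_pairSum (hp : IsNome p) (hb : InAnnulus (p ^ 2) b) (hc : InAnnulus (p ^ 2) c)
    (ha : a ≠ 0) :
    Summable fun i : ℤ × ℤ => pairCoeff b c p i / (1 - a * p ^ (i.1 + i.2)) :=
  summable_poleSum hp (summable_norm_pairCoeff_div hp hb hc) ha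

lemma norm_mul_zpow_lt_one (hp : IsNome p) (hb : ‖b‖ < 1) {n : ℤ} (hn : 0 ≤ n) :
    ‖b * p ^ n‖ < 1 := by
  rw [norm_mul, norm_zpow]
  exact mul_lt_one_of_nonneg_of_lt_one_left (norm_nonneg b) hb
    (by simpa using zpow_le_zpow_right_of_le_one₀ hp.norm_pos hp.norm_lt_one.le hn)

lemma one_lt_norm_mul_zpow (hp : IsNome p) {k : ℕ} (hb : ‖p ^ k‖ < ‖b‖) {n : ℤ} (hn : n ≤ -k) :
    1 < ‖b * p ^ n‖ := by
  have hp0 := hp.norm_pos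
  have hle : ‖p‖ ^ (-k : ℤ) ≤ ‖p‖ ^ n := zpow_le_zpow_right_of_le_one₀ hp0 hp.norm_lt_one.le hn
  rw [norm_pow] at hb
  rw [norm_mul, norm_zpow]
  calc 1 < ‖b‖ * ‖p‖ ^ (-k : ℤ) := by
        rw [zpow_neg, zpow_natCast, ← div_eq_mul_inv]
        exact (one_lt_div (pow_pos hp0 k)).2 hb
    _ ≤ ‖b‖ * ‖p‖ ^ n := by gcongr

lemma tsum_pairCoeff (hp : IsNome p) (hb : InAnnulus p b) (hc : InAnnulus p c) :
    ∑' i, pairCoeff b c p i = poleSum p id (fun t => c ^ t) b := by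
  have hs : Summable fun i : ℤ × ℤ => pairCoeff b c p ((Equiv.prodComm ℤ ℤ) i) :=
    (Equiv.prodComm ℤ ℤ).summable_iff.2 (summable_norm_pairCoeff hp hb hc).of_norm
  rw [← (Equiv.prodComm ℤ ℤ).tsum_eq, hs.tsum_prod]
  refine tsum_congr fun t => ?_
  have hgeom := (hasSum_zpow_sg_eq (u := b * p ^ t) (norm_mul_zpow_lt_one hp hb.norm_lt_one)
    fun ht => one_lt_norm_mul_zpow hp (k := 1) (by simpa using hb.lt_norm)
      (by omega)).mul_left ((sg t : ℂ) * c ^ t)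
  refine (tsum_congr fun s => ?_).trans (hgeom.tsum_eq.trans ?_)
  · rw [Equiv.prodComm_apply, Prod.swap_prod_mk]
    split_ifs with hst
    · rw [pairCoeff_of_sg_eq hst, mul_zpow, ← zpow_mul, mul_comm t s]
      ring
    · rw [pairCoeff_of_sg_ne hst, mul_zero]
  · rw [id]
    linear_combination (c ^ t / (1 - b * p ^ t)) * sg_mul_sg_self t

lemma pairSum_sub_mul_pairSum (hp : IsNome p) (hb : InAnnulus p b) (hc : InAnnulus p c)
    (ha : a ≠ 0) (hja : j a p ≠ 0) :
    pairSum a b c p - a * pairSum a (p * b) (p * c) p = poleSum p id (fun t => c ^ t) b := by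
  rw [← tsum_pairCoeff hp hb hc, pairSum, pairSum, poleSum, poleSum, ← tsum_mul_left,
    ← (summable_pairSum hp hb.sq_base hc.sq_base ha).tsum_sub
      ((summable_pairSum hp (hb.self_mul hp) (hc.self_mul hp) ha).mul_left a)]
  refine tsum_congr fun i => ?_
  rw [mul_div_assoc', ← sub_div, div_eq_iff (one_sub_mul_zpow_ne_zero hp hja _), pairCoeff,
    pairCoeff, mul_zpow, mul_zpow, zpow_add₀ hp.ne_zero i.1 i.2]
  ring

/-- The general term of `pairSum` without the sign. -/
def pairTerm (a b c p : ℂ) (i : ℤ × ℤ) : ℂ :=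
  p ^ (i.1 * i.2) * b ^ i.1 * c ^ i.2 / (1 - a * p ^ (i.1 + i.2))

lemma pairTerm_swap (a b c p : ℂ) (i : ℤ × ℤ) :
    pairTerm a b c p i.swap = pairTerm a c b p i := by
  rw [pairTerm, pairTerm, Prod.fst_swap, Prod.snd_swap, mul_comm i.2, add_comm i.2,
    mul_right_comm]

lemma pairTerm_add_one (hp : p ≠ 0) (hb : b ≠ 0) (hc : c ≠ 0) (i : ℤ × ℤ) :
    pairTerm a b c p (i + (1, 1)) = p * b * c * pairTerm (p ^ 2 * a) (p * b) (p * c) p i := by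
  obtain ⟨s, t⟩ := i
  have hden : a * p ^ (s + 1 + (t + 1)) = p ^ 2 * a * p ^ (s + t) := by
    rw [show s + 1 + (t + 1) = s + t + (2 : ℕ) by push_cast; ring, zpow_add₀ hp (s + t),
      zpow_natCast]
    ring
  simp only [pairTerm, Prod.mk_add_mk]
  rw [hden, show (s + 1) * (t + 1) = s * t + s + t + 1 by ring, zpow_add_one₀ hp,
    zpow_add₀ hp _ t, zpow_add₀ hp _ s, mul_zpow, mul_zpow, zpow_add_one₀ hb, zpow_add_one₀ hc]
  ring

lemma hasSum_pairSum (hp : IsNome p) (hb : InAnnulus (p ^ 2) b) (hc : InAnnulus (p ^ 2) c)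
    (ha : a ≠ 0) : HasSum (fun i => pairSign i * pairTerm a b c p i) (pairSum a b c p) :=
  (summable_pairSum hp hb hc ha).hasSum.congr_fun fun _ => (mul_div_assoc _ _ _).symm

lemma hasSum_mul_pairSum_shift (hp : IsNome p) (hb : InAnnulus p b) (hc : InAnnulus p c)
    (ha : a ≠ 0) :
    HasSum (fun i => pairSign (i - (1, 1)) * pairTerm a b c p i)
      (p * b * c * pairSum (p ^ 2 * a) (p * b) (p * c) p) := by
  rw [← (Equiv.addRight ((1, 1) : ℤ × ℤ)).hasSum_iff]
  refine ((hasSum_pairSum hp (hb.self_mul hp) (hc.self_mul hp)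
    (mul_ne_zero hp.sq.ne_zero ha)).mul_left (p * b * c)).congr_fun fun i => ?_
  rw [Function.comp_apply, Equiv.coe_addRight, add_sub_cancel_right,
    pairTerm_add_one hp.ne_zero hb.ne_zero hc.ne_zero]
  ring

lemma hasSum_pairTerm_fst_eq_zero (hp : IsNome p) (hc : InAnnulus p c) (ha : a ≠ 0) (b : ℂ) :
    HasSum (fun i : ℤ × ℤ => (if i.1 = 0 then 1 else 0) * pairTerm a b c p i)
      (poleSum p id (fun t => c ^ t) a) := by
  have hsum := (summable_poleSum (n := id) hp (summable_norm_zpow_div hp.ne_zero hc) ha).hasSum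
  refine ((Prod.mk_right_injective (0 : ℤ)).hasSum_iff ?_).1 (hsum.congr_fun fun t => ?_)
  · rintro ⟨s, t⟩ h
    rw [if_neg fun h0 => h ⟨t, by rw [← h0]⟩, zero_mul]
  · simp [pairTerm]

lemma hasSum_pairTerm_snd_eq_zero (hp : IsNome p) (hb : InAnnulus p b) (ha : a ≠ 0) (c : ℂ) :
    HasSum (fun i : ℤ × ℤ => (if i.2 = 0 then 1 else 0) * pairTerm a b c p i)
      (poleSum p id (fun s => b ^ s) a) := by
  rw [← (Equiv.prodComm ℤ ℤ).hasSum_iff]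
  refine (hasSum_pairTerm_fst_eq_zero hp hb ha c).congr_fun fun i => ?_
  rw [Function.comp_apply, Equiv.prodComm_apply, Prod.snd_swap, pairTerm_swap]

lemma mul_pairSum_sq_mul (hp : IsNome p) (hb : InAnnulus p b) (hc : InAnnulus p c) (ha : a ≠ 0) :
    p * b * c * pairSum (p ^ 2 * a) (p * b) (p * c) p =
      pairSum a b c p - poleSum p id (fun t => c ^ t) a - poleSum p id (fun s => b ^ s) a := by
  have hzero := (hasSum_pairTerm_fst_eq_zero hp hc ha b).add
    (hasSum_pairTerm_snd_eq_zero hp hb ha c)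
  rw [sub_sub]
  refine (hasSum_mul_pairSum_shift hp hb hc ha).unique
    (((hasSum_pairSum hp hb.sq_base hc.sq_base ha).sub hzero).congr_fun fun i => ?_)
  linear_combination -pairTerm a b c p i * pairSign_sub_pairSign i.1 i.2

end PairSum

section DoubleSum

variable {q x y z : ℂ}

lemma InAnnulus.sq_pow_four (hy : InAnnulus q y) : InAnnulus (q ^ 4) (y ^ 2) := by
  have h := (hy.pow two_ne_zero).sq_base
  rwa [← pow_mul] at h

lemma zpow_four_mul (w : ℂ) (n : ℤ) : w ^ (4 * n) = (w ^ 4) ^ n := by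
  rw [zpow_mul]
  norm_cast

lemma indicator_evenTerm (i : ℤ × ℤ) :
    sameSignPairs.indicator (evenTerm x y z q) i =
      pairCoeff (y ^ 2) (z ^ 2) (q ^ 4) i / (1 - x ^ 2 * (q ^ 4) ^ (i.1 + i.2)) := by
  obtain ⟨s, t⟩ := i
  by_cases h : sg s = sg t
  · rw [Set.indicator_of_mem (show (s, t) ∈ sameSignPairs from h), pairCoeff_of_sg_eq h]
    simp only [evenTerm]
    rw [h, mul_assoc 4 s t, ← mul_add 4 s t, zpow_four_mul, zpow_four_mul, zpow_mul y, zpow_mul z]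
    norm_cast
    ring
  · rw [Set.indicator_of_notMem (show (s, t) ∉ sameSignPairs from h), pairCoeff_of_sg_ne h,
      zero_div]

lemma oddTerm_eq_mul_evenTerm (hq : q ≠ 0) (hy : y ≠ 0) (hz : z ≠ 0) :
    oddTerm x y z q = fun i =>
      q ^ 3 * y * z * evenTerm (q ^ 2 * x) (q ^ 2 * y) (q ^ 2 * z) q i := by
  funext ⟨s, t⟩
  have hnum : q ^ (4 * s * t + 4 * s + 4 * t + 3) =
      q ^ (4 * s * t) * (q ^ 2) ^ (2 * s) * (q ^ 2) ^ (2 * t) * q ^ 3 := by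
    rw [zpow_add₀ hq, zpow_add₀ hq, zpow_add₀ hq, ← zpow_natCast q 2, ← zpow_mul, ← zpow_mul,
      Nat.cast_ofNat, ← mul_assoc, ← mul_assoc]
    norm_cast
  have hden : x ^ 2 * q ^ (4 * s + 4 * t + 4) = (q ^ 2 * x) ^ 2 * q ^ (4 * s + 4 * t) := by
    rw [zpow_add₀ hq _ 4]
    norm_cast
    ring
  simp only [oddTerm, evenTerm]
  rw [hnum, hden, zpow_add_one₀ hy, zpow_add_one₀ hz, mul_zpow, mul_zpow]
  ring

lemma indicator_oddTerm (hq : q ≠ 0) (hy : y ≠ 0) (hz : z ≠ 0) (i : ℤ × ℤ) :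
    sameSignPairs.indicator (oddTerm x y z q) i =
      q ^ 3 * y * z * (pairCoeff (q ^ 4 * y ^ 2) (q ^ 4 * z ^ 2) (q ^ 4) i /
        (1 - q ^ 4 * x ^ 2 * (q ^ 4) ^ (i.1 + i.2))) := by
  rw [oddTerm_eq_mul_evenTerm hq hy hz, Set.indicator_const_mul, indicator_evenTerm]
  simp only [mul_pow, ← pow_mul]

lemma summable_evenTerm (hq : IsNome q) (hx : x ≠ 0) (hy : InAnnulus q y) (hz : InAnnulus q z) :
    Summable fun i : sameSignPairs => evenTerm x y z q i := by
  refine (summable_subtype_iff_indicator (f := evenTerm x y z q)).2 ?_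
  simp only [funext indicator_evenTerm]
  exact summable_pairSum hq.pow_four hy.sq_pow_four.sq_base hz.sq_pow_four.sq_base
    (pow_ne_zero 2 hx)

lemma summable_oddTerm (hq : IsNome q) (hx : x ≠ 0) (hy : InAnnulus q y) (hz : InAnnulus q z) :
    Summable fun i : sameSignPairs => oddTerm x y z q i := by
  refine (summable_subtype_iff_indicator (f := oddTerm x y z q)).2 ?_
  simp only [funext (indicator_oddTerm hq.ne_zero hy.ne_zero hz.ne_zero)]
  exact (summable_pairSum hq.pow_four (hy.sq_pow_four.self_mul hq.pow_four)
    (hz.sq_pow_four.self_mul hq.pow_four)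
    (mul_ne_zero hq.pow_four.ne_zero (pow_ne_zero 2 hx))).mul_left _

lemma F_eq_pairSum (hq : q ≠ 0) (hy : y ≠ 0) (hz : z ≠ 0) (x : ℂ) :
    F x y z q = pairSum (x ^ 2) (y ^ 2) (z ^ 2) (q ^ 4) +
      q ^ 3 * x * y * z * pairSum (q ^ 4 * x ^ 2) (q ^ 4 * y ^ 2) (q ^ 4 * z ^ 2) (q ^ 4) := by
  rw [F, tsum_subtype sameSignPairs (evenTerm x y z q),
    tsum_subtype sameSignPairs (oddTerm x y z q)]
  simp only [funext (indicator_oddTerm hq hy hz), funext indicator_evenTerm]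
  rw [tsum_mul_left, pairSum, pairSum, poleSum, poleSum]
  ring

end DoubleSum

section SameParity

variable {a b c p : ℂ} {r s t : ℤ}

/-- Triples of integers of the same sign, over which the geometric series expansion of `pairSum`
runs. -/
def sameSignTriples : Set (ℤ × ℤ × ℤ) := {i | sg i.1 = sg i.2.1 ∧ sg i.2.1 = sg i.2.2}

lemma norm_tripleTerm (a b c p : ℂ) (r s t : ℤ) : ‖tripleTerm a b c p (r, s, t)‖ =
    ‖p‖ ^ (r * s + r * t + s * t) * (‖a‖ ^ r * (‖b‖ ^ s * ‖c‖ ^ t)) := by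
  simp only [tripleTerm, norm_mul, norm_zpow, mul_assoc]

lemma norm_tripleTerm_le_of_nonneg (hp : IsNome p) (a b c : ℂ) (hr : 0 ≤ r) (hs : 0 ≤ s)
    (ht : 0 ≤ t) : ‖tripleTerm a b c p (r, s, t)‖ ≤ ‖a‖ ^ r * (‖b‖ ^ s * ‖c‖ ^ t) := by
  rw [norm_tripleTerm]
  refine mul_le_of_le_one_left (by positivity) ?_
  simpa using zpow_le_zpow_right_of_le_one₀ hp.norm_pos hp.norm_lt_one.le
    (show 0 ≤ r * s + r * t + s * t by positivity)

lemma norm_tripleTerm_le_of_neg (hp : IsNome p) (a b c : ℂ) (hr : r < 0) (hs : s < 0)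
    (ht : t < 0) : ‖tripleTerm a b c p (r, s, t)‖ ≤
      (‖p‖ ^ 3)⁻¹ * (‖a / p ^ 2‖ ^ r * (‖b / p ^ 2‖ ^ s * ‖c / p ^ 2‖ ^ t)) := by
  have hp0 := hp.norm_pos
  calc ‖tripleTerm a b c p (r, s, t)‖
      = ‖p‖ ^ (r * s + r * t + s * t) * (‖a‖ ^ r * (‖b‖ ^ s * ‖c‖ ^ t)) :=
        norm_tripleTerm a b c p r s t
    _ ≤ ‖p‖ ^ (-3 - 2 * r - 2 * s - 2 * t) * (‖a‖ ^ r * (‖b‖ ^ s * ‖c‖ ^ t)) := by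
        refine mul_le_mul_of_nonneg_right ?_ (by positivity)
        exact zpow_le_zpow_right_of_le_one₀ hp0 hp.norm_lt_one.le (by nlinarith)
    _ = (‖p‖ ^ 3)⁻¹ * (‖a / p ^ 2‖ ^ r * (‖b / p ^ 2‖ ^ s * ‖c / p ^ 2‖ ^ t)) := by
        simp only [norm_div, norm_pow, div_zpow]
        rw [zpow_sub₀ hp0.ne', zpow_sub₀ hp0.ne', zpow_sub₀ hp0.ne', zpow_neg, zpow_mul, zpow_mul,
          zpow_mul]
        norm_cast
        ring

lemma summable_indicator_tripleTerm (hp : IsNome p) (ha : InAnnulus (p ^ 2) a)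
    (hb : InAnnulus (p ^ 2) b) (hc : InAnnulus (p ^ 2) c) :
    Summable (sameSignTriples.indicator (tripleTerm a b c p)) := by
  have hnn := annulusBound_nonneg (p ^ 2)
  have hbc := (summable_annulusBound hb).mul_of_nonneg (summable_annulusBound hc) (hnn b) (hnn c)
  have habc := (summable_annulusBound ha).mul_of_nonneg hbc (hnn a)
    fun i => mul_nonneg (hnn b i.1) (hnn c i.2)
  have hinv : 1 ≤ (‖p‖ ^ 3)⁻¹ :=
    (one_le_inv₀ (pow_pos hp.norm_pos 3)).2 (pow_le_one₀ (norm_nonneg p) hp.norm_lt_one.le)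
  refine (habc.mul_left (‖p‖ ^ 3)⁻¹).of_norm_bounded fun ⟨r, s, t⟩ => ?_
  by_cases h : (r, s, t) ∈ sameSignTriples
  · rw [Set.indicator_of_mem h]
    obtain ⟨hrs, hst⟩ : (0 ≤ r ↔ 0 ≤ s) ∧ (0 ≤ s ↔ 0 ≤ t) :=
      ⟨sg_eq_sg_iff.1 h.1, sg_eq_sg_iff.1 h.2⟩
    unfold annulusBound
    rcases le_or_gt 0 r with hr | hr
    · have hs := hrs.1 hr
      have ht := hst.1 hs
      simp only [if_pos hr, if_pos hs, if_pos ht]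
      exact (norm_tripleTerm_le_of_nonneg hp a b c hr hs ht).trans
        (le_mul_of_one_le_left (by positivity) hinv)
    · have hs : ¬0 ≤ s := fun hs => hr.not_ge (hrs.2 hs)
      have ht : ¬0 ≤ t := fun ht => hs (hst.2 ht)
      simp only [if_neg hr.not_ge, if_neg hs, if_neg ht]
      exact norm_tripleTerm_le_of_neg hp a b c hr (not_le.1 hs) (not_le.1 ht)
  · rw [Set.indicator_of_notMem h, norm_zero]
    exact mul_nonneg (by positivity)
      (mul_nonneg (hnn a r) (mul_nonneg (hnn b s) (hnn c t)))

lemma hasSum_indicator_tripleTerm_left (hp : IsNome p) (ha : InAnnulus (p ^ 2) a) (b c : ℂ)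
    (i : ℤ × ℤ) :
    HasSum (fun r => sameSignTriples.indicator (tripleTerm a b c p) (r, i))
      (pairCoeff b c p i / (1 - a * p ^ (i.1 + i.2))) := by
  obtain ⟨s, t⟩ := i
  by_cases hst : sg s = sg t
  · have hiff := sg_eq_sg_iff.1 hst
    have hgeom := (hasSum_zpow_sg_eq (u := a * p ^ (s + t)) (t := t)
      (fun ht => norm_mul_zpow_lt_one hp ha.norm_lt_one (by omega))
      fun ht => one_lt_norm_mul_zpow hp ha.lt_norm (by omega)).mul_left
      (p ^ (s * t) * b ^ s * c ^ t)
    have hval : p ^ (s * t) * b ^ s * c ^ t * ((sg t : ℂ) / (1 - a * p ^ (s + t))) =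
        pairCoeff b c p (s, t) / (1 - a * p ^ (s + t)) := by
      rw [pairCoeff_of_sg_eq hst]
      ring
    rw [hval] at hgeom
    refine hgeom.congr_fun fun r => ?_
    simp only [Set.indicator_apply, sameSignTriples, Set.mem_ofPred_eq, hst, and_true, mul_ite,
      mul_zero]
    refine if_congr Iff.rfl ?_ rfl
    simp only [tripleTerm]
    rw [mul_zpow, ← zpow_mul, zpow_add₀ hp.ne_zero,
      show (s + t) * r = r * s + r * t by ring]
    ring
  · rw [pairCoeff_of_sg_ne hst, zero_div]
    exact hasSum_zero.congr_fun fun r => Set.indicator_of_notMem (fun h => hst h.2) _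

lemma hasSum_sameSignTriples (hp : IsNome p) (ha : InAnnulus (p ^ 2) a)
    (hb : InAnnulus (p ^ 2) b) (hc : InAnnulus (p ^ 2) c) :
    HasSum (fun i : sameSignTriples => tripleTerm a b c p i) (pairSum a b c p) := by
  obtain ⟨v, hv⟩ := summable_indicator_tripleTerm hp ha hb hc
  have hfiber := ((Equiv.prodComm (ℤ × ℤ) ℤ).hasSum_iff.2 hv).prod_fiberwise
    (hasSum_indicator_tripleTerm_left hp ha b c)
  have hval : pairSum a b c p = v := hfiber.tsum_eq
  rw [hval]
  exact hasSum_subtype_iff_indicator.2 hv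

/-- The triple `(2r + e, 2s + e, 2t + e)`; for `e = 0, 1` these are the triples of common
parity. -/
def dilate (e : ℤ) (i : ℤ × ℤ × ℤ) : ℤ × ℤ × ℤ := (2 * i.1 + e, 2 * i.2.1 + e, 2 * i.2.2 + e)

lemma dilate_injective (e : ℤ) : Function.Injective (dilate e) := fun i k h => by
  simpa [dilate, Prod.ext_iff] using h

lemma sameParityTriples_eq :
    sameParityTriples = dilate 0 '' sameSignTriples ∪ dilate 1 '' sameSignTriples := by
  ext ⟨r, s, t⟩
  simp only [sameParityTriples, sameSignTriples, dilate, sg_eq_sg_iff, Int.ModEq, Set.mem_union,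
    Set.mem_image, Set.mem_ofPred_eq, Prod.exists, Prod.mk.injEq]
  constructor
  · rintro ⟨hsg, hrs, hst⟩
    rcases Int.emod_two_eq_zero_or_one r with hr | hr
    · exact Or.inl ⟨r / 2, s / 2, t / 2, by omega, by omega⟩
    · exact Or.inr ⟨r / 2, s / 2, t / 2, by omega, by omega⟩
  · rintro (⟨r', s', t', hsg, hr, hs, ht⟩ | ⟨r', s', t', hsg, hr, hs, ht⟩) <;> omega

lemma disjoint_dilate : Disjoint (dilate 0 '' sameSignTriples) (dilate 1 '' sameSignTriples) := by
  refine Set.disjoint_left.2 ?_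
  rintro - ⟨i, -, rfl⟩ ⟨k, -, h⟩
  have h1 := congrArg Prod.fst h
  simp only [dilate] at h1
  omega

variable {q x y z : ℂ}

lemma tripleTerm_dilate_zero (x y z q : ℂ) (i : ℤ × ℤ × ℤ) :
    tripleTerm x y z q (dilate 0 i) = tripleTerm (x ^ 2) (y ^ 2) (z ^ 2) (q ^ 4) i := by
  simp only [tripleTerm, dilate, add_zero]
  rw [← zpow_four_mul, zpow_mul x, zpow_mul y, zpow_mul z]
  norm_cast
  ring_nf

lemma tripleTerm_dilate_one (hq : q ≠ 0) (hx : x ≠ 0) (hy : y ≠ 0) (hz : z ≠ 0)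
    (i : ℤ × ℤ × ℤ) :
    tripleTerm x y z q (dilate 1 i) = q ^ 3 * x * y * z *
      tripleTerm (q ^ 4 * x ^ 2) (q ^ 4 * y ^ 2) (q ^ 4 * z ^ 2) (q ^ 4) i := by
  obtain ⟨r, s, t⟩ := i
  have hexp : (2 * r + 1) * (2 * s + 1) + (2 * r + 1) * (2 * t + 1) + (2 * s + 1) * (2 * t + 1) =
      4 * (r * s + r * t + s * t) + 4 * r + 4 * s + 4 * t + (3 : ℕ) := by
    push_cast
    ring
  simp only [tripleTerm, dilate]
  rw [hexp, zpow_add₀ hq, zpow_add₀ hq, zpow_add₀ hq, zpow_add₀ hq, zpow_natCast, zpow_four_mul,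
    zpow_four_mul, zpow_four_mul, zpow_four_mul, zpow_add_one₀ hx, zpow_add_one₀ hy,
    zpow_add_one₀ hz, zpow_mul x, zpow_mul y, zpow_mul z, mul_zpow, mul_zpow, mul_zpow]
  norm_cast
  ring

theorem hasSum_sameParityTriples (hq : IsNome q) (hx : InAnnulus q x) (hy : InAnnulus q y)
    (hz : InAnnulus q z) :
    HasSum (fun i : sameParityTriples => tripleTerm x y z q i) (F x y z q) := by
  have hp := hq.pow_four
  have heven : HasSum (tripleTerm x y z q ∘ ((↑) : dilate 0 '' sameSignTriples → ℤ × ℤ × ℤ))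
      (pairSum (x ^ 2) (y ^ 2) (z ^ 2) (q ^ 4)) :=
    (Equiv.Set.image _ _ (dilate_injective 0)).hasSum_iff.1 <|
      (hasSum_sameSignTriples hp hx.sq_pow_four.sq_base hy.sq_pow_four.sq_base
        hz.sq_pow_four.sq_base).congr_fun fun i => tripleTerm_dilate_zero x y z q i
  have hodd : HasSum (tripleTerm x y z q ∘ ((↑) : dilate 1 '' sameSignTriples → ℤ × ℤ × ℤ))
      (q ^ 3 * x * y * z * pairSum (q ^ 4 * x ^ 2) (q ^ 4 * y ^ 2) (q ^ 4 * z ^ 2) (q ^ 4)) :=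
    (Equiv.Set.image _ _ (dilate_injective 1)).hasSum_iff.1 <|
      ((hasSum_sameSignTriples hp (hx.sq_pow_four.self_mul hp) (hy.sq_pow_four.self_mul hp)
        (hz.sq_pow_four.self_mul hp)).mul_left _).congr_fun fun i =>
          tripleTerm_dilate_one hq.ne_zero hx.ne_zero hy.ne_zero hz.ne_zero i
  rw [sameParityTriples_eq, F_eq_pairSum hq.ne_zero hy.ne_zero hz.ne_zero]
  exact heven.add_disjoint disjoint_dilate hodd

end SameParity

section RegularForm

variable {q u v w x y z : ℂ}

lemma j_sq_pow_four (hq : ‖q‖ < 1) (x : ℂ) :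
    j (x ^ 2) (q ^ 4) =
      qPoch (q ^ 4) (q ^ 4) / qPoch (q ^ 2) (q ^ 2) ^ 2 * (j x (q ^ 2) * j (-x) (q ^ 2)) := by
  have h := j_sq (norm_sq_lt_one hq) x
  have hP := qPoch_self_ne_zero (norm_sq_lt_one hq)
  rw [← pow_mul] at h
  rw [div_mul_eq_mul_div]
  exact eq_div_of_mul_eq (pow_ne_zero 2 hP) h

/-- The factor of a summand `(theta quotient) · m(-qv/(uw), q², -uw)` of `G` that is left when the
zeros of `j(u²w²;q⁴)` cancel the poles of `1 / j(-uw;q²)`. -/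
def crossCoeff (u w q : ℂ) : ℂ :=
  qPoch (q ^ 2) (q ^ 2) ^ 2 * qPoch (q ^ 4) (q ^ 4) ^ 2 * j (u * w) (q ^ 2) /
    (j u (q ^ 2) * j (-u) (q ^ 2) * (j w (q ^ 2) * j (-w) (q ^ 2)))

/-- The summand `(theta quotient) · m(-qv/(uw), q², -uw)` of `G` without its removable
singularities. -/
def crossTerm (u v w q : ℂ) : ℂ := crossCoeff u w q * appellSum (v / q) (u * w) (q ^ 2)

/-- The factor of the theta summand of `G` that does not depend on `x`. -/
def thetaCoeff (y z q : ℂ) : ℂ :=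
  qPoch q q ^ 3 * qPoch (q ^ 2) (q ^ 2) ^ 3 * j (y * z) (q ^ 2) /
    (j y q * j z q * (j (-y) (q ^ 2) * j (-z) (q ^ 2)))

/-- The theta summand of `G`. -/
def thetaTerm (x y z q : ℂ) : ℂ :=
  thetaCoeff y z q * (j (x * y) (q ^ 2) * j (x * z) (q ^ 2) / (j x q * j (-x) (q ^ 2)))

/-- The function `G` without its removable singularities in `x`. -/
def regularG (x y z q : ℂ) : ℂ :=
  crossTerm y x z q + crossTerm x y z q + thetaTerm x y z q + crossTerm x z y q

lemma kroneckerQuotient_sq (hq : IsNome q) (u w : ℂ) :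
    kroneckerQuotient (u ^ 2) (w ^ 2) (q ^ 4) = crossCoeff u w q * j (-(u * w)) (q ^ 2) := by
  have hP2 := qPoch_self_ne_zero hq.sq.norm_lt_one
  have hP4 := qPoch_self_ne_zero hq.pow_four.norm_lt_one
  simp only [kroneckerQuotient, crossCoeff, ← mul_pow, j_sq_pow_four hq.norm_lt_one]
  field_simp

lemma mul_appellLerch_eq_crossTerm (hq : IsNome q) (hu : u ≠ 0) (hw : w ≠ 0)
    (h : j (-(u * w)) (q ^ 2) ≠ 0) :
    J q 4 ^ 3 * j (u ^ 2 * w ^ 2) (q ^ 4) / (j (u ^ 2) (q ^ 4) * j (w ^ 2) (q ^ 4)) *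
      appellLerch (-(q * v / (u * w))) (q ^ 2) (-(u * w)) = crossTerm u v w q := by
  have hq0 := hq.ne_zero
  have harg : -(q * v / (u * w)) * -(u * w) / q ^ 2 = v / q := by field_simp
  rw [J, ← kroneckerQuotient, kroneckerQuotient_sq hq, appellLerch_eq hq.sq.ne_zero,
    neg_neg, harg, crossTerm, mul_assoc, mul_div_cancel₀ _ h]

lemma G_eq_regularG (hq : IsNome q) (hx : x ≠ 0) (hy : InAnnulus q y) (hz : InAnnulus q z)
    (hxy : j (-(x * y)) (q ^ 2) ≠ 0) (hxz : j (-(x * z)) (q ^ 2) ≠ 0) :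
    G x y z q = regularG x y z q := by
  rw [G, regularG, mul_appellLerch_eq_crossTerm hq hy.ne_zero hz.ne_zero
    ((hy.mul hz).neg.j_ne_zero hq.sq), mul_appellLerch_eq_crossTerm hq hx hz.ne_zero hxz,
    mul_appellLerch_eq_crossTerm hq hx hy.ne_zero hxy, thetaTerm, thetaCoeff, J, J, pow_one]
  ring

lemma crossCoeff_sq_mul (hq : IsNome q) (hu : u ≠ 0) (hw : w ≠ 0) :
    crossCoeff (q ^ 2 * u) w q = u / w * crossCoeff u w q := by
  rw [crossCoeff, crossCoeff, mul_assoc (q ^ 2), ← mul_neg, j_mul_self hq.sq (mul_ne_zero hu hw),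
    j_mul_self hq.sq hu, j_mul_self hq.sq (neg_ne_zero.2 hu)]
  field_simp

lemma crossTerm_sq_mul_left (hq : IsNome q) (hu : u ≠ 0) (hv : v ≠ 0) (hw : w ≠ 0)
    (hjv : j (v / q) (q ^ 2) ≠ 0) :
    crossTerm (q ^ 2 * u) v w q =
      q * u / (v * w) * (crossTerm u v w q - kroneckerQuotient (u ^ 2) (w ^ 2) (q ^ 4)) := by
  have hq0 := hq.ne_zero
  rw [kroneckerQuotient_sq hq, crossTerm, crossTerm, crossCoeff_sq_mul hq hu hw,
    mul_assoc (q ^ 2),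
    appellSum_mul_right hq.sq (div_ne_zero hv hq0) (mul_ne_zero hu hw) hjv]
  field_simp

lemma crossTerm_sq_mul_mid (hq : IsNome q) (hu : u ≠ 0) (hv : v ≠ 0) (hw : w ≠ 0)
    (hjv : j (v / q) (q ^ 2) ≠ 0) :
    crossTerm u (q ^ 2 * v) w q =
      kroneckerQuotient (u ^ 2) (w ^ 2) (q ^ 4) + q * v / (u * w) * crossTerm u v w q := by
  have hq0 := hq.ne_zero
  rw [kroneckerQuotient_sq hq, crossTerm, crossTerm, mul_div_assoc (q ^ 2),
    appellSum_mul_left hq.sq (div_ne_zero hv hq0) (mul_ne_zero hu hw) hjv]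
  field_simp

lemma thetaTerm_sq_mul (hq : IsNome q) (hx : x ≠ 0) (hy : y ≠ 0) (hz : z ≠ 0) :
    thetaTerm (q ^ 2 * x) y z q = q * x / (y * z) * thetaTerm x y z q := by
  have hq0 := hq.ne_zero
  rw [thetaTerm, thetaTerm, mul_assoc (q ^ 2) x y, mul_assoc (q ^ 2) x z, ← mul_neg (q ^ 2) x,
    j_mul_self hq.sq (mul_ne_zero hx hy), j_mul_self hq.sq (mul_ne_zero hx hz),
    j_mul_self hq.sq (neg_ne_zero.2 hx), sq q, mul_assoc q q x, j_mul_self hq (mul_ne_zero hq0 hx),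
    j_mul_self hq hx]
  field_simp

lemma j_sq_pow_four_ne_zero (hq : IsNome q) (hx : j x (q ^ 2) ≠ 0) (hxn : j (-x) (q ^ 2) ≠ 0) :
    j (x ^ 2) (q ^ 4) ≠ 0 := by
  rw [j_sq_pow_four hq.norm_lt_one]
  exact mul_ne_zero (div_ne_zero (qPoch_self_ne_zero hq.pow_four.norm_lt_one)
    (pow_ne_zero 2 (qPoch_self_ne_zero hq.sq.norm_lt_one))) (mul_ne_zero hx hxn)

lemma j_mul_self_ne_zero (hq : IsNome q) (hx : x ≠ 0) (h : j x q ≠ 0) : j (q * x) q ≠ 0 := by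
  rw [j_mul_self hq hx]
  exact mul_ne_zero (neg_ne_zero.2 (inv_ne_zero hx)) h

lemma F_sq_mul (hq : IsNome q) (hx : x ≠ 0) (hy : InAnnulus q y) (hz : InAnnulus q z)
    (hjx : j (x ^ 2) (q ^ 4) ≠ 0) :
    F (q ^ 2 * x) y z q = q * x / (y * z) * F x y z q + kroneckerQuotient (y ^ 2) (z ^ 2) (q ^ 4) -
      q * x / (y * z) * (kroneckerQuotient (x ^ 2) (z ^ 2) (q ^ 4) +
        kroneckerQuotient (x ^ 2) (y ^ 2) (q ^ 4)) := by
  have hp := hq.pow_four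
  have hx2 := pow_ne_zero 2 hx
  have hy2 := hy.sq_pow_four
  have hz2 := hz.sq_pow_four
  have hq0 := hq.ne_zero
  have hy0 := hy.ne_zero
  have hz0 := hz.ne_zero
  have hjx' := j_mul_self_ne_zero hp hx2 hjx
  have heven : pairSum (q ^ 4 * x ^ 2) (y ^ 2) (z ^ 2) (q ^ 4) =
      kroneckerQuotient (y ^ 2) (z ^ 2) (q ^ 4) + q ^ 4 * x ^ 2 *
        pairSum (q ^ 4 * x ^ 2) (q ^ 4 * y ^ 2) (q ^ 4 * z ^ 2) (q ^ 4) := by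
    rw [← kronecker_identity hp hz2 hy2.ne_zero (hy2.j_ne_zero hp), ← sub_eq_iff_eq_add]
    exact pairSum_sub_mul_pairSum hp hy2 hz2 (mul_ne_zero hp.ne_zero hx2) hjx'
  have hodd := mul_pairSum_sq_mul hp hy2 hz2 hx2
  rw [kronecker_identity hp hz2 hx2 hjx, kronecker_identity hp hy2 hx2 hjx, mul_comm,
    ← eq_div_iff (mul_ne_zero (mul_ne_zero hp.ne_zero hy2.ne_zero) hz2.ne_zero)] at hodd
  have hsq : (q ^ 2 * x) ^ 2 = q ^ 4 * x ^ 2 := by ring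
  have hsq' : q ^ 4 * (q ^ 4 * x ^ 2) = (q ^ 4) ^ 2 * x ^ 2 := by ring
  rw [F_eq_pairSum hq0 hy0 hz0, F_eq_pairSum hq0 hy0 hz0, hsq, heven, hsq', hodd]
  field_simp
  ring

lemma j_sq_base_ne_zero (hq : IsNome q) (h : j x q ≠ 0) : j x (q ^ 2) ≠ 0 := by
  have h' := j_even_mul_odd hq x
  have hP := mul_ne_zero h (pow_ne_zero 2 (qPoch_self_ne_zero hq.sq.norm_lt_one))
  exact left_ne_zero_of_mul (right_ne_zero_of_mul (h' ▸ hP))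

lemma j_div_sq_base_ne_zero (hq : IsNome q) (hx : x ≠ 0) (h : j x q ≠ 0) :
    j (x / q) (q ^ 2) ≠ 0 :=
  j_sq_base_ne_zero hq (j_div_self_ne_zero hq hx h)

lemma sub_regularG_sq_mul (hq : IsNome q) (hx : x ≠ 0) (hy : InAnnulus q y) (hz : InAnnulus q z)
    (hjx : j x q ≠ 0) (hjxn : j (-x) (q ^ 2) ≠ 0) :
    F (q ^ 2 * x) y z q - regularG (q ^ 2 * x) y z q =
      q / (y * z) * x * (F x y z q - regularG x y z q) := by
  have hy0 := hy.ne_zero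
  have hz0 := hz.ne_zero
  have hjyq := j_div_sq_base_ne_zero hq hy0 (hy.j_ne_zero hq)
  have hjzq := j_div_sq_base_ne_zero hq hz0 (hz.j_ne_zero hq)
  rw [F_sq_mul hq hx hy hz (j_sq_pow_four_ne_zero hq (j_sq_base_ne_zero hq hjx) hjxn), regularG,
    regularG, crossTerm_sq_mul_left hq hx hy0 hz0 hjyq, crossTerm_sq_mul_left hq hx hz0 hy0 hjzq,
    crossTerm_sq_mul_mid hq hy0 hx hz0 (j_div_sq_base_ne_zero hq hx hjx),
    thetaTerm_sq_mul hq hx hy0 hz0]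
  ring

end RegularForm

section Differentiability

variable {b c p q u v w x y z : ℂ}

lemma differentiableAt_pairSum (hp : IsNome p) (hb : InAnnulus (p ^ 2) b)
    (hc : InAnnulus (p ^ 2) c) (hu : u ≠ 0) (hju : j u p ≠ 0) :
    DifferentiableAt ℂ (fun u => pairSum u b c p) u :=
  differentiableAt_poleSum hp (summable_norm_pairCoeff_div hp hb hc) hu fun _ _ =>
    one_sub_mul_zpow_ne_zero hp hju _

-- At `u = p` a pole would need `s + t = -1`, which is impossible for `s`, `t` of the same sign.
lemma differentiableAt_pairSum_self (hp : IsNome p) (hb : InAnnulus (p ^ 2) b)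
    (hc : InAnnulus (p ^ 2) c) : DifferentiableAt ℂ (fun u => pairSum u b c p) p := by
  refine differentiableAt_poleSum hp (summable_norm_pairCoeff_div hp hb hc) hp.ne_zero ?_
  rintro ⟨s, t⟩ hst h
  have hsg := sg_eq_sg_iff.1 (not_not.1 (mt pairCoeff_of_sg_ne hst))
  rw [← zpow_one_add₀ hp.ne_zero, sub_eq_zero, eq_comm, hp.zpow_eq_one_iff] at h
  omega

lemma hasResidueAt_pairSum (hp : IsNome p) (hb : InAnnulus (p ^ 2) b)
    (hc : InAnnulus (p ^ 2) c) : HasResidueAt (fun u => pairSum u b c p) 1 (-1) := by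
  have h := hasResidueAt_poleSum (i₀ := ((0 : ℤ), (0 : ℤ))) hp
    (summable_norm_pairCoeff_div hp hb hc) one_ne_zero (by simp) ?_
  · rwa [pairCoeff_of_sg_eq rfl, sg_of_nonneg le_rfl, mul_zero, zpow_zero, zpow_zero, zpow_zero,
      mul_one, mul_one, mul_one, Int.cast_one, mul_one] at h
  · rintro ⟨s, t⟩ hst h
    have hsg := sg_eq_sg_iff.1 (not_not.1 (mt pairCoeff_of_sg_ne hst))
    rw [one_mul, hp.zpow_eq_one_iff] at h
    rw [Prod.mk.injEq]
    omega

lemma differentiableAt_F (hq : IsNome q) (hx : x ≠ 0) (hy : InAnnulus q y) (hz : InAnnulus q z)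
    (hjx : j (x ^ 2) (q ^ 4) ≠ 0) : DifferentiableAt ℂ (fun x => F x y z q) x := by
  have hp := hq.pow_four
  have hx2 := pow_ne_zero 2 hx
  have hy2 := hy.sq_pow_four
  have hz2 := hz.sq_pow_four
  have hjx' := j_mul_self_ne_zero hp hx2 hjx
  have heven := (differentiableAt_pairSum hp hy2.sq_base hz2.sq_base hx2 hjx).comp
    (f := fun w : ℂ => w ^ 2) x (by fun_prop)
  have hodd := (differentiableAt_pairSum hp (hy2.self_mul hp) (hz2.self_mul hp)
    (mul_ne_zero hp.ne_zero hx2) hjx').comp (f := fun w : ℂ => q ^ 4 * w ^ 2) x (by fun_prop)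
  simp only [F_eq_pairSum hq.ne_zero hy.ne_zero hz.ne_zero]
  exact heven.add (DifferentiableAt.mul (by fun_prop) hodd)

lemma differentiableAt_j_neg (hp : ‖p‖ < 1) (hx : x ≠ 0) :
    DifferentiableAt ℂ (fun x => j (-x) p) x :=
  (differentiableAt_j hp (neg_ne_zero.2 hx)).comp (f := fun w : ℂ => -w) x (by fun_prop)

lemma differentiableAt_crossTerm_left (hq : IsNome q) (hu : u ≠ 0) (hv : v ≠ 0)
    (hw : InAnnulus q w) (hju : j u (q ^ 2) ≠ 0) (hjun : j (-u) (q ^ 2) ≠ 0) :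
    DifferentiableAt ℂ (fun u => crossTerm u v w q) u := by
  have hp := hq.sq
  have hw0 := hw.ne_zero
  have happell := (differentiableAt_appellSum_right hp (div_ne_zero hv hq.ne_zero)
    (mul_ne_zero hu hw0)).comp (f := fun u : ℂ => u * w) u (by fun_prop)
  have hden : DifferentiableAt ℂ (fun u => j u (q ^ 2) * j (-u) (q ^ 2) *
      (j w (q ^ 2) * j (-w) (q ^ 2))) u :=
    ((differentiableAt_j hp.norm_lt_one hu).mul
      (differentiableAt_j_neg hp.norm_lt_one hu)).mul_const _
  exact (((differentiableAt_j_mul_const hp hu hw0).const_mul _).fun_div hden (mul_ne_zero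
    (mul_ne_zero hju hjun) (mul_ne_zero (hw.sq_base.j_ne_zero hp)
      (hw.sq_base.neg.j_ne_zero hp)))).mul happell

lemma differentiableAt_crossTerm_mid (hq : IsNome q) (hu : u ≠ 0) (hv : v ≠ 0) (hw : w ≠ 0)
    (hjv : j (v / q) (q ^ 2) ≠ 0) : DifferentiableAt ℂ (fun v => crossTerm u v w q) v :=
  ((differentiableAt_appellSum_left hq.sq (div_ne_zero hv hq.ne_zero) (mul_ne_zero hu hw)
    hjv).comp (f := fun v : ℂ => v / q) v (by fun_prop)).const_mul _

lemma differentiableAt_thetaTerm (hq : IsNome q) (hx : x ≠ 0) (hy : y ≠ 0) (hz : z ≠ 0)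
    (hjx : j x q ≠ 0) (hjxn : j (-x) (q ^ 2) ≠ 0) :
    DifferentiableAt ℂ (fun x => thetaTerm x y z q) x := by
  have hnum := (differentiableAt_j_mul_const hq.sq hx hy).mul
    (differentiableAt_j_mul_const hq.sq hx hz)
  have hden := (differentiableAt_j hq.norm_lt_one hx).mul
    (differentiableAt_j_neg hq.sq.norm_lt_one hx)
  exact (hnum.fun_div hden (mul_ne_zero hjx hjxn)).const_mul _

end Differentiability

section Residues

variable {p q v w x y z ε : ℂ}

lemma j_sign_mul_j_neg (hε : ε ^ 2 = 1) (w p : ℂ) :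
    j (ε * w) p * j (-(ε * w)) p = j w p * j (-w) p := by
  obtain rfl | rfl := sq_eq_one_iff.1 hε
  · rw [one_mul]
  · rw [neg_one_mul, neg_neg, mul_comm]

lemma hasDerivAt_j_mul_j_neg_one (hp : ‖p‖ < 1) (hq : ‖q‖ < 1) :
    HasDerivAt (fun w => j w p * j (-w) q) (-qPoch p p ^ 3 * j (-1) q) 1 := by
  have h := (hasDerivAt_j_one hp).fun_mul (differentiableAt_j_neg hq one_ne_zero).hasDerivAt
  simpa only [j_one hp, zero_mul, add_zero] using h

lemma hasDerivAt_j_mul_j_neg_neg_one (hp : ‖p‖ < 1) (hq : ‖q‖ < 1) :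
    HasDerivAt (fun w => j w p * j (-w) q) (j (-1) p * qPoch q q ^ 3) (-1) := by
  have hneg : HasDerivAt (fun w => j (-w) q) (-qPoch q q ^ 3 * -1) (-1) :=
    (hasDerivAt_j_one hq).comp_of_eq (-1) (hasDerivAt_neg (-1)) (neg_neg 1).symm
  have h := (differentiableAt_j hp (neg_ne_zero.2 one_ne_zero)).hasDerivAt.fun_mul hneg
  simpa only [neg_neg, j_one hq, mul_zero, zero_add, mul_neg_one] using h

lemma hasDerivAt_j_mul_j_neg_sign (hq : IsNome q) (hε : ε ^ 2 = 1) :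
    HasDerivAt (fun w => j w q * j (-w) q)
      (-2 * ε * (qPoch q q ^ 2 * qPoch (q ^ 2) (q ^ 2) ^ 2)) ε := by
  have hq1 := hq.norm_lt_one
  obtain rfl | rfl := sq_eq_one_iff.1 hε
  · refine (hasDerivAt_j_mul_j_neg_one hq1 hq1).congr_deriv ?_
    linear_combination -qPoch q q ^ 2 * j_neg_one hq1
  · refine (hasDerivAt_j_mul_j_neg_neg_one hq1 hq1).congr_deriv ?_
    linear_combination qPoch q q ^ 2 * j_neg_one hq1

lemma j_neg_self_sq_eq (hq : IsNome q) :
    j (-q) (q ^ 2) =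
      qPoch (q ^ 2) (q ^ 2) ^ 5 / (qPoch q q ^ 2 * qPoch (q ^ 4) (q ^ 4) ^ 2) := by
  have hP := qPoch_self_ne_zero hq.norm_lt_one
  have hP4 := qPoch_self_ne_zero hq.pow_four.norm_lt_one
  rw [eq_div_iff (mul_ne_zero (pow_ne_zero 2 hP) (pow_ne_zero 2 hP4)), ← mul_assoc,
    j_neg_self_sq hq]

lemma hasDerivAt_j_mul_j_neg_sq_base_sign (hq : IsNome q) (hε : ε ^ 2 = 1) :
    HasDerivAt (fun w => j w q * j (-w) (q ^ 2))
      (-2 * ε * (qPoch q q * qPoch (q ^ 2) (q ^ 2) ^ 4) / j (-(ε * q)) (q ^ 2)) ε := by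
  have hP := qPoch_self_ne_zero hq.norm_lt_one
  have hP2 := qPoch_self_ne_zero hq.sq.norm_lt_one
  have hP4 := qPoch_self_ne_zero hq.pow_four.norm_lt_one
  obtain rfl | rfl := sq_eq_one_iff.1 hε
  · refine (hasDerivAt_j_mul_j_neg_one hq.norm_lt_one hq.sq.norm_lt_one).congr_deriv ?_
    have h := j_neg_one hq.sq.norm_lt_one
    rw [← pow_mul, ← eq_div_iff hP2] at h
    rw [h, one_mul, j_neg_self_sq_eq hq]
    field_simp
  · refine (hasDerivAt_j_mul_j_neg_neg_one hq.norm_lt_one hq.sq.norm_lt_one).congr_deriv ?_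
    rw [neg_one_mul, neg_neg, eq_div_of_mul_eq hP (j_neg_one hq.norm_lt_one),
      eq_div_of_mul_eq hP2 (j_self_sq hq)]
    field_simp

lemma hasDerivAt_j_mul_j_neg_sq_base_self (hq : IsNome q) :
    HasDerivAt (fun w => j w q * j (-w) (q ^ 2)) (qPoch q q ^ 3 / q * j (-q) (q ^ 2)) q := by
  have h := (hasDerivAt_j_self hq).fun_mul
    (differentiableAt_j_neg hq.sq.norm_lt_one hq.ne_zero).hasDerivAt
  simpa only [(j_eq_zero_iff hq hq.ne_zero).2 ⟨1, (zpow_one q).symm⟩, zero_mul, add_zero] using h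

lemma hasResidueAt_F (hq : IsNome q) (hy : InAnnulus q y) (hz : InAnnulus q z) (hε : ε ^ 2 = 1) :
    HasResidueAt (fun w => F w y z q) ε (-(ε / 2)) := by
  have hp := hq.pow_four
  have hy2 := hy.sq_pow_four
  have hz2 := hz.sq_pow_four
  have hε0 : ε ≠ 0 := fun h => by simp [h] at hε
  have hsq : HasDerivAt (fun w : ℂ => w ^ 2) (2 * ε) ε := by simpa using hasDerivAt_pow 2 ε
  have heven := (show HasResidueAt (fun u => pairSum u (y ^ 2) (z ^ 2) (q ^ 4)) (ε ^ 2) (-1) from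
    hε ▸ hasResidueAt_pairSum hp hy2.sq_base hz2.sq_base).comp (g := fun w => w ^ 2) hsq
    (mul_ne_zero two_ne_zero hε0)
  have hodd : DifferentiableAt ℂ (fun w => q ^ 3 * w * y * z *
      pairSum (q ^ 4 * w ^ 2) (q ^ 4 * y ^ 2) (q ^ 4 * z ^ 2) (q ^ 4)) ε := by
    refine DifferentiableAt.mul (by fun_prop) (DifferentiableAt.comp
      (g := fun u => pairSum u (q ^ 4 * y ^ 2) (q ^ 4 * z ^ 2) (q ^ 4))
      (f := fun w : ℂ => q ^ 4 * w ^ 2) ε ?_ (by fun_prop))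
    rw [hε, mul_one]
    exact differentiableAt_pairSum_self hp (hy2.self_mul hp) (hz2.self_mul hp)
  simp only [F_eq_pairSum hq.ne_zero hy.ne_zero hz.ne_zero]
  convert heven.add (hasResidueAt_zero_of_continuousAt hodd.continuousAt) using 1
  field_simp
  linear_combination -hε

lemma hasResidueAt_crossTerm_left (hq : IsNome q) (hv : v ≠ 0) (hw : InAnnulus q w)
    (hε : ε ^ 2 = 1) : HasResidueAt (fun u => crossTerm u v w q) ε
      (-(ε / 2) * appellLerch (-(ε * q * v / w)) (q ^ 2) (-(ε * w))) := by
  have hε0 : ε ≠ 0 := fun h => by simp [h] at hε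
  have hp := hq.sq
  have hq0 := hq.ne_zero
  have hw0 := hw.ne_zero
  have hP2 := qPoch_self_ne_zero hp.norm_lt_one
  have hP4 := qPoch_self_ne_zero hq.pow_four.norm_lt_one
  have happell : DifferentiableAt ℂ (fun u => appellSum (v / q) (u * w) (q ^ 2)) ε :=
    (differentiableAt_appellSum_right hp (div_ne_zero hv hq0)
      (mul_ne_zero hε0 hw0)).comp (f := fun u : ℂ => u * w) ε (by fun_prop)
  have hderiv : HasDerivAt (fun u => j u (q ^ 2) * j (-u) (q ^ 2))
      (-2 * ε * (qPoch (q ^ 2) (q ^ 2) ^ 2 * qPoch (q ^ 4) (q ^ 4) ^ 2)) ε := by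
    simpa only [← pow_mul] using hasDerivAt_j_mul_j_neg_sign hp hε
  have hzero : j ε (q ^ 2) * j (-ε) (q ^ 2) = 0 := by
    have h := j_sign_mul_j_neg hε 1 (q ^ 2)
    rwa [mul_one, j_one hp.norm_lt_one, zero_mul] at h
  have hεw := (hw.sign_mul hε).sq_base
  have hj := hεw.j_ne_zero hp
  have hjn := hεw.neg.j_ne_zero hp
  have hres := (hasResidueAt_div (((differentiableAt_j_mul_const hp hε0 hw0).fun_mul
    happell).const_mul (qPoch (q ^ 2) (q ^ 2) ^ 2 * qPoch (q ^ 4) (q ^ 4) ^ 2)).continuousAt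
    hderiv hzero (by simp [hε0, hP2, hP4])).div_const (j (ε * w) (q ^ 2) * j (-(ε * w)) (q ^ 2))
  have harg : -(ε * q * v / w) * -(ε * w) / q ^ 2 = v / q := by
    field_simp
    exact hε
  rw [appellLerch_eq hp.ne_zero, harg, neg_neg]
  convert hres using 1
  · funext u
    rw [crossTerm, crossCoeff, j_sign_mul_j_neg hε]
    ring
  · field_simp
    linear_combination -appellSum (v / q) (ε * w) (q ^ 2) * hε

lemma hasResidueAt_crossTerm_mid (hq : IsNome q) (hy : y ≠ 0) (hz : z ≠ 0) :
    HasResidueAt (fun w => crossTerm y w z q) q (-q * crossCoeff y z q) := by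
  have hq0 := hq.ne_zero
  have h : HasResidueAt (fun a => appellSum a (y * z) (q ^ 2)) (q / q) (-1) := by
    rw [div_self hq0]
    exact hasResidueAt_appellSum hq.sq (mul_ne_zero hy hz)
  have hd : HasDerivAt (fun w => w / q) (1 / q) q := (hasDerivAt_id' q).div_const q
  convert (h.comp (g := fun w => w / q) hd (one_div_ne_zero hq0)).const_mul (crossCoeff y z q)
    using 1
  · rfl
  · rw [one_div, div_inv_eq_mul]
    ring

lemma hasResidueAt_thetaTerm {d : ℂ} (hq : IsNome q) (hx : x ≠ 0) (hy : y ≠ 0) (hz : z ≠ 0)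
    (hd : HasDerivAt (fun w => j w q * j (-w) (q ^ 2)) d x) (hd0 : d ≠ 0)
    (hjx : j x q * j (-x) (q ^ 2) = 0) : HasResidueAt (fun w => thetaTerm w y z q) x
      (thetaCoeff y z q * (j (x * y) (q ^ 2) * j (x * z) (q ^ 2) / d)) :=
  (hasResidueAt_div ((differentiableAt_j_mul_const hq.sq hx hy).mul
    (differentiableAt_j_mul_const hq.sq hx hz)).continuousAt hd hjx hd0).const_mul _

lemma thetaCoeff_eq (hq : IsNome q) (y z : ℂ) : thetaCoeff y z q =
    qPoch q q * qPoch (q ^ 2) (q ^ 2) ^ 7 * j (y * z) (q ^ 2) /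
      (j y (q ^ 2) * j (-y) (q ^ 2) * (j z (q ^ 2) * j (-z) (q ^ 2)) *
        (j (q * y) (q ^ 2) * j (q * z) (q ^ 2))) := by
  have hP := qPoch_self_ne_zero hq.norm_lt_one
  have hP2 := qPoch_self_ne_zero hq.sq.norm_lt_one
  have hj : ∀ x, j x q = qPoch q q * (j x (q ^ 2) * j (q * x) (q ^ 2)) /
      qPoch (q ^ 2) (q ^ 2) ^ 2 := fun x =>
    eq_div_of_mul_eq (pow_ne_zero 2 hP2) (j_even_mul_odd hq x).symm
  rw [thetaCoeff, hj y, hj z]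
  field_simp

lemma j_sign_mul_self_sq_ne_zero (hq : IsNome q) (hε : ε ^ 2 = 1) :
    j (-(ε * q)) (q ^ 2) ≠ 0 :=
  (hq.inAnnulus_sq.sign_mul hε).neg.j_ne_zero hq.sq

lemma hasResidueAt_thetaTerm_sign (hq : IsNome q) (hy : InAnnulus q y) (hz : InAnnulus q z)
    (hε : ε ^ 2 = 1) : HasResidueAt (fun w => thetaTerm w y z q) ε
      (-(ε / 2) * (qPoch (q ^ 2) (q ^ 2) ^ 3 * j (y * z) (q ^ 2) * j (-(ε * q)) (q ^ 2) /
        (j (-(ε * y)) (q ^ 2) * j (-(ε * z)) (q ^ 2) *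
          (j (q * y) (q ^ 2) * j (q * z) (q ^ 2))))) := by
  have hε0 : ε ≠ 0 := fun h => by simp [h] at hε
  have hP := qPoch_self_ne_zero hq.norm_lt_one
  have hP2 := qPoch_self_ne_zero hq.sq.norm_lt_one
  have hjq := j_sign_mul_self_sq_ne_zero hq hε
  have hεy := (hy.sign_mul hε).sq_base
  have hεz := (hz.sign_mul hε).sq_base
  have hjy := hεy.j_ne_zero hq.sq
  have hjz := hεz.j_ne_zero hq.sq
  have hjyn := hεy.neg.j_ne_zero hq.sq
  have hjzn := hεz.neg.j_ne_zero hq.sq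
  have hzero : j ε q * j (-ε) (q ^ 2) = 0 := by
    obtain rfl | rfl := sq_eq_one_iff.1 hε
    · rw [j_one hq.norm_lt_one, zero_mul]
    · rw [neg_neg, j_one hq.sq.norm_lt_one, mul_zero]
  convert hasResidueAt_thetaTerm hq hε0 hy.ne_zero hz.ne_zero
    (hasDerivAt_j_mul_j_neg_sq_base_sign hq hε) (div_ne_zero (by simp [hε0, hP, hP2]) hjq)
    hzero using 1
  rw [thetaCoeff_eq hq, ← j_sign_mul_j_neg hε y, ← j_sign_mul_j_neg hε z]
  field_simp
  linear_combination -(j (y * z) (q ^ 2) / (j (q * y) (q ^ 2) * j (q * z) (q ^ 2))) * hε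

lemma hasResidueAt_thetaTerm_self (hq : IsNome q) (hy : InAnnulus q y) (hz : InAnnulus q z) :
    HasResidueAt (fun w => thetaTerm w y z q) q (q * crossCoeff y z q) := by
  have hq0 := hq.ne_zero
  have hP := qPoch_self_ne_zero hq.norm_lt_one
  have hP2 := qPoch_self_ne_zero hq.sq.norm_lt_one
  have hP4 := qPoch_self_ne_zero hq.pow_four.norm_lt_one
  have hjq := j_neg_self_sq_eq hq
  have hjqy := (hy.self_mul hq).j_ne_zero hq.sq
  have hjqz := (hz.self_mul hq).j_ne_zero hq.sq
  convert hasResidueAt_thetaTerm hq hq0 hy.ne_zero hz.ne_zero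
    (hasDerivAt_j_mul_j_neg_sq_base_self hq) ?_ ?_ using 1
  · rw [thetaCoeff_eq hq, hjq, crossCoeff]
    field_simp
  · rw [hjq]
    positivity
  · rw [(j_eq_zero_iff hq hq0).2 ⟨1, (zpow_one q).symm⟩, zero_mul]

end Residues

section Main

variable {q x y z ε : ℂ}

lemma hasResidueAt_sub_regularG_sign (hq : IsNome q) (hy : InAnnulus q y) (hz : InAnnulus q z)
    (hε : ε ^ 2 = 1) : HasResidueAt (fun w => F w y z q - regularG w y z q) ε 0 := by
  have hε0 : ε ≠ 0 := fun h => by simp [h] at hε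
  have hq0 := hq.ne_zero
  have hjε : j (ε / q) (q ^ 2) ≠ 0 := by
    have hεq := hq.inAnnulus_sq.sign_mul hε
    have harg : ε / q = ε * q / q ^ 2 := by field_simp
    rw [harg]
    exact j_div_self_ne_zero hq.sq hεq.ne_zero (hεq.j_ne_zero hq.sq)
  have hmid := hasResidueAt_zero_of_continuousAt
    (differentiableAt_crossTerm_mid hq hy.ne_zero hε0 hz.ne_zero hjε).continuousAt
  have hG : HasResidueAt (fun w => regularG w y z q) ε _ :=
    ((hmid.add (hasResidueAt_crossTerm_left hq hy.ne_zero hz hε)).add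
      (hasResidueAt_thetaTerm_sign hq hy hz hε)).add
      (hasResidueAt_crossTerm_left hq hz.ne_zero hy hε)
  convert (hasResidueAt_F hq hy hz hε).sub hG using 1
  linear_combination -(ε / 2) * appellLerch_add_appellLerch hq hy hz hε

lemma hasResidueAt_sub_regularG_self (hq : IsNome q) (hy : InAnnulus q y) (hz : InAnnulus q z) :
    HasResidueAt (fun w => F w y z q - regularG w y z q) q 0 := by
  have hq0 := hq.ne_zero
  have hjq := hq.inAnnulus_sq.j_ne_zero hq.sq
  have hjqn := hq.inAnnulus_sq.neg.j_ne_zero hq.sq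
  have hF := hasResidueAt_zero_of_continuousAt
    (differentiableAt_F hq hq0 hy hz (j_sq_pow_four_ne_zero hq hjq hjqn)).continuousAt
  have hleft := hasResidueAt_zero_of_continuousAt
    (differentiableAt_crossTerm_left hq hq0 hy.ne_zero hz hjq hjqn).continuousAt
  have hright := hasResidueAt_zero_of_continuousAt
    (differentiableAt_crossTerm_left hq hq0 hz.ne_zero hy hjq hjqn).continuousAt
  have hG : HasResidueAt (fun w => regularG w y z q) q _ :=
    (((hasResidueAt_crossTerm_mid hq hy.ne_zero hz.ne_zero).add hleft).add
      (hasResidueAt_thetaTerm_self hq hy hz)).add hright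
  convert hF.sub hG using 1
  ring

lemma differentiableAt_sub_regularG (hq : IsNome q) (hx : x ≠ 0) (hy : InAnnulus q y)
    (hz : InAnnulus q z) (hjx : j x q ≠ 0) (hjxn : j (-x) (q ^ 2) ≠ 0) :
    DifferentiableAt ℂ (fun x => F x y z q - regularG x y z q) x := by
  have hjx2 := j_sq_base_ne_zero hq hjx
  exact (differentiableAt_F hq hx hy hz (j_sq_pow_four_ne_zero hq hjx2 hjxn)).sub
    ((((differentiableAt_crossTerm_mid hq hy.ne_zero hx hz.ne_zero
      (j_div_sq_base_ne_zero hq hx hjx)).add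
    (differentiableAt_crossTerm_left hq hx hy.ne_zero hz hjx2 hjxn)).add
    (differentiableAt_thetaTerm hq hx hy.ne_zero hz.ne_zero hjx hjxn)).add
    (differentiableAt_crossTerm_left hq hx hz.ne_zero hy hjx2 hjxn))

lemma exists_hasResidueAt_sub_regularG (hq : IsNome q) (hx : x ≠ 0) (hy : InAnnulus q y)
    (hz : InAnnulus q z) (h : ¬(j x q ≠ 0 ∧ j (-x) (q ^ 2) ≠ 0)) :
    ∃ c ≠ 0, (∃ n : ℤ, x = (q ^ 2) ^ n * c) ∧
      HasResidueAt (fun w => F w y z q - regularG w y z q) c 0 := by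
  have hsign : ∀ {ε : ℂ} {n : ℤ}, ε ^ 2 = 1 → x = (q ^ 2) ^ n * ε →
      ∃ c ≠ 0, (∃ n : ℤ, x = (q ^ 2) ^ n * c) ∧
        HasResidueAt (fun w => F w y z q - regularG w y z q) c 0 := fun hε hn =>
    ⟨_, fun h => by simp [h] at hε, ⟨_, hn⟩, hasResidueAt_sub_regularG_sign hq hy hz hε⟩
  rw [not_and_or, not_not, not_not, j_eq_zero_iff hq hx, j_eq_zero_iff hq.sq (neg_ne_zero.2 hx)]
    at h
  obtain ⟨n, hn⟩ | ⟨n, hn⟩ := h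
  · obtain ⟨k, rfl | rfl⟩ := Int.even_or_odd' n
    · exact hsign (n := k) (one_pow 2) (by rw [hn, mul_one, zpow_mul, zpow_ofNat])
    · exact ⟨q, hq.ne_zero, ⟨k, by rw [hn, zpow_add_one₀ hq.ne_zero, zpow_mul, zpow_ofNat]⟩,
        hasResidueAt_sub_regularG_self hq hy hz⟩
  · exact hsign (n := n) neg_one_sq (by rw [← hn, mul_neg_one, neg_neg])

lemma eventually_j_ne_zero_and_j_neg_ne_zero (hq : IsNome q) (hx : x ≠ 0) :
    ∀ᶠ w in 𝓝[≠] x, j w q ≠ 0 ∧ j (-w) (q ^ 2) ≠ 0 := by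
  have hneg := eventually_j_mul_const_ne_zero hq.sq hx (neg_ne_zero.2 one_ne_zero)
  simp only [mul_neg_one] at hneg
  exact (eventually_j_ne_zero hq hx).and hneg

theorem F_eq_regularG (hq : IsNome q) (hx : x ≠ 0) (hy : InAnnulus q y) (hz : InAnnulus q z)
    (hjx : j x q ≠ 0) (hjxn : j (-x) (q ^ 2) ≠ 0) : F x y z q = regularG x y z q := by
  rw [← sub_eq_zero]
  refine eq_zero_of_qShift (μ := fun x => q / (y * z) * x)
    (S := {x | j x q ≠ 0 ∧ j (-x) (q ^ 2) ≠ 0}) (D := fun x => F x y z q - regularG x y z q)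
    hq.sq (by fun_prop)
    (fun x hx => mul_ne_zero (div_ne_zero hq.ne_zero (mul_ne_zero hy.ne_zero hz.ne_zero)) hx)
    (by simp) (fun k => ?_) (fun x hx => eventually_j_ne_zero_and_j_neg_ne_zero hq hx)
    (fun x hS hx => differentiableAt_sub_regularG hq hx hy hz hS.1 hS.2)
    (fun x hS hx => sub_regularG_sq_mul hq hx hy hz hS.1 hS.2)
    (fun x hS hx => exists_hasResidueAt_sub_regularG hq hx hy hz hS) ⟨hjx, hjxn⟩ hx
  rw [mul_zero]
  exact (pow_ne_zero k hq.sq.ne_zero).symm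

theorem F_eq_G (hq : IsNome q) (hx : x ≠ 0) (hy : InAnnulus q y) (hz : InAnnulus q z)
    (hjx : j x q ≠ 0) (hjxn : j (-x) (q ^ 2) ≠ 0) (hxy : j (-(x * y)) (q ^ 2) ≠ 0)
    (hxz : j (-(x * z)) (q ^ 2) ≠ 0) : F x y z q = G x y z q := by
  rw [F_eq_regularG hq hx hy hz hjx hjxn, G_eq_regularG hq hx hy hz hxy hxz]

theorem tendsto_G (hq : IsNome q) (hx : x ≠ 0) (hy : InAnnulus q y) (hz : InAnnulus q z)
    (hjx : j x (q ^ 2) ≠ 0) (hjxn : j (-x) (q ^ 2) ≠ 0) :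
    Tendsto (fun w => G w y z q) (𝓝[≠] x) (𝓝 (F x y z q)) := by
  refine (tendsto_punctured (differentiableAt_F hq hx hy hz
    (j_sq_pow_four_ne_zero hq hjx hjxn)).continuousAt).congr' ?_
  filter_upwards [eventually_j_ne_zero_and_j_neg_ne_zero hq hx,
    eventually_j_mul_const_ne_zero hq.sq hx (neg_ne_zero.2 hy.ne_zero),
    eventually_j_mul_const_ne_zero hq.sq hx (neg_ne_zero.2 hz.ne_zero),
    eventually_punctured_ne hx] with w hw hwy hwz hw0
  rw [mul_neg] at hwy hwz
  exact F_eq_G hq hw0 hy hz hw.1 hw.2 hwy hwz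

lemma j_ne_zero_of_forall (hq : IsNome q) (hx : x ≠ 0)
    (h : ∀ n : ℤ, x ≠ q ^ (2 * n) ∧ x ≠ q ^ (2 * n + 1)) : j x q ≠ 0 := by
  rw [Ne, j_eq_zero_iff hq hx]
  rintro ⟨n, hn⟩
  obtain ⟨k, rfl | rfl⟩ := Int.even_or_odd' n
  · exact (h k).1 hn
  · exact (h k).2 hn

lemma j_sq_base_ne_zero_of_forall (hq : IsNome q) (hx : x ≠ 0) (h : ∀ n : ℤ, x ≠ q ^ (2 * n)) :
    j x (q ^ 2) ≠ 0 := by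
  rw [Ne, j_eq_zero_iff hq.sq hx]
  rintro ⟨n, hn⟩
  exact h n (by rw [hn, zpow_mul, zpow_ofNat])

lemma j_neg_sq_base_ne_zero_of_forall (hq : IsNome q) (hx : x ≠ 0)
    (h : ∀ n : ℤ, x ≠ -q ^ (2 * n)) : j (-x) (q ^ 2) ≠ 0 :=
  j_sq_base_ne_zero_of_forall hq (neg_ne_zero.2 hx) fun n hn => h n (by rw [← hn, neg_neg])

end Main

end TripleSum

end

theorem theorem2 (q : ℂ) (hq0 : q ≠ 0) (hq1 : ‖q‖ < 1) :
    (∀ x y z : ℂ, ‖q‖ < ‖x‖ → ‖x‖ < 1 → ‖q‖ < ‖y‖ → ‖y‖ < 1 → ‖q‖ < ‖z‖ → ‖z‖ < 1 →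
      HasSum (fun p : TripleSum.sameParityTriples => TripleSum.tripleTerm x y z q p)
        (TripleSum.G x y z q)) ∧
    (∀ x y z : ℂ, x ≠ 0 → (∀ n : ℤ, x ≠ q ^ (2 * n) ∧ x ≠ -q ^ (2 * n)) →
      ‖q‖ < ‖y‖ → ‖y‖ < 1 → ‖q‖ < ‖z‖ → ‖z‖ < 1 →
      Summable (fun p : TripleSum.sameSignPairs => TripleSum.evenTerm x y z q p) ∧
      Summable (fun p : TripleSum.sameSignPairs => TripleSum.oddTerm x y z q p) ∧
      -- literal equality wherever no denominator of `G` vanishes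
      ((∀ n : ℤ, x ≠ q ^ (2 * n + 1) ∧ x * y ≠ -q ^ (2 * n) ∧ x * z ≠ -q ^ (2 * n)) →
        TripleSum.F x y z q = TripleSum.G x y z q) ∧
      -- at the remaining points the singularity of `G` in `x` is removable, with value `F`
      Tendsto (fun w : ℂ => TripleSum.G w y z q) (𝓝[≠] x) (𝓝 (TripleSum.F x y z q))) := by
  have hq : TripleSum.IsNome q := ⟨hq0, hq1⟩
  refine ⟨fun x y z hx hx1 hy hy1 hz hz1 => ?_, fun x y z hx0 hx hy hy1 hz hz1 => ?_⟩
  · have hx : TripleSum.InAnnulus q x := ⟨hx, hx1⟩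
    have hy : TripleSum.InAnnulus q y := ⟨hy, hy1⟩
    have hz : TripleSum.InAnnulus q z := ⟨hz, hz1⟩
    rw [← TripleSum.F_eq_G hq hx.ne_zero hy hz (hx.j_ne_zero hq) (hx.sq_base.neg.j_ne_zero hq.sq)
      ((hx.mul hy).neg.j_ne_zero hq.sq) ((hx.mul hz).neg.j_ne_zero hq.sq)]
    exact TripleSum.hasSum_sameParityTriples hq hx hy hz
  · have hy : TripleSum.InAnnulus q y := ⟨hy, hy1⟩
    have hz : TripleSum.InAnnulus q z := ⟨hz, hz1⟩
    have hjx := TripleSum.j_sq_base_ne_zero_of_forall hq hx0 fun n => (hx n).1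
    have hjxn := TripleSum.j_neg_sq_base_ne_zero_of_forall hq hx0 fun n => (hx n).2
    refine ⟨TripleSum.summable_evenTerm hq hx0 hy hz, TripleSum.summable_oddTerm hq hx0 hy hz,
      fun h => ?_, TripleSum.tendsto_G hq hx0 hy hz hjx hjxn⟩
    exact TripleSum.F_eq_G hq hx0 hy hz
      (TripleSum.j_ne_zero_of_forall hq hx0 fun n => ⟨(hx n).1, (h n).1⟩) hjxn
      (TripleSum.j_neg_sq_base_ne_zero_of_forall hq (mul_ne_zero hx0 hy.ne_zero)
        fun n => (h n).2.1)
      (TripleSum.j_neg_sq_base_ne_zero_of_forall hq (mul_ne_zero hx0 hz.ne_zero)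
        fun n => (h n).2.2)
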